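/- All logarithms are to base 2, and \(\exp\) is the natural exponential. In \(\mathsf G(n,\frac12,k)\) a set \(K\) of \(k\) of the \(n\) vertices is chosen uniformly at random, all pairs inside \(K\) are joined, and every other pair is joined independently with probability \(\frac12\). An algorithm reads the graph through its adjacency matrix; reading an entry, drawing a uniformly random element of a list, tossing a biased coin, and any elementary vertex, list or arithmetic operation (comparisons with real thresholds included) take unit time. Non-integral sample sizes are rounded up. Consider the following algorithms. **Clique-Completion**\((G,S)\), for \(G\) on \(n\) vertices: let \(V'\) consist of \(S\) and of all vertices outside \(S\) that are adjacent to all of \(S\). Pick a uniformly random subset \(S'\subseteq V'\) of size \(2\log n\) and return \(S'\) together with all vertices of \(V'\setminus S'\) that are adjacent to all of \(S'\). **Keep-High-Degree-And-Complete**\((G,L)\), for \(G\) on \(n\) vertices: \(L\) times, sample a uniformly random vertex \(v\) of \(G\), compute \(\deg(v)\), and add \(v\) to a set \(S_C\) (initially empty) if \(\deg(v)\ge \frac n2+2\sqrt{n\log n}\). If \(|S_C|<2\log n\) (or if \(G\) has no vertices), declare failure. Otherwise return Clique-Completion\((G,S)\) for a uniformly random \(S\subseteq S_C\) of size \(2\log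 n\). **Subsample-And-Filter**\((G,k,p)\), for \(G\) on the vertex set \(V\) with \(|V|=n\): let \(V_1,V_2\subset V\) be two (arbitrary) disjoint sets fixed in advance, of size \(\lfloor n/2\rfloor\) each. Put each \(v\in V_1\) independently with probability \(p\) (truncated to \([0,1]\)) into a set \(S_P\). If \(|S_P|>pn\), return \(k\) uniformly random vertices of \(V\). Let \(S_F\) be the set of those \(v\in S_P\) whose number of neighbours in \(V_2\) lies between \(\frac{n+k}4-2\sqrt n\) and \(\frac{n+k}4+2\sqrt n\). Let \(S_C\) be the output of Keep-High-Degree-And-Complete\((G[S_F],|S_F|)\) (empty if it declares failure). If \(|S_C|<2\log n\), return \(k\) uniformly random vertices of \(V\). Otherwise return Clique-Completion\((G,S)\) for a uniformly random \(S\subseteq S_C\) of size \(2\log n\). **Theorem.** Let \(k=k(n)\le n\) satisfy \(k=\omega(\sqrt{n\log\log n})\) and \(k=o(\sqrt{n\log n})\), and set \(p=\frac{n\log n}{k^2}\exp\left(\frac{-k^2}{24n}\right)\). Then, on every graph with \(n\) vertices and for every outcome of the random choices, Subsample-And-Filter\((G,k,p)\) runs in time \[O(pn^2)=O\left(\frac{n^3\log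 n}{k^2}\exp\left(\frac{-k^2}{24n}\right)\right)=\widetilde O\left(\frac{n^2}{\exp\left(\frac{k^2}{24n}\right)}\right)=o(n^2),\] where \(\widetilde O(f)\) stands for \((\log n)^{d}\,O(f)\) with some constant \(d\). If \(G\) is drawn from \(\mathsf G(n,\frac12,k)\), then its output is the planted clique \(K\) except with probability at most \[O\left(\exp\left(\frac{-k^2}{48n}\right)\right)=O\left(\frac1{\log n}\right).\] -/

import Mathlib

open Filter Asymptotics

noncomputable section

namespace PlantedClique

/-! ### Randomized computations with adjacency queries and unit-cost steps -/

/-- A randomized computation that returns an element of `α` and that has access to an unknown graph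
on `V` only through queries to its adjacency matrix.  Apart from returning, each constructor is one
unit-cost operation:
* `step`: one elementary operation (comparison, arithmetic operation, list or counter update, ...);
* `query u v`: read the entry `(u, v)` of the adjacency matrix;
* `coin p`: toss a coin that shows `true` with probability `p`;
* `draw m`: draw a uniformly random element of `{0, …, m}`. -/
inductive Prog (V α : Type) : Type
  | ret (a : α) : Prog V α
  | step (next : Prog V α) : Prog V α
  | query (u v : V) (next : Bool → Prog V α) : Prog V α
  | coin (p : unitInterval) (next : Bool → Prog V α) : Prog V α
  | draw (m : ℕ) (next : Fin (m + 1) → Prog V α) : Prog V α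

namespace Prog

variable {V α β : Type}

/-- Sequential composition. -/
def bind : Prog V α → (α → Prog V β) → Prog V β
  | ret a, f => f a
  | step next, f => step (next.bind f)
  | query u v next, f => query u v fun b => (next b).bind f
  | coin p next, f => coin p fun b => (next b).bind f
  | draw m next, f => draw m fun i => (next i).bind f

instance : Monad (Prog V) where
  pure := ret
  bind := bind

/-- The law of the output of a computation on the graph with adjacency matrix `A`; all coins and
draws are independent. -/
def run (A : V → V → Bool) : Prog V α → PMF α
  | ret a => PMF.pure a
  | step next => next.run A
  | query u v next => (next (A u v)).run A
  | coin p next =>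
      (ProbabilityTheory.bernoulliMeasure true false p).toPMF.bind fun b => (next b).run A
  | draw m next => (PMF.uniformOfFintype (Fin (m + 1))).bind fun i => (next i).run A

/-- The running time (number of unit-cost operations) of a computation on the graph with adjacency
matrix `A`, in the worst case over all outcomes of the coins and draws. -/
def time (A : V → V → Bool) : Prog V α → ℕ
  | ret _ => 0
  | step next => next.time A + 1
  | query u v next => (next (A u v)).time A + 1
  | coin _ next => max ((next true).time A) ((next false).time A) + 1
  | draw _ next => (Finset.univ.sup fun i => (next i).time A) + 1

end Prog

/-! ### Basic routines

All data are lists and numbers.  Every pass through a loop, every comparison, every arithmetic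
operation and every insertion into a list is charged. -/

section Routines

variable {V : Type}

/-- One elementary operation. -/
def tick : Prog V Unit := .step (.ret ())

/-- `m` elementary operations. -/
def ticks : ℕ → Prog V Unit
  | 0 => .ret ()
  | m + 1 => .step (ticks m)

/-- Read the adjacency matrix. -/
def ask (u v : V) : Prog V Bool := .query u v .ret

/-- Toss a coin with success probability `p` (truncated to `[0, 1]`). -/
def flip (p : ℝ) : Prog V Bool := .coin (Set.projIcc 0 1 zero_le_one p) .ret

open Classical in
/-- One comparison of two numbers or of two vertices. -/
def test (P : Prop) : Prog V Bool := .step (.ret (decide P))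

/-- The length of a list, found by traversing it. -/
def size : List V → Prog V ℕ
  | [] => pure 0
  | _ :: l => do
      let m ← size l
      tick
      return m + 1

/-- Does `v` occur in the list? -/
def member (v : V) : List V → Prog V Bool
  | [] => pure false
  | u :: l => do
      tick
      if ← test (v = u) then return true else member v l

/-- The number of neighbours of `v` in the list. -/
def degreeInto (v : V) : List V → Prog V ℕ
  | [] => pure 0
  | u :: l => do
      tick
      let b ← ask u v
      let d ← degreeInto v l
      tick
      return if b then d + 1 else d

/-- Is `v` adjacent to all vertices of the list? -/
def adjacentToAll (v : V) : List V → Prog V Bool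
  | [] => pure true
  | u :: l => do
      tick
      if ← ask v u then adjacentToAll v l else return false

/-- The elements of the list that pass the (possibly random) test `t`. -/
def select (t : V → Prog V Bool) : List V → Prog V (List V)
  | [] => pure []
  | v :: l => do
      tick
      let b ← t v
      let rest ← select t l
      tick
      return if b then v :: rest else rest

/-- `m` elements of the list, drawn uniformly at random without replacement (the whole list if it
has fewer than `m` elements).  Finding and removing the drawn element is charged as a traversal. -/
def randomSubset : ℕ → List V → Prog V (List V)
  | 0, _ => pure []
  | _ + 1, [] => pure []
  | m + 1, v :: l => do
      let i ← Prog.draw l.length .ret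
      ticks (l.length + 2)
      let rest ← randomSubset m ((v :: l).eraseIdx i)
      return (v :: l).get i :: rest

end Routines

/-! ### The algorithms

An induced subgraph is given by the list of its vertices. -/

section Algorithms

variable {V : Type}

/-- The list `S` followed by all vertices of `vs` outside `S` that are adjacent to all of `S`. -/
def addCommonNeighbours (vs S : List V) : Prog V (List V) := do
  let new ← select (fun v => do
    if ← member v S then return false else adjacentToAll v S) vs
  ticks S.length
  return S ++ new

/-- The integer that `(1 + c) log n` stands for (logarithms are to base 2). -/
def seedSize (c : ℝ) (n : ℕ) : ℕ := ⌈(1 + c) * Real.logb 2 n⌉₊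

/-- `Clique-Completion` with constant `c`, on the subgraph induced by `vs`, from the known clique
vertices `S`. -/
def cliqueCompletion (c : ℝ) (vs S : List V) : Prog V (List V) := do
  let n ← size vs
  let V' ← addCommonNeighbours vs S
  tick
  let S' ← randomSubset (seedSize c n) V'
  addCommonNeighbours V' S'

/-- The sampling loop of `Keep-High-Degree-And-Complete`, on the subgraph induced by the nonempty
list `w :: ws`: repeatedly sample a vertex (with replacement), compute its degree, and put it into
the set `S` if the degree is at least `θ`. -/
def collectHighDegree (w : V) (ws : List V) (θ : ℝ) : ℕ → List V → Prog V (List V)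
  | 0, S => pure S
  | m + 1, S => do
      tick
      let i ← Prog.draw ws.length .ret
      let v := (w :: ws).get i
      let d ← degreeInto v (w :: ws)
      if ← test (θ ≤ (d : ℝ)) then
        if ← member v S then collectHighDegree w ws θ m S
        else
          tick
          collectHighDegree w ws θ m (v :: S)
      else collectHighDegree w ws θ m S

/-- `Keep-High-Degree-And-Complete`, on the subgraph induced by `vs`, with `L` sampled vertices;
`none` means that it declares failure. -/
def keepHighDegreeAndComplete (vs : List V) (L : ℕ) : Prog V (Option (List V)) :=
  match vs with
  | [] => pure none
  | w :: ws => do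
      let n ← size (w :: ws)
      tick
      let S ← collectHighDegree w ws
        ((n : ℝ) / 2 + 2 * Real.sqrt (n * Real.logb 2 n)) L []
      let s ← size S
      if ← test ((s : ℝ) < 2 * Real.logb 2 n) then return none
      else
        tick
        let seed ← randomSubset (seedSize 1 n) S
        let out ← cliqueCompletion 1 (w :: ws) seed
        return some out

/-- `Subsample-And-Filter` on a graph with vertex set `{0, …, n - 1}`, with clique size `k`,
subsampling fraction `p`, and the two disjoint halves `V₁` and `V₂` of the vertex set. -/
def subsampleAndFilter {n : ℕ} (V₁ V₂ : Finset (Fin n)) (k : ℕ) (p : ℝ) :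
    Prog (Fin n) (List (Fin n)) := do
  -- write down the two halves
  ticks n
  -- subsample
  let SP ← select (fun _ => flip p) V₁.toList
  let m ← size SP
  if ← test (p * n < (m : ℝ)) then randomSubset k (List.finRange n)
  else
    -- filter by the degree into the second half
    tick
    let Tl : ℝ := ((n : ℝ) + k) / 4 - 2 * Real.sqrt n
    let Td : ℝ := ((n : ℝ) + k) / 4 + 2 * Real.sqrt n
    let SF ← select (fun v => do
      let d ← degreeInto v V₂.toList
      let lower ← test (Tl ≤ (d : ℝ))
      let upper ← test ((d : ℝ) ≤ Td)
      return lower && upper) SP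
    let n' ← size SF
    -- high degree; a declared failure counts as finding no vertex
    let found ← keepHighDegreeAndComplete SF n'
    let SC : List (Fin n) := found.getD []
    let s ← size SC
    if ← test ((s : ℝ) < 2 * Real.logb 2 n) then randomSubset k (List.finRange n)
    else
      -- complete the clique
      tick
      let seed ← randomSubset (seedSize 1 n) SC
      cliqueCompletion 1 (List.finRange n) seed

end Algorithms

/-! ### The planted clique distribution, running time and failure probability -/

open Classical in
/-- The adjacency matrix of a graph. -/
def adjacency {V : Type} (G : SimpleGraph V) (u v : V) : Bool := decide (G.Adj u v)

/-- The graph obtained from `G` by joining all pairs of distinct vertices of `K`. -/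
def plant {V : Type} (K : Finset V) (G : SimpleGraph V) : SimpleGraph V :=
  G ⊔ SimpleGraph.fromRel fun u v => u ∈ K ∧ v ∈ K

instance {n : ℕ} : MeasurableSingletonClass (SimpleGraph (Fin n)) where
  measurableSet_singleton G := by
    have h : ({G} : Set (SimpleGraph (Fin n))) = SimpleGraph.edgeSet ⁻¹' {G.edgeSet} := by
      ext H
      simp
    rw [h]
    exact SimpleGraph.measurable_edgeSet (Set.toFinite _).measurableSet

/-- The law `G(n, 1/2)`: each edge is present independently with probability `1/2`. -/
def erdosRenyi (n : ℕ) : PMF (SimpleGraph (Fin n)) :=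
  (SimpleGraph.binomialRandom (Fin n) ⟨1 / 2, by norm_num, by norm_num⟩).toPMF

/-- The law of a uniformly random `k`-element set of vertices. -/
def uniformSubset (n k : ℕ) (h : k ≤ n) : PMF (Finset (Fin n)) :=
  PMF.uniformOfFinset (Finset.powersetCard k Finset.univ)
    (Finset.powersetCard_nonempty.2 (by simpa using h))

/-- The joint law of the planted clique `K` and of the graph `G ∼ G(n, 1/2, k)`. -/
def plantedClique (n k : ℕ) (h : k ≤ n) : PMF (Finset (Fin n) × SimpleGraph (Fin n)) :=
  (uniformSubset n k h).bind fun K => (erdosRenyi n).map fun G => (K, plant K G)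

/-- The worst-case running time over all input graphs on `n` vertices and all random outcomes. -/
def runningTime {n : ℕ} {α : Type} (P : Prog (Fin n) α) : ℕ :=
  Finset.univ.sup fun G : SimpleGraph (Fin n) => P.time (adjacency G)

/-- The probability, over `G ∼ G(n, 1/2, k)` and the randomness of the computation, that the output
is not the planted clique. -/
def failureProbability {n : ℕ} (k : ℕ) (h : k ≤ n) (P : Prog (Fin n) (List (Fin n))) : ℝ :=
  (((plantedClique n k h).bind fun KG =>
      (P.run (adjacency KG.2)).map fun S => (KG.1, S)).toOuterMeasure
    {x | x.2.toFinset ≠ x.1}).toReal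

end PlantedClique

end

/-! The mechanism. A clique vertex has about `(n + k) / 4` neighbours in `V₂`, with fluctuations of
order `√n`, so it passes the filter with probability at least 49/50. A vertex outside `K` has about
`n / 4` neighbours there and passes only after a deviation of `k / 4 - 2√n`, which by Hoeffding has
probability at most `q = exp(-4 (k/4 - 2√n)² / n)`. Let `M` be the number of sampled clique
vertices; with high probability `M ≥ m = pk/8`. Outside unlikely events, the filtered sample `W`
keeps `9/10 M` of them and has at most `B = p n q exp(k²/48n)` other vertices. Markov's inequality
for the latter fails with probability `exp(-k²/48n)`, the dominant error. The fraction `p` is just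
large enough that `B log n` is at most a constant times `m²`. Hence the clique part of `W` exceeds a
multiple of `√(|W| log |W|)`, and degrees inside `W` separate clique vertices from the others.

Independence. `W` depends only on the clique, on the sample and on pairs not inside `V₁`, while the
middle stage reads only pairs inside `V₁`. Since `G(n, 1/2)` is uniform on all graphs, independence
of disjoint sets of pairs is a bijection on pairs of graphs (`expect_merge`). If the degrees
separate, the seed of the middle stage is a function of the internal randomness and of `W ∩ K` only.
A vertex outside `K` is therefore adjacent to the whole seed with probability at most `|W|⁻²`, and a
union bound applies (`expect_keepHighDegreeAndComplete_random_le`). The last completion cannot be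
treated in this way, because the filter has already inspected the pairs meeting `V₂`. Instead, no
outside vertex sees `11/20` of the unfiltered clique sample, hence none sees more than `5/8` of the
filtered one, and `(5/8)^(2 log n)` is smaller than `1/n` by a power of `n`
(`expect_afterSampling_random_le`).

Averaging over the sample and over `K` uses Chebyshev's inequality twice
(`expect_select_flip_dev_le`, `expect_powersetCard_dev_le`). With `u = n^(1/8)`, the upper bound on
`k` gives `u⁻¹ ≤ exp(-k²/24n)`, so all the other errors, being multiples of `u⁻¹`, are absorbed. The
lower bound on `k` makes `exp(-k²/cn)` beat every power of `log n`.

Running time. At most `pn` vertices survive the size test. The filter reads `O(n)` entries for each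
of them, the middle stage is quadratic in their number, and the completions cost `O(n log² n)`,
which is below `pn²` because `p ≥ n^(-1/8)`. -/

open scoped BigOperators

noncomputable section

namespace PlantedClique

/-! ### Expectations and postconditions of randomized computations -/

namespace Prog

variable {V α β : Type}

/-- The expectation of `f` of the output of a computation on the graph with adjacency matrix `A`. -/
def expect (A : V → V → Bool) : Prog V α → (α → ℝ) → ℝ
  | ret a, f => f a
  | step next, f => next.expect A f
  | query u v next, f => (next (A u v)).expect A f
  | coin p next, f => (p : ℝ) * (next true).expect A f + (1 - p) * (next false).expect A f
  | draw m next, f => (∑ i, (next i).expect A f) / (m + 1)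

/-- Every possible output of the computation satisfies `Q`. -/
def Ensures (A : V → V → Bool) : Prog V α → (α → Prop) → Prop
  | ret a, Q => Q a
  | step next, Q => next.Ensures A Q
  | query u v next, Q => (next (A u v)).Ensures A Q
  | coin _ next, Q => ∀ b, (next b).Ensures A Q
  | draw _ next, Q => ∀ i, (next i).Ensures A Q

/-- The computation does not read the adjacency matrix. -/
def QueryFree : Prog V α → Prop
  | ret _ => True
  | step next => next.QueryFree
  | query _ _ _ => False
  | coin _ next => ∀ b, (next b).QueryFree
  | draw _ next => ∀ i, (next i).QueryFree

variable {A : V → V → Bool}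

@[simp] lemma pure_eq (a : α) : (pure a : Prog V α) = ret a := rfl

@[simp] lemma bind_eq (P : Prog V α) (f : α → Prog V β) : P >>= f = P.bind f := rfl

@[simp] lemma ret_bind (a : α) (f : α → Prog V β) : (ret a).bind f = f a := rfl

@[simp] lemma step_bind (P : Prog V α) (f : α → Prog V β) :
    (step P).bind f = step (P.bind f) := rfl

@[simp] lemma query_bind (u v : V) (P : Bool → Prog V α) (f : α → Prog V β) :
    (query u v P).bind f = query u v fun b => (P b).bind f := rfl

@[simp] lemma coin_bind (p : unitInterval) (P : Bool → Prog V α) (f : α → Prog V β) :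
    (coin p P).bind f = coin p fun b => (P b).bind f := rfl

@[simp] lemma draw_bind (m : ℕ) (P : Fin (m + 1) → Prog V α) (f : α → Prog V β) :
    (draw m P).bind f = draw m fun i => (P i).bind f := rfl

@[simp] lemma expect_ret (a : α) (f : α → ℝ) : (ret a : Prog V α).expect A f = f a := rfl

@[simp] lemma expect_step (P : Prog V α) (f : α → ℝ) : (step P).expect A f = P.expect A f := rfl

@[simp] lemma expect_query (u v : V) (P : Bool → Prog V α) (f : α → ℝ) :
    (query u v P).expect A f = (P (A u v)).expect A f := rfl

@[simp] lemma expect_coin (p : unitInterval) (P : Bool → Prog V α) (f : α → ℝ) :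
    (coin p P).expect A f = (p : ℝ) * (P true).expect A f + (1 - p) * (P false).expect A f := rfl

@[simp] lemma expect_draw (m : ℕ) (P : Fin (m + 1) → Prog V α) (f : α → ℝ) :
    (draw m P).expect A f = (∑ i, (P i).expect A f) / (m + 1) := rfl

@[simp] lemma ensures_ret (a : α) (Q : α → Prop) : (ret a : Prog V α).Ensures A Q ↔ Q a := Iff.rfl

@[simp] lemma ensures_step (P : Prog V α) (Q : α → Prop) :
    (step P).Ensures A Q ↔ P.Ensures A Q := Iff.rfl

@[simp] lemma ensures_query (u v : V) (P : Bool → Prog V α) (Q : α → Prop) :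
    (query u v P).Ensures A Q ↔ (P (A u v)).Ensures A Q := Iff.rfl

@[simp] lemma ensures_draw (m : ℕ) (P : Fin (m + 1) → Prog V α) (Q : α → Prop) :
    (draw m P).Ensures A Q ↔ ∀ i, (P i).Ensures A Q := Iff.rfl

@[simp] lemma time_ret (a : α) : (ret a : Prog V α).time A = 0 := rfl

@[simp] lemma time_step (P : Prog V α) : (step P).time A = P.time A + 1 := rfl

@[simp] lemma time_query (u v : V) (P : Bool → Prog V α) :
    (query u v P).time A = (P (A u v)).time A + 1 := rfl

@[simp] lemma time_coin (p : unitInterval) (P : Bool → Prog V α) :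
    (coin p P).time A = max ((P true).time A) ((P false).time A) + 1 := rfl

@[simp] lemma time_draw (m : ℕ) (P : Fin (m + 1) → Prog V α) :
    (draw m P).time A = (Finset.univ.sup fun i => (P i).time A) + 1 := rfl

@[simp] lemma queryFree_step (P : Prog V α) : (step P).QueryFree ↔ P.QueryFree := Iff.rfl

@[simp] lemma queryFree_draw (m : ℕ) (P : Fin (m + 1) → Prog V α) :
    (draw m P).QueryFree ↔ ∀ i, (P i).QueryFree := Iff.rfl

lemma QueryFree.bind {P : Prog V α} {f : α → Prog V β} (hP : P.QueryFree)
    (hf : ∀ a, (f a).QueryFree) : (P.bind f).QueryFree := by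
  induction P with
  | ret a => exact hf a
  | step P ih => exact ih hP
  | query u v P ih => exact hP.elim
  | coin p P ih => exact fun b => ih b (hP b)
  | draw m P ih => exact fun i => ih i (hP i)

/-- Coins and draws do not see the graph, so the expectation may be evaluated with a dummy matrix.
This is how independence of the sample or of the seed from the graph is expressed. -/
lemma QueryFree.expect_eq {P : Prog V α} (hP : P.QueryFree) (A B : V → V → Bool) (f : α → ℝ) :
    P.expect A f = P.expect B f := by
  induction P with
  | ret a => rfl
  | step P ih => exact ih hP
  | query u v P ih => exact hP.elim
  | coin p P ih => simp [ih _ (hP _)]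
  | draw m P ih => simp [ih _ (hP _)]

@[simp] lemma expect_bind (P : Prog V α) (f : α → Prog V β) (g : β → ℝ) :
    (P.bind f).expect A g = P.expect A fun a => (f a).expect A g := by
  induction P with
  | ret a => rfl
  | step P ih => simpa using ih
  | query u v P ih => simpa using ih _
  | coin p P ih => simp [ih]
  | draw m P ih => simp [ih]

lemma Ensures.mono {P : Prog V α} {Q R : α → Prop} (h : P.Ensures A Q) (hQR : ∀ a, Q a → R a) :
    P.Ensures A R := by
  induction P with
  | ret a => exact hQR _ h
  | step P ih => exact ih h
  | query u v P ih => exact ih _ h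
  | coin p P ih => exact fun b => ih b (h b)
  | draw m P ih => exact fun i => ih i (h i)

lemma Ensures.bind {P : Prog V α} {f : α → Prog V β} {Q : α → Prop} {R : β → Prop}
    (h : P.Ensures A Q) (hf : ∀ a, Q a → (f a).Ensures A R) : (P.bind f).Ensures A R := by
  induction P with
  | ret a => exact hf _ h
  | step P ih => exact ih h
  | query u v P ih => exact ih _ h
  | coin p P ih => exact fun b => ih b (h b)
  | draw m P ih => exact fun i => ih i (h i)

lemma Ensures.expect_mono {P : Prog V α} {Q : α → Prop} {f g : α → ℝ} (h : P.Ensures A Q)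
    (hfg : ∀ a, Q a → f a ≤ g a) : P.expect A f ≤ P.expect A g := by
  induction P with
  | ret a => exact hfg _ h
  | step P ih => exact ih h
  | query u v P ih => exact ih _ h
  | coin p P ih =>
    have h1 := ih true (h true)
    have h2 := ih false (h false)
    have := p.2.1
    have := p.2.2
    simp only [expect_coin]
    gcongr
  | draw m P ih =>
    simp only [expect_draw]
    gcongr with i
    exact ih i (h i)

lemma ensures_true (P : Prog V α) : P.Ensures A fun _ => True := by
  induction P with
  | ret a => trivial
  | step P ih => exact ih
  | query u v P ih => exact ih _
  | coin p P ih => exact ih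
  | draw m P ih => exact ih

lemma expect_mono {P : Prog V α} {f g : α → ℝ} (hfg : ∀ a, f a ≤ g a) :
    P.expect A f ≤ P.expect A g :=
  P.ensures_true.expect_mono fun a _ => hfg a

lemma Ensures.expect_congr {P : Prog V α} {Q : α → Prop} {f g : α → ℝ} (h : P.Ensures A Q)
    (hfg : ∀ a, Q a → f a = g a) : P.expect A f = P.expect A g :=
  le_antisymm (h.expect_mono fun a ha => (hfg a ha).le) (h.expect_mono fun a ha => (hfg a ha).ge)

@[simp] lemma expect_const (P : Prog V α) (c : ℝ) : P.expect A (fun _ => c) = c := by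
  induction P with
  | ret a => rfl
  | step P ih => exact ih
  | query u v P ih => exact ih _
  | coin p P ih => simp [ih]; ring
  | draw m P ih => simp [ih]; field_simp

lemma expect_add (P : Prog V α) (f g : α → ℝ) :
    P.expect A (fun a => f a + g a) = P.expect A f + P.expect A g := by
  induction P with
  | ret a => rfl
  | step P ih => exact ih
  | query u v P ih => exact ih _
  | coin p P ih => simp [ih]; ring
  | draw m P ih => simp [ih, Finset.sum_add_distrib, add_div]

lemma expect_const_mul (P : Prog V α) (c : ℝ) (f : α → ℝ) :
    P.expect A (fun a => c * f a) = c * P.expect A f := by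
  induction P with
  | ret a => rfl
  | step P ih => exact ih
  | query u v P ih => exact ih _
  | coin p P ih => simp [ih]; ring
  | draw m P ih => simp [ih, ← Finset.mul_sum, mul_div_assoc]

lemma expect_sum {ι : Type*} (P : Prog V α) (s : Finset ι) (f : ι → α → ℝ) :
    P.expect A (fun a => ∑ i ∈ s, f i a) = ∑ i ∈ s, P.expect A (f i) := by
  classical
  induction s using Finset.induction_on with
  | empty => simp
  | insert i s hi ih => simp [Finset.sum_insert hi, expect_add, ih]

/-- Exchanges internal randomness with a finite average. For query-free computations the graph can
then be averaged first, with the sample or the seed held fixed. -/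
lemma expect_finset_expect {ι : Type*} (P : Prog V α) (s : Finset ι) (f : ι → α → ℝ) :
    P.expect A (fun a => 𝔼 i ∈ s, f i a) = 𝔼 i ∈ s, P.expect A (f i) := by
  simp only [Finset.expect_eq_sum_div_card, div_eq_inv_mul, expect_const_mul, expect_sum]

lemma expect_nonneg {P : Prog V α} {f : α → ℝ} (hf : ∀ a, 0 ≤ f a) : 0 ≤ P.expect A f := by
  simpa using expect_mono (P := P) (A := A) hf

lemma Ensures.expect_le {P : Prog V α} {Q : α → Prop} {f : α → ℝ} {c : ℝ} (h : P.Ensures A Q)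
    (hf : ∀ a, Q a → f a ≤ c) : P.expect A f ≤ c := by
  simpa using h.expect_mono (g := fun _ => c) hf

lemma Ensures.expect_eq {P : Prog V α} {a : α} (h : P.Ensures A (· = a)) (f : α → ℝ) :
    P.expect A f = f a := by
  simpa using h.expect_congr (f := f) (g := fun _ => f a) (by rintro b rfl; rfl)

/-- The continuation has to be bounded only on outputs that can occur, so length bounds on
intermediate lists suffice for all running times. -/
lemma Ensures.time_bind_le {P : Prog V α} {f : α → Prog V β} {Q : α → Prop} {t : ℕ}
    (h : P.Ensures A Q) (hf : ∀ a, Q a → (f a).time A ≤ t) :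
    (P.bind f).time A ≤ P.time A + t := by
  induction P with
  | ret a => simpa using hf _ h
  | step P ih => have := ih h; simp; omega
  | query u v P ih => have := ih _ h; simp; omega
  | coin p P ih =>
    have h1 := ih _ (h true)
    have h2 := ih _ (h false)
    simp; omega
  | draw m P ih =>
    simp only [draw_bind, time_draw]
    have : (Finset.univ.sup fun i => ((P i).bind f).time A) ≤
        (Finset.univ.sup fun i => (P i).time A) + t := by
      refine Finset.sup_le fun i _ => (ih i (h i)).trans ?_
      gcongr
      exact Finset.le_sup (f := fun i => (P i).time A) (Finset.mem_univ i)
    omega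

lemma time_bind_le {P : Prog V α} {f : α → Prog V β} {t : ℕ}
    (hf : ∀ a, (f a).time A ≤ t) : (P.bind f).time A ≤ P.time A + t :=
  P.ensures_true.time_bind_le fun a _ => hf a

/-- The bridge from the measure-theoretic law of the output to the recursive real-valued
expectation; measures are not needed for computations after this. -/
lemma toOuterMeasure_run_toReal (P : Prog V α) (s : Set α) :
    ((P.run A).toOuterMeasure s).toReal = P.expect A (s.indicator 1) := by
  classical
  have fin : ∀ (P : Prog V α), (P.run A).toOuterMeasure s ≠ ⊤ := fun P =>
    ne_top_of_le_ne_top ENNReal.one_ne_top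
      (((P.run A).toOuterMeasure.mono (Set.subset_univ s)).trans_eq
        (((P.run A).toOuterMeasure_apply_eq_one_iff _).2 (Set.subset_univ _)))
  induction P with
  | ret a => by_cases h : a ∈ s <;> simp [run, h]
  | step P ih => exact ih
  | query u v P ih => exact ih _
  | coin p P ih =>
    have e : ∀ b : Bool, (ProbabilityTheory.bernoulliMeasure true false p).toPMF b =
        ENNReal.ofReal (if b then (p : ℝ) else 1 - p) := by
      intro b
      rw [MeasureTheory.Measure.toPMF_apply,
        ProbabilityTheory.bernoulliMeasure_apply _ (MeasurableSet.singleton _)]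
      cases b
      · simp
        rw [ENNReal.ofReal]; congr 1; ext
        simpa using p.2.2
      · simp
        rw [ENNReal.ofReal]; congr 1; ext
        have := p.2.1
        simp [this]
    simp only [run, PMF.toOuterMeasure_bind_apply, tsum_fintype, Fintype.sum_bool, e]
    rw [ENNReal.toReal_add (ENNReal.mul_ne_top ENNReal.ofReal_ne_top (fin _))
      (ENNReal.mul_ne_top ENNReal.ofReal_ne_top (fin _))]
    simp [ih, ENNReal.toReal_ofReal p.2.1, ENNReal.toReal_ofReal (sub_nonneg.2 p.2.2)]
  | draw m P ih =>
    simp only [run, PMF.toOuterMeasure_bind_apply, tsum_fintype, PMF.uniformOfFintype_apply]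
    rw [ENNReal.toReal_sum fun i _ => ENNReal.mul_ne_top (by simp) (fin _)]
    simp only [ENNReal.toReal_mul, ih, ← Finset.mul_sum]
    simp [div_eq_inv_mul]
    left
    norm_cast

end Prog

/-! ### Outputs and running times of the basic routines -/

section Routines

open Prog

variable {V α : Type} {A : V → V → Bool}

@[simp] lemma expect_ticks (m : ℕ) (f : Unit → ℝ) : (ticks m : Prog V Unit).expect A f = f () := by
  induction m with
  | zero => rfl
  | succ m ih => simpa [ticks] using ih

@[simp] lemma time_ticks (m : ℕ) : (ticks m : Prog V Unit).time A = m := by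
  induction m with
  | zero => rfl
  | succ m ih => simpa [ticks] using ih

lemma queryFree_ticks (m : ℕ) : (ticks m : Prog V Unit).QueryFree := by
  induction m with
  | zero => trivial
  | succ m ih => simpa [ticks] using ih

open Classical in
lemma test_bind (P : Prop) (f : Bool → Prog V α) : (test P).bind f = step (f (decide P)) := rfl

lemma tick_bind (f : Unit → Prog V α) : (tick : Prog V Unit).bind f = step (f ()) := rfl

lemma ask_bind (u v : V) (f : Bool → Prog V α) : (ask u v).bind f = query u v f := rfl

lemma ensures_size (l : List V) : (size l).Ensures A (· = l.length) := by
  induction l with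
  | nil => rfl
  | cons v l ih => exact ih.bind fun a ha => by simp [tick_bind, ha]

lemma time_size_le (l : List V) : (size l).time A ≤ l.length := by
  induction l with
  | nil => simp [size]
  | cons v l ih =>
    exact (time_bind_le (t := 1) fun a => by simp [tick_bind]).trans (by simpa using ih)

lemma ensures_member (v : V) (l : List V) : (member v l).Ensures A (· = true ↔ v ∈ l) := by
  induction l with
  | nil => simp [member]
  | cons u l ih =>
    simp only [member, bind_eq, tick_bind, test_bind]
    by_cases h : v = u
    · simp [h]
    · simpa [h] using ih

lemma time_member_le (v : V) (l : List V) : (member v l).time A ≤ 2 * l.length := by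
  induction l with
  | nil => simp [member]
  | cons u l ih =>
    simp only [member, bind_eq, tick_bind, test_bind]
    by_cases h : v = u
    · simp [h]
    · simp [h]; omega

lemma ensures_degreeInto (v : V) (l : List V) :
    (degreeInto v l).Ensures A (· = l.countP fun u => A u v) := by
  induction l with
  | nil => rfl
  | cons u l ih =>
    simp only [degreeInto, bind_eq, tick_bind, ask_bind]
    refine ih.bind fun d hd => ?_
    by_cases h : A u v <;> simp [h, hd]

lemma time_degreeInto_le (v : V) (l : List V) : (degreeInto v l).time A ≤ 3 * l.length := by
  induction l with
  | nil => simp [degreeInto]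
  | cons u l ih =>
    simp only [degreeInto, bind_eq, tick_bind, ask_bind]
    have := time_bind_le (P := degreeInto v l) (A := A) (t := 1)
      (f := fun d => step (pure (if A u v = true then d + 1 else d))) fun a => by simp
    simp at this ⊢
    omega

lemma ensures_adjacentToAll (v : V) (l : List V) :
    (adjacentToAll v l).Ensures A (· = l.all (A v)) := by
  induction l with
  | nil => rfl
  | cons u l ih =>
    simp only [adjacentToAll, bind_eq, tick_bind, ask_bind]
    by_cases h : A v u
    · simpa [h] using ih
    · simp [h]

lemma time_adjacentToAll_le (v : V) (l : List V) :
    (adjacentToAll v l).time A ≤ 2 * l.length := by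
  induction l with
  | nil => simp [adjacentToAll]
  | cons u l ih =>
    simp only [adjacentToAll, bind_eq, tick_bind, ask_bind]
    by_cases h : A v u
    · simp [h]; omega
    · simp [h]

lemma ensures_select (t : V → Prog V Bool) (l : List V) (τ : V → Bool)
    (h : ∀ v ∈ l, (t v).Ensures A (· = τ v)) : (select t l).Ensures A (· = l.filter τ) := by
  induction l with
  | nil => simp [select]
  | cons v l ih =>
    simp only [select, bind_eq, tick_bind, ensures_step]
    refine (h v (by simp)).bind ?_
    rintro b rfl
    refine (ih fun v hv => h v (by simp [hv])).bind ?_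
    rintro r rfl
    cases hb : τ v <;> simp [hb]

lemma ensures_select_sublist (t : V → Prog V Bool) (l : List V) :
    (select t l).Ensures A (List.Sublist · l) := by
  induction l with
  | nil => simp [select]
  | cons v l ih =>
    simp only [select, bind_eq, tick_bind, ensures_step]
    refine (ensures_true _).bind fun b _ => ih.bind fun r hr => ?_
    cases b
    · simpa using hr.cons v
    · simpa using hr.cons_cons v

lemma time_select_le (t : V → Prog V Bool) (l : List V) (c : ℕ)
    (h : ∀ v ∈ l, (t v).time A ≤ c) : (select t l).time A ≤ l.length * (c + 2) := by
  induction l with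
  | nil => simp [select]
  | cons v l ih =>
    have ih := ih fun v hv => h v (by simp [hv])
    simp only [select, bind_eq, tick_bind, time_step]
    have h1 := time_bind_le (P := t v) (A := A) (t := l.length * (c + 2) + 1)
      (f := fun b => (select t l).bind fun r => step (pure (if b = true then v :: r else r)))
      fun b => (time_bind_le (t := 1) fun r => by simp).trans (by omega)
    have := h v (by simp)
    simp only [List.length_cons]
    nlinarith

lemma queryFree_randomSubset (m : ℕ) (l : List V) : (randomSubset m l).QueryFree := by
  induction m generalizing l with
  | zero => trivial
  | succ m ih =>
    cases l with
    | nil => trivial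
    | cons v l =>
      simp only [randomSubset, bind_eq, draw_bind, ret_bind, queryFree_draw]
      exact fun i => (queryFree_ticks _).bind fun _ => (ih _).bind fun _ => trivial

lemma length_eraseIdx_fin {l : List V} {m : ℕ} (h : l.length = m + 1) (i : Fin (m + 1)) :
    (l.eraseIdx i).length = m := by
  rw [List.length_eraseIdx_of_lt (by omega), h, Nat.add_sub_cancel]

/-- `Subperm` rather than mere inclusion records multiplicities, so that duplicate-freeness passes
to the drawn list. -/
lemma ensures_randomSubset (m : ℕ) (l : List V) :
    (randomSubset m l).Ensures A fun r => r.Subperm l ∧ r.length = min m l.length := by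
  induction m generalizing l with
  | zero => simp [randomSubset]
  | succ m ih =>
    cases l with
    | nil => simp [randomSubset]
    | cons v l =>
      simp only [randomSubset, bind_eq, draw_bind, ret_bind, ensures_draw]
      intro i
      refine (ensures_true _).bind fun _ _ => (ih _).bind fun r hr => ?_
      rw [length_eraseIdx_fin (by simp)] at hr
      constructor
      · have : ((v :: l).get i :: (v :: l).eraseIdx i).Perm (v :: l) :=
          List.getElem_cons_eraseIdx_perm i.2
        exact ((List.subperm_cons _).2 hr.1).trans this.subperm
      · simp [hr.2]

lemma time_randomSubset_le (m : ℕ) (l : List V) :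
    (randomSubset m l).time A ≤ m * (l.length + 3) := by
  induction m generalizing l with
  | zero => simp [randomSubset]
  | succ m ih =>
    cases l with
    | nil => simp [randomSubset]
    | cons v l =>
      simp only [randomSubset, bind_eq, draw_bind, ret_bind, time_draw]
      have : (Finset.univ.sup fun i : Fin (l.length + 1) =>
          ((ticks (l.length + 2) : Prog V Unit).bind fun _ =>
            (randomSubset m ((v :: l).eraseIdx i)).bind fun rest =>
              pure ((v :: l).get i :: rest)).time A) ≤ l.length + 2 + m * (l.length + 3) := by
        refine Finset.sup_le fun i _ => ?_
        refine (time_bind_le (t := m * (l.length + 3)) fun _ => ?_).trans (by simp)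
        refine (time_bind_le (t := 0) fun _ => by simp).trans ?_
        exact (ih _).trans_eq (by rw [length_eraseIdx_fin (by simp)])
      refine (Nat.add_le_add_right this 1).trans ?_
      simp only [List.length_cons]
      nlinarith

lemma sum_get_eq (f : V → ℝ) (l : List V) :
    ∑ i : Fin l.length, f (l.get i) = (l.map f).sum := by
  simp

lemma sum_map_boole (D : V → Bool) (l : List V) :
    (l.map fun v => if D v then (1 : ℝ) else 0).sum = l.countP D := by
  induction l with
  | nil => simp
  | cons v l ih =>
    rw [List.map_cons, List.sum_cons, ih, List.countP_cons]
    split_ifs <;> push_cast <;> ring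

/-- The probability that all elements of a random subset have a property is at most what it would
be for draws with replacement. -/
lemma expect_randomSubset_all_le (D : V → Bool) (m : ℕ) (l : List V) (hm : m ≤ l.length) :
    (randomSubset m l).expect A (fun r => if r.all D then 1 else 0) ≤
      ((l.countP D : ℝ) / l.length) ^ m := by
  induction m generalizing l with
  | zero => simp [randomSubset]
  | succ m ih =>
    cases l with
    | nil => simp at hm
    | cons v l =>
      simp only [randomSubset, bind_eq, draw_bind, ret_bind, expect_draw, expect_bind,
        expect_ticks, pure_eq, expect_ret]
      have hm : m ≤ l.length := by simpa using hm
      have hstep : ∀ i : Fin (l.length + 1),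
          (randomSubset m ((v :: l).eraseIdx i)).expect A
            (fun r => if ((v :: l).get i :: r).all D then 1 else 0) ≤
          (if D ((v :: l).get i) then (1 : ℝ) else 0) *
            (((v :: l).countP D : ℝ) / (v :: l).length) ^ m := by
        intro i
        have hlen : ((v :: l).eraseIdx i).length = l.length := length_eraseIdx_fin (by simp) i
        have hp : ((v :: l).get i :: (v :: l).eraseIdx i).Perm (v :: l) :=
          List.getElem_cons_eraseIdx_perm i.2
        generalize (v :: l).get i = u at *
        generalize (v :: l).eraseIdx i = r at *
        by_cases hD : D u = true
        · have hc : (v :: l).countP D = r.countP D + 1 := by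
            rw [← hp.countP_eq, List.countP_cons, if_pos hD]
          simp only [List.all_cons, hD, Bool.true_and, if_true, one_mul]
          refine (ih r (hm.trans hlen.ge)).trans ?_
          rw [hlen, hc, List.length_cons]
          -- For `m = 0` the tail may be empty and the quotient degenerate. Otherwise, with `c` good
          -- elements among `N`, the claim is `(c - 1) / (N - 1) ≤ c / N`, true since `c ≤ N`.
          rcases Nat.eq_zero_or_pos m with rfl | hmpos
          · simp
          have hl : (0 : ℝ) < l.length := by exact_mod_cast hmpos.trans_le hm
          have hle : (r.countP D : ℝ) ≤ l.length := by
            rw [← hlen]; exact_mod_cast List.countP_le_length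
          refine pow_le_pow_left₀ (by positivity) ?_ m
          rw [div_le_div_iff₀ hl (by positivity)]
          push_cast
          nlinarith
        · simp [hD]
      have : (∑ i : Fin (l.length + 1), (randomSubset m ((v :: l).eraseIdx i)).expect A
            (fun r => if ((v :: l).get i :: r).all D then (1 : ℝ) else 0)) ≤
          ((v :: l).countP D : ℝ) * (((v :: l).countP D : ℝ) / (v :: l).length) ^ m := by
        refine (Finset.sum_le_sum fun i _ => hstep i).trans_eq ?_
        rw [← Finset.sum_mul]
        congr 1
        rw [← sum_map_boole]
        exact sum_get_eq (fun v => if D v then (1 : ℝ) else 0) (v :: l)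
      refine (div_le_div_of_nonneg_right this (by positivity)).trans ?_
      rw [pow_succ, List.length_cons]
      push_cast
      exact le_of_eq (by ring)

/-- The common neighbours of `S` in `vs`, outside of `S`. -/
lemma ensures_addCommonNeighbours (vs S : List V) :
    (addCommonNeighbours vs S).Ensures A fun out =>
      ∃ new : List V, new.Sublist vs ∧ out = S ++ new ∧
        ∀ v, v ∈ new ↔ v ∈ vs ∧ v ∉ S ∧ ∀ u ∈ S, A v u = true := by
  classical
  simp only [addCommonNeighbours, bind_eq]
  refine (ensures_select _ vs (fun v => decide (v ∉ S) && S.all (A v)) fun v _ => ?_).bind ?_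
  · refine (ensures_member v S).bind fun b hb => ?_
    cases b
    · have hv : v ∉ S := by simpa using hb
      simpa [hv] using ensures_adjacentToAll (A := A) v S
    · have hv : v ∈ S := by simpa using hb
      simp [hv]
  · rintro _ rfl
    refine (ensures_true _).bind fun _ _ => ?_
    refine ⟨_, List.filter_sublist, rfl, fun v => ?_⟩
    simp

lemma time_addCommonNeighbours_le (vs S : List V) :
    (addCommonNeighbours vs S).time A ≤ vs.length * (4 * S.length + 2) + S.length := by
  simp only [addCommonNeighbours, bind_eq]
  refine (time_bind_le (t := S.length) fun _ => ?_).trans ?_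
  · exact (time_bind_le (t := 0) fun _ => by simp).trans (by simp)
  · gcongr
    refine time_select_le _ _ _ fun v _ => ?_
    refine (time_bind_le (t := 2 * S.length) fun b => ?_).trans
      ((Nat.add_le_add_right (time_member_le v S) _).trans (by omega))
    cases b
    · simpa using time_adjacentToAll_le v S
    · simp

end Routines

/-! ### Correctness of the algorithms on a fixed graph -/

section Algorithms

open Prog

variable {V α : Type} {A : V → V → Bool}

@[simp] lemma expect_tick (f : Unit → ℝ) : (tick : Prog V Unit).expect A f = f () := rfl

open Classical in
@[simp] lemma expect_test (P : Prop) (f : Bool → ℝ) :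
    (test P : Prog V Bool).expect A f = f (decide P) := rfl

/-- By `hsep` the common neighbours of the seed are all marked, so `V'` is exactly the marked part
of `vs`. This is a clique, hence any `S' ⊆ V'` recovers all of `V'` and the second random choice is
harmless. -/
lemma ensures_cliqueCompletion (c : ℝ) {vs S : List V} {C : V → Prop} (hvs : vs.Nodup)
    (hS : S.Nodup) (hSC : ∀ v ∈ S, v ∈ vs ∧ C v)
    (hclique : ∀ u v, C u → C v → u ≠ v → A u v = true)
    (hsep : ∀ u ∈ vs, ¬ C u → ¬ ∀ v ∈ S, A u v = true) :
    (cliqueCompletion c vs S).Ensures A fun out =>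
      out.Nodup ∧ ∀ v, v ∈ out ↔ v ∈ vs ∧ C v := by
  simp only [cliqueCompletion, bind_eq]
  refine (ensures_true _).bind fun n _ => (ensures_addCommonNeighbours vs S).bind ?_
  rintro V' ⟨new, hnew, rfl, hmem⟩
  have hV' : (S ++ new).Nodup :=
    hS.append (hnew.nodup hvs) fun v hv hv' => ((hmem v).1 hv').2.1 hv
  have hV'mem : ∀ v, v ∈ S ++ new ↔ v ∈ vs ∧ C v := by
    intro v
    rw [List.mem_append, hmem]
    constructor
    · rintro (h | ⟨h, -, h'⟩)
      · exact hSC v h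
      · exact ⟨h, by_contra fun hC => hsep v h hC h'⟩
    · rintro ⟨h, hC⟩
      by_cases hv : v ∈ S
      · exact Or.inl hv
      · exact Or.inr ⟨h, hv, fun u hu => hclique v u hC (hSC u hu).2 (by rintro rfl; exact hv hu)⟩
  simp only [tick_bind, ensures_step]
  refine (ensures_randomSubset _ _).bind fun S' hS' =>
    (ensures_addCommonNeighbours _ S').mono ?_
  rintro out ⟨new', hnew', rfl, hmem'⟩
  have hS'n : S'.Nodup := by
    obtain ⟨l, hl, hl'⟩ := hS'.1
    exact hl.nodup_iff.1 (hl'.nodup hV')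
  refine ⟨hS'n.append (hnew'.nodup hV') fun v hv hv' => ((hmem' v).1 hv').2.1 hv, fun v => ?_⟩
  rw [← hV'mem, List.mem_append, hmem']
  constructor
  · rintro (h | h)
    · exact hS'.1.subset h
    · exact h.1
  · intro h
    by_cases hv : v ∈ S'
    · exact Or.inl hv
    · refine Or.inr ⟨h, hv, fun u hu => hclique v u ((hV'mem v).1 h).2
        ((hV'mem u).1 (hS'.1.subset hu)).2 (by rintro rfl; exact hv hu)⟩

open Classical in
/-- The sampling loop with the degree test replaced by the test whether the vertex is marked. -/
def collectMarked (C : V → Prop) (w : V) (ws : List V) : ℕ → List V → Prog V (List V)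
  | 0, S => .ret S
  | m + 1, S => .draw ws.length fun i => collectMarked C w ws m
      (if C ((w :: ws).get i) ∧ (w :: ws).get i ∉ S then (w :: ws).get i :: S else S)

lemma queryFree_collectMarked (C : V → Prop) (w : V) (ws : List V) (m : ℕ) (S : List V) :
    (collectMarked C w ws m S).QueryFree := by
  induction m generalizing S with
  | zero => trivial
  | succ m ih => exact fun i => ih _

-- Once degrees identify the marked vertices, the loop no longer depends on the graph:
-- `collectMarked` is query-free.
open Classical in
lemma expect_collectHighDegree {C : V → Prop} {w : V} {ws : List V} {θ : ℝ}
    (h : ∀ v ∈ w :: ws, θ ≤ ((w :: ws).countP fun u => A u v) ↔ C v) (m : ℕ) (S : List V)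
    (f : List V → ℝ) :
    (collectHighDegree w ws θ m S).expect A f = (collectMarked C w ws m S).expect A f := by
  induction m generalizing S with
  | zero => rfl
  | succ m ih =>
    simp only [collectHighDegree, collectMarked, bind_eq, tick_bind, draw_bind, ret_bind,
      expect_step, expect_draw]
    congr 1
    refine Finset.sum_congr rfl fun i _ => ?_
    have hi : (w :: ws).get i ∈ w :: ws := List.get_mem _ _
    generalize (w :: ws).get i = v at *
    rw [expect_bind, (ensures_degreeInto v (w :: ws)).expect_eq, test_bind, expect_step]
    by_cases hC : C v
    · simp only [(h v hi).2 hC, decide_true, if_true, hC, true_and]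
      rw [expect_bind, (ensures_member v S).expect_congr (f := _)
        (g := fun _ => (collectMarked C w ws m (if v ∉ S then v :: S else S)).expect A f)]
      · simp
      · intro b hb
        cases b
        · have hv : v ∉ S := by simpa using hb
          simp [hv, ih]
        · have hv : v ∈ S := by simpa using hb
          simp [hv, ih]
    · have : ¬ θ ≤ ((w :: ws).countP fun u => A u v) := fun h' => hC ((h v hi).1 h')
      simp only [this, decide_false, hC, false_and, if_false]
      simpa using ih S

lemma ensures_collectMarked (C : V → Prop) (w : V) (ws : List V) (m : ℕ) (S : List V)
    (hS : S.Nodup) (hSC : ∀ v ∈ S, v ∈ w :: ws ∧ C v) :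
    (collectMarked C w ws m S).Ensures A fun out =>
      out.Nodup ∧ (∀ v ∈ out, v ∈ w :: ws ∧ C v) ∧ S.length ≤ out.length := by
  induction m generalizing S with
  | zero => exact ⟨hS, hSC, le_rfl⟩
  | succ m ih =>
    intro i
    dsimp only
    have hi : (w :: ws).get i ∈ w :: ws := List.get_mem _ _
    generalize (w :: ws).get i = v at *
    split_ifs with h
    · refine (ih (v :: S) (List.nodup_cons.2 ⟨h.2, hS⟩) ?_).mono ?_
      · rintro u (_ | ⟨_, hu⟩)
        · exact ⟨hi, h.1⟩
        · exact hSC u hu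
      · rintro out ⟨h1, h2, h3⟩
        exact ⟨h1, h2, by simp at h3; omega⟩
    · exact ih S hS hSC

open Classical in
/-- It is unlikely that few marked vertices are found: the quantity `2 ^ (- number found)` shrinks
by a constant factor in expectation. -/
lemma expect_collectMarked_short_le (C : V → Prop) (w : V) (ws : List V) (s : ℕ)
    (hnd : (w :: ws).Nodup) (hs : s ≤ (w :: ws).countP (fun v => decide (C v))) (m : ℕ)
    (S : List V) (hS : S.Nodup) (hSC : ∀ v ∈ S, v ∈ w :: ws ∧ C v) :
    (collectMarked C w ws m S).expect A (fun out => if out.length < s then 1 else 0) ≤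
      2 ^ s / 2 ^ S.length * (1 - (((w :: ws).countP (fun v => decide (C v)) : ℝ) - s) /
        (2 * (w :: ws).length)) ^ m := by
  set c := (w :: ws).countP (fun v => decide (C v)) with hc
  set N : ℝ := ((w :: ws).length : ℝ) with hN
  have hN0 : 0 < N := by rw [hN]; simp; positivity
  have hcN : (c : ℝ) ≤ N := by
    rw [hc, hN]; exact_mod_cast List.countP_le_length
  have hsc : (s : ℝ) ≤ c := by exact_mod_cast hs
  have hs0 : (0 : ℝ) ≤ s := s.cast_nonneg
  set x : ℝ := 1 - ((c : ℝ) - s) / (2 * N) with hx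
  have hx0 : 0 ≤ x := by
    rw [hx, sub_nonneg, div_le_one (by positivity)]
    linarith
  induction m generalizing S with
  | zero =>
    simp only [collectMarked, expect_ret, pow_zero, mul_one]
    split_ifs with h
    · rw [le_div_iff₀ (by positivity), one_mul]
      exact pow_le_pow_right₀ one_le_two h.le
    · positivity
  | succ m ih =>
    -- The list never shrinks, so only `|S| < s` matters. In that case at least `c - s` marked
    -- vertices are still missing from `S`.
    rcases le_or_gt s S.length with hle | hlt
    · refine ((ensures_collectMarked C w ws (m + 1) S hS hSC).expect_le (c := 0) ?_).trans
        (by positivity)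
      rintro out ⟨-, -, h⟩
      rw [if_neg (by omega)]
    simp only [collectMarked, expect_draw]
    have hN' : ((ws.length : ℝ) + 1) = N := by rw [hN]; simp
    rw [hN', div_le_iff₀ hN0]
    -- The potential `2 ^ (-|S|)` is halved exactly when the draw is a new marked vertex.
    have hstep : ∀ i : Fin (ws.length + 1),
        (collectMarked C w ws m (if C ((w :: ws).get i) ∧ (w :: ws).get i ∉ S then
          (w :: ws).get i :: S else S)).expect A (fun out => if out.length < s then 1 else 0) ≤
        2 ^ s / 2 ^ S.length * x ^ m *
          (1 - 1 / 2 * (if (decide (C ((w :: ws).get i) ∧ (w :: ws).get i ∉ S) : Bool)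
            then (1 : ℝ) else 0)) := by
      intro i
      have hi : (w :: ws).get i ∈ w :: ws := List.get_mem _ _
      generalize (w :: ws).get i = v at *
      by_cases h : C v ∧ v ∉ S
      · simp only [h, not_false_eq_true, and_self, if_true, decide_true]
        refine (ih (v :: S) (List.nodup_cons.2 ⟨h.2, hS⟩) ?_).trans_eq ?_
        · rintro u (_ | ⟨_, hu⟩)
          · exact ⟨hi, h.1⟩
          · exact hSC u hu
        · rw [List.length_cons, pow_succ]
          field_simp
          ring
      · simp only [h, if_false, decide_false]
        simpa using ih S hS hSC
    refine (Finset.sum_le_sum fun i _ => hstep i).trans ?_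
    rw [← Finset.mul_sum, Finset.sum_sub_distrib, ← Finset.mul_sum]
    have hsum := (sum_get_eq (fun v => if (decide (C v ∧ v ∉ S) : Bool) then (1 : ℝ) else 0)
      (w :: ws)).trans (sum_map_boole (fun v => decide (C v ∧ v ∉ S)) (w :: ws))
    -- A draw is new with probability at least `(c - s) / N`, so the expected factor of one round is
    -- at most `1 - (c - s) / (2N)`.
    have hcount : (c : ℝ) - s ≤ (w :: ws).countP (fun v => decide (C v ∧ v ∉ S)) := by
      have h1 : c ≤ (w :: ws).countP (fun v => decide (C v ∧ v ∉ S)) + S.length := by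
        rw [hc, List.countP_eq_length_filter, List.countP_eq_length_filter,
          ← List.toFinset_card_of_nodup (hnd.filter _),
          ← List.toFinset_card_of_nodup (hnd.filter _), ← List.toFinset_card_of_nodup hS]
        refine (Finset.card_le_card ?_).trans (Finset.card_union_le _ _)
        intro v
        simp only [List.mem_toFinset, List.mem_filter, Finset.mem_union, decide_eq_true_eq]
        tauto
      have h2 : (c : ℝ) ≤ (w :: ws).countP (fun v => decide (C v ∧ v ∉ S)) + S.length := by
        exact_mod_cast h1
      have h3 : (S.length : ℝ) ≤ s := by exact_mod_cast hlt.le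
      linarith
    have h1 : (∑ i : Fin (ws.length + 1), (1 : ℝ)) = N := by simp [hN]
    rw [h1, pow_succ, ← mul_assoc, mul_assoc _ x N]
    refine mul_le_mul_of_nonneg_left ?_ (by positivity)
    have h2 : x * N = N - (c - s) / 2 := by rw [hx]; field_simp
    rw [h2]
    have h3 : (∑ i : Fin (ws.length + 1),
        if (decide (C ((w :: ws).get i) ∧ (w :: ws).get i ∉ S) : Bool) = true
          then (1 : ℝ) else 0) = (w :: ws).countP (fun v => decide (C v ∧ v ∉ S)) := hsum
    rw [h3]
    linarith

/-- The output of `Keep-High-Degree-And-Complete` is a list of the marked vertices. -/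
def FoundMarked (C : V → Prop) (W : List V) (found : Option (List V)) : Prop :=
  ∃ out, found = some out ∧ out.Nodup ∧ ∀ v, v ∈ out ↔ v ∈ W ∧ C v

/-- Comparing an integer with the real threshold or with its ceiling is the same, so passing the
test guarantees a seed of full size. -/
lemma lt_seedSize_iff (s n : ℕ) : (s : ℝ) < 2 * Real.logb 2 n ↔ s < seedSize 1 n := by
  rw [seedSize, Nat.lt_ceil]
  norm_num

lemma ite_forall_le_sum {ι : Type*} {P : Prop} [Decidable P] {Q : ι → Prop} [DecidablePred Q]
    {s : Finset ι} (h : P → ∃ i ∈ s, Q i) :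
    (if P then (1 : ℝ) else 0) ≤ ∑ i ∈ s, if Q i then 1 else 0 := by
  split_ifs with hP
  · obtain ⟨i, hi, hQ⟩ := h hP
    have := Finset.single_le_sum (f := fun i => if Q i then (1 : ℝ) else 0)
      (fun i _ => by positivity) hi
    simpa [hQ] using this
  · exact Finset.sum_nonneg fun i _ => by positivity

/-- Starting from a random seed among the marked vertices, `Clique-Completion` finds all marked
vertices unless some other vertex is adjacent to the whole seed. -/
lemma expect_seed_cliqueCompletion_le (c : ℝ) (s : ℕ) {vs S : List V} {C : V → Prop}
    (U : Finset V) (hvs : vs.Nodup) (hS : S.Nodup) (hSC : ∀ v ∈ S, v ∈ vs ∧ C v)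
    (hclique : ∀ u v, C u → C v → u ≠ v → A u v = true) (hU : ∀ u ∈ vs, ¬ C u → u ∈ U)
    (f : List V → ℝ) (hf : ∀ out, f out ≤ 1)
    (hf0 : ∀ out, out.Nodup → (∀ v, v ∈ out ↔ v ∈ vs ∧ C v) → f out ≤ 0) :
    ((randomSubset s S).expect A fun seed => (cliqueCompletion c vs seed).expect A f) ≤
      (randomSubset s S).expect A fun seed => ∑ u ∈ U, if seed.all (A u) then 1 else 0 := by
  classical
  refine (ensures_randomSubset s S).expect_mono ?_
  rintro seed ⟨hsub, -⟩
  have hseed : seed.Nodup := by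
    obtain ⟨l, hl, hl'⟩ := hsub
    exact hl.nodup_iff.1 (hl'.nodup hS)
  by_cases h : ∃ u ∈ vs, ¬ C u ∧ ∀ v ∈ seed, A u v = true
  · have h1 := ite_forall_le_sum (P := True) (Q := fun u => seed.all (A u) = true) (s := U) (by
      obtain ⟨u, hu, hC, h⟩ := h
      exact fun _ => ⟨u, hU u hu hC, by simpa using h⟩)
    rw [if_pos trivial] at h1
    exact ((ensures_true _).expect_le fun out _ => hf out).trans h1
  · push Not at h
    refine ((ensures_cliqueCompletion c hvs hseed (fun v hv => hSC v (hsub.subset hv)) hclique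
      fun u hu hC h' => ?_).expect_le (c := 0) fun out ho => hf0 out ho.1 ho.2).trans
      (Finset.sum_nonneg fun i _ => by positivity)
    obtain ⟨v, hv, hA⟩ := h u hu hC
    exact hA (h' v hv)

open Classical in
/-- If the vertices of high degree are the marked ones, then `Keep-High-Degree-And-Complete` fails
only if few marked vertices are found or if an unmarked vertex is adjacent to the whole seed. -/
lemma expect_keepHighDegreeAndComplete_le {C : V → Prop} (w : V) (ws : List V)
    (U : Finset V) (hnd : (w :: ws).Nodup)
    (hdeg : ∀ v ∈ w :: ws, (((w :: ws).length : ℝ) / 2 +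
        2 * Real.sqrt ((w :: ws).length * Real.logb 2 (w :: ws).length) ≤
      ((w :: ws).countP fun u => A u v)) ↔ C v)
    (hclique : ∀ u v, C u → C v → u ≠ v → A u v = true) (hU : ∀ u ∈ w :: ws, ¬ C u → u ∈ U)
    (L : ℕ) :
    ((keepHighDegreeAndComplete (w :: ws) L).expect A
        fun found => if FoundMarked C (w :: ws) found then 0 else 1) ≤
      (collectMarked C w ws L []).expect A fun S =>
        if S.length < seedSize 1 (w :: ws).length then 1 else
          (randomSubset (seedSize 1 (w :: ws).length) S).expect A fun seed =>
            ∑ u ∈ U, if seed.all (A u) then 1 else 0 := by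
  simp only [keepHighDegreeAndComplete, bind_eq, expect_bind]
  rw [(ensures_size _).expect_eq, expect_tick, expect_collectHighDegree hdeg]
  refine (ensures_collectMarked C w ws L [] List.nodup_nil (by simp)).expect_mono ?_
  rintro S ⟨hS, hSC, -⟩
  rw [(ensures_size S).expect_eq, expect_test]
  by_cases h : S.length < seedSize 1 (w :: ws).length
  · rw [if_pos h]
    refine (ensures_true _).expect_le fun found _ => ?_
    split_ifs <;> norm_num
  · have h' := h
    rw [← lt_seedSize_iff] at h'
    rw [if_neg h]
    simp only [h', decide_false, Bool.false_eq_true, if_false, expect_tick, expect_bind]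
    refine expect_seed_cliqueCompletion_le 1 _ U hnd hS hSC hclique hU
      (fun out => (pure (some out) : Prog V (Option (List V))).expect A
        fun found => if FoundMarked C (w :: ws) found then 0 else 1) (fun out => ?_)
      fun out h1 h2 => ?_
    · simp only [pure_eq, expect_ret]
      split_ifs <;> norm_num
    · simp only [pure_eq, expect_ret]
      rw [if_pos ⟨out, rfl, h1, h2⟩]

/-- The final step of `Subsample-And-Filter`, from all clique vertices in the sample. -/
lemma expect_final_cliqueCompletion_le (c : ℝ) (s : ℕ) {vs S : List V} {C : V → Prop}
    (U : Finset V) (hvs : vs.Nodup) (hS : S.Nodup) (hSC : ∀ v ∈ S, v ∈ vs ∧ C v)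
    (hclique : ∀ u v, C u → C v → u ≠ v → A u v = true) (hU : ∀ u ∈ vs, ¬ C u → u ∈ U)
    (hs : s ≤ S.length)
    (f : List V → ℝ) (hf : ∀ out, f out ≤ 1)
    (hf0 : ∀ out, out.Nodup → (∀ v, v ∈ out ↔ v ∈ vs ∧ C v) → f out ≤ 0) :
    ((randomSubset s S).expect A fun seed => (cliqueCompletion c vs seed).expect A f) ≤
      ∑ u ∈ U, ((S.countP (A u) : ℝ) / S.length) ^ s := by
  refine (expect_seed_cliqueCompletion_le c s U hvs hS hSC hclique hU f hf hf0).trans ?_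
  rw [expect_sum]
  exact Finset.sum_le_sum fun u _ => expect_randomSubset_all_le (A u) s S hs

end Algorithms

/-! ### `Subsample-And-Filter` on a fixed graph, after the sample is drawn -/

section Algorithms

open Prog

/-- The degree filter of `Subsample-And-Filter`. -/
def degreeFilter {n : ℕ} (V₂ : Finset (Fin n)) (k : ℕ) (v : Fin n) : Prog (Fin n) Bool := do
  let d ← degreeInto v V₂.toList
  let lower ← test (((n : ℝ) + k) / 4 - 2 * Real.sqrt n ≤ (d : ℝ))
  let upper ← test ((d : ℝ) ≤ ((n : ℝ) + k) / 4 + 2 * Real.sqrt n)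
  return lower && upper

/-- `Subsample-And-Filter`, after the sample `SP` has been drawn. -/
def afterSampling {n : ℕ} (V₂ : Finset (Fin n)) (k : ℕ) (p : ℝ) (SP : List (Fin n)) :
    Prog (Fin n) (List (Fin n)) := do
  let m ← size SP
  if ← test (p * n < (m : ℝ)) then randomSubset k (List.finRange n)
  else
    tick
    let SF ← select (degreeFilter V₂ k) SP
    let n' ← size SF
    let found ← keepHighDegreeAndComplete SF n'
    let SC : List (Fin n) := found.getD []
    let s ← size SC
    if ← test ((s : ℝ) < 2 * Real.logb 2 n) then randomSubset k (List.finRange n)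
    else
      tick
      let seed ← randomSubset (seedSize 1 n) SC
      cliqueCompletion 1 (List.finRange n) seed

lemma subsampleAndFilter_eq {n : ℕ} (V₁ V₂ : Finset (Fin n)) (k : ℕ) (p : ℝ) :
    subsampleAndFilter V₁ V₂ k p =
      (ticks n).bind fun _ => (select (fun _ => flip p) V₁.toList).bind (afterSampling V₂ k p) :=
  rfl

/-- The number of neighbours in `V₂` is in the range that the filter allows. -/
def PassesFilter {n : ℕ} (A : Fin n → Fin n → Bool) (V₂ : Finset (Fin n)) (k : ℕ) (v : Fin n) :
    Prop :=
  ((n : ℝ) + k) / 4 - 2 * Real.sqrt n ≤ (V₂.toList.countP fun u => A u v) ∧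
    (V₂.toList.countP fun u => A u v) ≤ ((n : ℝ) + k) / 4 + 2 * Real.sqrt n

open Classical in
/-- The sampled vertices that pass the filter. -/
def filtered {n : ℕ} (A : Fin n → Fin n → Bool) (V₂ : Finset (Fin n)) (k : ℕ)
    (SP : List (Fin n)) : List (Fin n) :=
  SP.filter fun v => decide (PassesFilter A V₂ k v)

variable {n : ℕ} {A : Fin n → Fin n → Bool}

lemma ensures_select_degreeFilter (V₂ : Finset (Fin n)) (k : ℕ) (SP : List (Fin n)) :
    (select (degreeFilter V₂ k) SP).Ensures A (· = filtered A V₂ k SP) := by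
  classical
  refine ensures_select _ SP (fun v => decide (PassesFilter A V₂ k v)) fun v _ => ?_
  refine (ensures_degreeInto v _).bind ?_
  rintro d rfl
  simp [test_bind, PassesFilter]

open Classical in
/-- On a graph with the planted clique `K`, the algorithm succeeds if the middle stage finds the
sampled clique vertices, unless a vertex outside the clique is adjacent to the last seed. -/
lemma expect_afterSampling_le (K V₂ : Finset (Fin n)) (k : ℕ) (p : ℝ) (SP : List (Fin n))
    (hSP : SP.Nodup) (hlen : (SP.length : ℝ) ≤ p * n)
    (hclique : ∀ u ∈ K, ∀ v ∈ K, u ≠ v → A u v = true)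
    (hs : seedSize 1 n ≤ ((filtered A V₂ k SP).filter (· ∈ K)).length) :
    ((afterSampling V₂ k p SP).expect A fun out => if out.toFinset ≠ K then 1 else 0) ≤
      ((keepHighDegreeAndComplete (filtered A V₂ k SP) (filtered A V₂ k SP).length).expect A
        fun found => if FoundMarked (· ∈ K) (filtered A V₂ k SP) found then 0 else 1) +
      ∑ u ∈ Kᶜ, ((((filtered A V₂ k SP).filter (· ∈ K)).countP (A u) : ℝ) /
        ((filtered A V₂ k SP).filter (· ∈ K)).length) ^ seedSize 1 n := by
  set W := filtered A V₂ k SP with hW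
  have hWn : W.Nodup := hSP.filter _
  set err : List (Fin n) → ℝ := fun out => if out.toFinset ≠ K then 1 else 0 with herr
  have herr1 : ∀ out, err out ≤ 1 := fun out => by simp only [herr]; split_ifs <;> norm_num
  set R : ℝ := ∑ u ∈ Kᶜ, (((W.filter (· ∈ K)).countP (A u) : ℝ) /
        (W.filter (· ∈ K)).length) ^ seedSize 1 n with hR
  have hR0 : 0 ≤ R := Finset.sum_nonneg fun u _ => by positivity
  simp only [afterSampling, bind_eq, expect_bind]
  rw [(ensures_size SP).expect_eq, expect_test, decide_eq_false (not_lt.2 hlen)]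
  simp only [Bool.false_eq_true, if_false, expect_bind, expect_tick]
  rw [(ensures_select_degreeFilter V₂ k SP).expect_eq, ← hW, (ensures_size W).expect_eq]
  rw [← expect_const (A := A) (keepHighDegreeAndComplete W W.length) R, ← expect_add]
  refine expect_mono fun found => ?_
  by_cases hf : FoundMarked (· ∈ K) W found
  · rw [if_pos hf, zero_add]
    obtain ⟨SC, rfl, hSCn, hSC⟩ := hf
    simp only [Option.getD_some]
    -- Only the set that was found matters, because the bound for the last stage is a ratio of
    -- counts.
    have hperm : SC.Perm (W.filter (· ∈ K)) :=
      (List.perm_ext_iff_of_nodup hSCn (hWn.filter _)).2 fun v => by simp [hSC]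
    rw [(ensures_size SC).expect_eq, expect_test, decide_eq_false]
    · simp only [Bool.false_eq_true, if_false, expect_bind, expect_tick]
      refine (expect_final_cliqueCompletion_le 1 (seedSize 1 n) Kᶜ (List.nodup_finRange n) hSCn
        (C := (· ∈ K)) (fun v hv => ⟨List.mem_finRange v, ((hSC v).1 hv).2⟩)
        (fun u v hu hv => hclique u hu v hv) (fun u _ hu => by simpa using hu)
        (by rw [hperm.length_eq]; exact hs) err herr1 ?_).trans_eq ?_
      · intro out _ hout
        have : out.toFinset = K := by ext v; simp [hout]
        simp [herr, this]
      · rw [hR]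
        refine Finset.sum_congr rfl fun u _ => ?_
        rw [hperm.countP_eq, hperm.length_eq]
    · rw [lt_seedSize_iff, not_lt, hperm.length_eq]
      exact hs
  · rw [if_neg hf]
    refine ((ensures_true _).expect_le (c := 1) fun s _ => ?_).trans (by linarith)
    exact (ensures_true _).expect_le fun b _ => (ensures_true _).expect_le fun out _ => herr1 out

end Algorithms

/-! ### The failure probability as an average -/

open Classical in
lemma erdosRenyi_apply (n : ℕ) (G : SimpleGraph (Fin n)) :
    erdosRenyi n G = (1 / 2) ^ (n.choose 2) := by
  rw [erdosRenyi, MeasureTheory.Measure.toPMF_apply, SimpleGraph.binomialRandom_singleton]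
  have h : G.edgeSet.ncard ≤ n.choose 2 := by
    have := G.card_edgeFinset_le_card_choose_two
    rw [Fintype.card_fin] at this
    rwa [← SimpleGraph.coe_edgeFinset, Set.ncard_coe_finset]
  rw [Nat.card_eq_fintype_card, Fintype.card_fin]
  have e1 : ((unitInterval.toNNReal ⟨1 / 2, by norm_num, by norm_num⟩ : NNReal) : ENNReal) =
      1 / 2 := by
    rw [show (unitInterval.toNNReal ⟨1 / 2, by norm_num, by norm_num⟩ : NNReal) = 1 / 2 from by
      ext; simp only [unitInterval.coe_toNNReal, NNReal.coe_div, NNReal.coe_one, NNReal.coe_ofNat]]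
    simp
  have e2 : ((unitInterval.toNNReal (unitInterval.symm ⟨1 / 2, by norm_num, by norm_num⟩) : NNReal)
      : ENNReal) = 1 / 2 := by
    rw [show (unitInterval.toNNReal (unitInterval.symm ⟨1 / 2, by norm_num, by norm_num⟩) : NNReal)
      = 1 / 2 from by ext; simp only [unitInterval.coe_toNNReal, unitInterval.coe_symm_eq, NNReal.coe_div, NNReal.coe_one, NNReal.coe_ofNat]; norm_num]
    simp
  rw [e1, e2, ← pow_add, Nat.add_sub_cancel' h]

/-- The weight is the same for every graph, and total mass one identifies it without counting the
graphs. -/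
lemma erdosRenyi_apply' (n : ℕ) (G : SimpleGraph (Fin n)) :
    erdosRenyi n G = (Fintype.card (SimpleGraph (Fin n)) : ENNReal)⁻¹ := by
  have h := (erdosRenyi n).tsum_coe
  simp only [erdosRenyi_apply, tsum_fintype, Finset.sum_const, Finset.card_univ,
    nsmul_eq_mul] at h
  rw [erdosRenyi_apply]
  exact ENNReal.eq_inv_of_mul_eq_one_left (by rw [mul_comm]; exact h)

-- From here on probabilities over the clique and the graph are plain averages over finite sets,
-- with the clique averaged outermost so that it can be fixed.
open Classical in
lemma failureProbability_eq {n : ℕ} (k : ℕ) (h : k ≤ n) (P : Prog (Fin n) (List (Fin n))) :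
    failureProbability k h P =
      𝔼 K ∈ Finset.powersetCard k (Finset.univ : Finset (Fin n)), 𝔼 G : SimpleGraph (Fin n),
        P.expect (adjacency (plant K G)) fun out => if out.toFinset ≠ K then 1 else 0 := by
  have fin : ∀ (K : Finset (Fin n)) (G : SimpleGraph (Fin n)) s,
      (P.run (adjacency G)).toOuterMeasure s ≠ ⊤ := fun K G s =>
    ne_top_of_le_ne_top ENNReal.one_ne_top
      (((P.run _).toOuterMeasure.mono (Set.subset_univ s)).trans_eq
        (((P.run _).toOuterMeasure_apply_eq_one_iff _).2 (Set.subset_univ _)))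
  have hcard : (Finset.powersetCard k (Finset.univ : Finset (Fin n))).card ≠ 0 := by
    rw [Finset.card_powersetCard, Finset.card_univ, Fintype.card_fin]
    exact (Nat.choose_pos h).ne'
  rw [failureProbability, plantedClique, PMF.bind_bind, PMF.toOuterMeasure_bind_apply]
  simp only [PMF.bind_map, PMF.toOuterMeasure_bind_apply, tsum_fintype, Function.comp_apply,
    PMF.toOuterMeasure_map_apply, erdosRenyi_apply']
  simp only [uniformSubset, PMF.uniformOfFinset_apply, ite_mul, zero_mul, Finset.sum_ite_mem,
    Finset.univ_inter]
  rw [ENNReal.toReal_sum fun K _ => ENNReal.mul_ne_top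
    (ENNReal.inv_ne_top.2 (by exact_mod_cast hcard))
    (ENNReal.sum_ne_top.2 fun G _ => ENNReal.mul_ne_top
      (ENNReal.inv_ne_top.2 (by exact_mod_cast Fintype.card_ne_zero)) (fin K _ _))]
  rw [Finset.expect_eq_sum_div_card, Finset.sum_div]
  refine Finset.sum_congr rfl fun K _ => ?_
  rw [ENNReal.toReal_mul, ENNReal.toReal_sum fun G _ => ENNReal.mul_ne_top
      (ENNReal.inv_ne_top.2 (by exact_mod_cast Fintype.card_ne_zero)) (fin K _ _)]
  rw [div_eq_inv_mul, Finset.expect_eq_sum_div_card, Finset.sum_div]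
  congr 1
  · simp
  · refine Finset.sum_congr rfl fun G _ => ?_
    rw [ENNReal.toReal_mul, div_eq_inv_mul, Prog.toOuterMeasure_run_toReal]
    congr 1
    · simp
    · congr 1
      ext out
      simp [Set.indicator]

/-! ### Averages over all graphs -/

section Averages

open Classical in
/-- The indicator of a proposition. -/
def ind (P : Prop) : ℝ := if P then 1 else 0

lemma ind_eq (P : Prop) [Decidable P] : ind P = if P then 1 else 0 := by
  unfold ind; congr

lemma ind_of {P : Prop} (h : P) : ind P = 1 := by simp [ind, h]

lemma ind_of_not {P : Prop} (h : ¬ P) : ind P = 0 := by simp [ind, h]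

lemma ind_nonneg (P : Prop) : 0 ≤ ind P := by unfold ind; positivity

lemma ind_le_one (P : Prop) : ind P ≤ 1 := by unfold ind; split_ifs <;> norm_num

lemma ind_mono {P Q : Prop} (h : P → Q) : ind P ≤ ind Q := by
  by_cases hP : P
  · rw [ind_of hP, ind_of (h hP)]
  · rw [ind_of_not hP]; exact ind_nonneg Q

lemma ind_or_le (P Q : Prop) : ind (P ∨ Q) ≤ ind P + ind Q := by
  by_cases hP : P <;> by_cases hQ : Q <;> simp [ind, hP, hQ]

lemma ind_le_sum {ι : Type*} {P : Prop} {Q : ι → Prop} {s : Finset ι}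
    (h : P → ∃ i ∈ s, Q i) : ind P ≤ ∑ i ∈ s, ind (Q i) := by
  classical
  exact ite_forall_le_sum h

lemma ind_mul_self (P : Prop) : ind P * ind P = ind P := by unfold ind; split_ifs <;> norm_num

lemma expect_le_of_forall_le {ι : Type*} {s : Finset ι} {f : ι → ℝ} {c : ℝ} (hc : 0 ≤ c)
    (h : ∀ i ∈ s, f i ≤ c) : 𝔼 i ∈ s, f i ≤ c := by
  rcases s.eq_empty_or_nonempty with rfl | hs
  · simpa using hc
  · exact Finset.expect_le hs h

/-- Chebyshev's inequality for a sum of indicators without positive pair correlations. -/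
lemma expect_sq_sum_sub_le {ι Ω : Type*} {T : Finset Ω} (hT : T.Nonempty) (s : Finset ι)
    (P : ι → Ω → Prop) (q : ℝ) (hq : ∀ i ∈ s, 𝔼 ω ∈ T, ind (P i ω) ≤ q)
    (hind : ∀ i ∈ s, ∀ j ∈ s, i ≠ j →
      𝔼 ω ∈ T, ind (P i ω) * ind (P j ω) ≤ (𝔼 ω ∈ T, ind (P i ω)) * 𝔼 ω ∈ T, ind (P j ω)) :
    𝔼 ω ∈ T, (∑ i ∈ s, ind (P i ω) - ∑ i ∈ s, 𝔼 ω ∈ T, ind (P i ω)) ^ 2 ≤ s.card * q := by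
  classical
  set e : ι → ℝ := fun i => 𝔼 ω ∈ T, ind (P i ω) with he
  have h1 : ∀ ω, (∑ i ∈ s, ind (P i ω) - ∑ i ∈ s, e i) ^ 2 =
      ∑ i ∈ s, ∑ j ∈ s, (ind (P i ω) - e i) * (ind (P j ω) - e j) := by
    intro ω
    rw [← Finset.sum_sub_distrib, sq, Finset.sum_mul_sum]
  have h2 : ∀ i j, 𝔼 ω ∈ T, (ind (P i ω) - e i) * (ind (P j ω) - e j) =
      (𝔼 ω ∈ T, ind (P i ω) * ind (P j ω)) - e i * e j := by
    intro i j
    have : ∀ ω, (ind (P i ω) - e i) * (ind (P j ω) - e j) =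
        ind (P i ω) * ind (P j ω) - e i * ind (P j ω) - e j * ind (P i ω) + e i * e j := by
      intro ω; ring
    simp only [this, Finset.expect_add_distrib, Finset.expect_sub_distrib,
      ← Finset.mul_expect, Finset.expect_const hT]
    simp only [he]
    ring
  simp only [h1, Finset.expect_sum_comm, h2]
  -- In each row of the covariance matrix the diagonal entry is at most `q`, and all other entries
  -- are nonpositive.
  have h3 : ∀ i ∈ s, (∑ j ∈ s, ((𝔼 ω ∈ T, ind (P i ω) * ind (P j ω)) - e i * e j)) ≤ q := by
    intro i hi
    rw [← Finset.add_sum_erase s _ hi]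
    refine (add_le_add (b := q) (d := 0) ?_ (Finset.sum_nonpos fun j hj => ?_)).trans_eq
      (add_zero q)
    · simp only [ind_mul_self]
      have := hq i hi
      have := mul_self_nonneg (e i)
      simp only [he] at *
      linarith
    · rw [Finset.mem_erase] at hj
      exact sub_nonpos.2 (hind i hi j hj.2 hj.1.symm)
  refine (Finset.sum_le_sum h3).trans_eq ?_
  rw [Finset.sum_const, nsmul_eq_mul]

variable {V : Type}

open Classical in
/-- The graph that agrees with `G` on the pairs in `E` and with `H` on all other pairs. -/
def merge (E : Set (Sym2 V)) (G H : SimpleGraph V) : SimpleGraph V where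
  Adj u v := if s(u, v) ∈ E then G.Adj u v else H.Adj u v
  symm := ⟨fun u v h => by
    rw [Sym2.eq_swap]
    simpa only [G.adj_comm, H.adj_comm] using h⟩
  loopless := ⟨fun u h => by split_ifs at h <;> simp at h⟩

lemma merge_adj {E : Set (Sym2 V)} {G H : SimpleGraph V} {u v : V} :
    (merge E G H).Adj u v ↔ s(u, v) ∈ E ∧ G.Adj u v ∨ s(u, v) ∉ E ∧ H.Adj u v := by
  by_cases h : s(u, v) ∈ E <;> simp [merge, h]

lemma adjacency_iff {G : SimpleGraph V} {u v : V} : adjacency G u v = true ↔ G.Adj u v := by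
  simp [adjacency]

lemma adjacency_merge_of_mem {E : Set (Sym2 V)} (G H : SimpleGraph V) {u v : V}
    (h : s(u, v) ∈ E) : adjacency (merge E G H) u v = adjacency G u v := by
  rw [Bool.eq_iff_iff, adjacency_iff, adjacency_iff, merge_adj]
  tauto

lemma adjacency_merge_of_notMem {E : Set (Sym2 V)} (G H : SimpleGraph V) {u v : V}
    (h : s(u, v) ∉ E) : adjacency (merge E G H) u v = adjacency H u v := by
  rw [Bool.eq_iff_iff, adjacency_iff, adjacency_iff, merge_adj]
  tauto

lemma adjacency_comm (G : SimpleGraph V) (u v : V) : adjacency G u v = adjacency G v u := by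
  simp [adjacency, G.adj_comm]

lemma adjacency_self (G : SimpleGraph V) (u : V) : adjacency G u u = false := by
  simp [adjacency]

lemma merge_merge_swap (E : Set (Sym2 V)) (G H : SimpleGraph V) :
    merge E (merge E G H) (merge E H G) = G := by
  ext u v
  simp only [merge_adj]
  tauto

lemma plant_adj {K : Finset V} {G : SimpleGraph V} {u v : V} :
    (plant K G).Adj u v ↔ G.Adj u v ∨ u ≠ v ∧ u ∈ K ∧ v ∈ K := by
  simp only [plant, SimpleGraph.sup_adj, SimpleGraph.fromRel_adj]
  tauto

lemma adjacency_plant_of_notMem {K : Finset V} (G : SimpleGraph V) {u v : V}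
    (h : u ∉ K ∨ v ∉ K) : adjacency (plant K G) u v = adjacency G u v := by
  rw [Bool.eq_iff_iff, adjacency_iff, adjacency_iff, plant_adj]
  tauto

lemma adjacency_plant_of_mem {K : Finset V} (G : SimpleGraph V) {u v : V} (hu : u ∈ K)
    (hv : v ∈ K) (h : u ≠ v) : adjacency (plant K G) u v = true := by
  rw [adjacency_iff, plant_adj]
  tauto

variable [Fintype V] [DecidableEq V]

/-- The pairs of graphs with the roles of the two graphs exchanged outside of `E`. -/
def mergeEquiv (E : Set (Sym2 V)) :
    SimpleGraph V × SimpleGraph V ≃ SimpleGraph V × SimpleGraph V where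
  toFun x := (merge E x.1 x.2, merge E x.2 x.1)
  invFun x := (merge E x.1 x.2, merge E x.2 x.1)
  left_inv x := by simp [merge_merge_swap]
  right_inv x := by simp [merge_merge_swap]

/-- The pairs in `E` and the other pairs may be drawn independently. -/
lemma expect_merge (E : Set (Sym2 V)) (F : SimpleGraph V → ℝ) :
    𝔼 G, 𝔼 H, F (merge E G H) = 𝔼 G, F G := by
  have h1 : 𝔼 G, 𝔼 H, F (merge E G H) =
      𝔼 x : SimpleGraph V × SimpleGraph V, F (merge E x.1 x.2) :=
    (Finset.expect_product' Finset.univ Finset.univ fun G H => F (merge E G H)).symm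
  have h2 : 𝔼 G, F G = 𝔼 x : SimpleGraph V × SimpleGraph V, F x.1 := by
    refine Eq.trans ?_ (Finset.expect_product' Finset.univ Finset.univ
      fun G (_ : SimpleGraph V) => F G).symm
    simp
  rw [h1, h2]
  exact Fintype.expect_equiv (mergeEquiv E) _ _ fun x => rfl

/-- Independence: `f` sees only pairs in `E`, and `g` only the other pairs. -/
lemma expect_mul_of_merge (E : Set (Sym2 V)) {f g : SimpleGraph V → ℝ}
    (hf : ∀ G H, f (merge E G H) = f G) (hg : ∀ G H, g (merge E G H) = g H) :
    𝔼 G, f G * g G = (𝔼 G, f G) * 𝔼 G, g G := by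
  rw [← expect_merge E, Fintype.expect_mul_expect]
  simp only [hf, hg]

/-- Toggling the pair `uv` is an involution on graphs that negates the entry, so both values are
equally frequent. -/
lemma expect_adjacency {u v : V} (h : u ≠ v) (f : Bool → ℝ) :
    𝔼 G : SimpleGraph V, f (adjacency G u v) = (f true + f false) / 2 := by
  have e : 𝔼 G : SimpleGraph V, f (adjacency G u v) = 𝔼 G : SimpleGraph V, f (!adjacency G u v) := by
    refine Fintype.expect_equiv (Function.Involutive.toPerm
      (fun G : SimpleGraph V => symmDiff G (SimpleGraph.edge u v))
      fun G => symmDiff_symmDiff_cancel_right _ _) _ _ fun G => ?_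
    congr 1
    by_cases hG : G.Adj u v <;>
      simp [adjacency, Function.Involutive.toPerm, symmDiff, hG, h, SimpleGraph.edge_adj]
  have s : (𝔼 G : SimpleGraph V, f (adjacency G u v)) + 𝔼 G : SimpleGraph V, f (!adjacency G u v) =
      f true + f false := by
    rw [← Finset.expect_add_distrib, ← Fintype.expect_const (ι := SimpleGraph V) (f true + f false)]
    refine Finset.expect_congr rfl fun G _ => ?_
    cases adjacency G u v
    · simp [add_comm]
    · simp
  linarith

/-- The pairs from `v` to distinct vertices are split off one at a time, each independent of the
rest. With exponential factors this gives Hoeffding's bound. -/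
lemma expect_prod_adjacency (v : V) (W : Finset V) (hv : v ∉ W) (f : V → Bool → ℝ) :
    𝔼 G : SimpleGraph V, ∏ w ∈ W, f w (adjacency G v w) =
      ∏ w ∈ W, (f w true + f w false) / 2 := by
  induction W using Finset.induction_on with
  | empty => simp
  | insert w W hw ih =>
    have hvw : v ≠ w := by rintro rfl; simp at hv
    have hvW : v ∉ W := fun h => hv (Finset.mem_insert_of_mem h)
    simp only [Finset.prod_insert hw]
    rw [expect_mul_of_merge {s(v, w)}, expect_adjacency hvw, ih hvW]
    · intro G H
      rw [adjacency_merge_of_mem _ _ (Set.mem_singleton _)]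
    · intro G H
      refine Finset.prod_congr rfl fun x hx => ?_
      rw [adjacency_merge_of_notMem]
      simp only [Set.mem_singleton_iff, Sym2.eq_iff, not_or, not_and]
      refine ⟨fun _ => ?_, fun h => absurd h hvw⟩
      rintro rfl; exact hw hx

lemma expect_forall_adjacency (v : V) (W : Finset V) (hv : v ∉ W) :
    𝔼 G : SimpleGraph V, ind (∀ w ∈ W, adjacency G v w = true) = (1 / 2) ^ W.card := by
  have : ∀ G : SimpleGraph V, ind (∀ w ∈ W, adjacency G v w = true) =
      ∏ w ∈ W, (fun (_ : V) (b : Bool) => if b then (1 : ℝ) else 0) w (adjacency G v w) := by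
    intro G
    by_cases h : ∀ w ∈ W, adjacency G v w = true
    · rw [ind_of h, Finset.prod_eq_one]
      intro w hw
      simp [h w hw]
    · rw [ind_of_not h]
      push Not at h
      obtain ⟨w, hw, hA⟩ := h
      rw [Finset.prod_eq_zero hw]
      simpa using hA
  rw [Finset.expect_congr rfl fun G _ => this G,
    expect_prod_adjacency v W hv fun _ b => if b then (1 : ℝ) else 0]
  simp

/-- The number of neighbours of `v` in `W`. -/
def degIn (A : V → V → Bool) (v : V) (W : Finset V) : ℝ := ∑ w ∈ W, if A v w then 1 else 0

/-- Hoeffding's inequality for the number of neighbours of a vertex, in both directions. -/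
lemma expect_degIn_tail (v : V) (W : Finset V) (hv : v ∉ W) {m t σ : ℝ} (hm : 0 < m)
    (hW : (W.card : ℝ) ≤ m) (ht : 0 ≤ t) (hσ : σ = 1 ∨ σ = -1) :
    𝔼 G : SimpleGraph V, ind (t ≤ σ * (degIn (adjacency G) v W - W.card / 2)) ≤
      Real.exp (-2 * t ^ 2 / m) := by
  -- The minimizer of the exponent `-2lt + l²m/2`, whose minimum is `-2t²/m`.
  set l : ℝ := 2 * t / m with hl
  have hl0 : 0 ≤ l := by positivity
  have key : ∀ G : SimpleGraph V, ind (t ≤ σ * (degIn (adjacency G) v W - W.card / 2)) ≤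
      Real.exp (-(2 * l * t)) *
        ∏ w ∈ W, (fun (_ : V) (b : Bool) => Real.exp (l * σ * (if b then 1 else -1))) w
          (adjacency G v w) := by
    intro G
    have h1 : ∏ w ∈ W, (fun (_ : V) (b : Bool) => Real.exp (l * σ * (if b then 1 else -1))) w
          (adjacency G v w) = Real.exp (2 * l * (σ * (degIn (adjacency G) v W - W.card / 2))) := by
      rw [← Real.exp_sum, ← Finset.mul_sum]
      congr 1
      -- Twice the centred degree is a sum of signs. Each sign has moment generating function
      -- `cosh`, which is even, so both tails are treated at once.
      have : ∀ w ∈ W, (if adjacency G v w = true then (1 : ℝ) else -1) =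
          2 * (if adjacency G v w = true then 1 else 0) - 1 := by
        intro w _; split_ifs <;> norm_num
      rw [Finset.sum_congr rfl this, Finset.sum_sub_distrib, ← Finset.mul_sum, degIn]
      simp only [Finset.sum_const, nsmul_eq_mul]
      ring
    rw [h1, ← Real.exp_add]
    by_cases h : t ≤ σ * (degIn (adjacency G) v W - W.card / 2)
    · rw [ind_of h]
      apply Real.one_le_exp
      nlinarith
    · rw [ind_of_not h]
      positivity
  refine (Finset.expect_le_expect fun G _ => key G).trans ?_
  rw [← Finset.mul_expect, expect_prod_adjacency v W hv
    fun _ b => Real.exp (l * σ * (if b then 1 else -1))]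
  have h2 : (Real.exp (l * σ * (if (true : Bool) then 1 else -1)) +
      Real.exp (l * σ * (if (false : Bool) then 1 else -1))) / 2 = Real.cosh l := by
    rw [Real.cosh_eq]
    rcases hσ with rfl | rfl
    · simp
    · simp [add_comm]
  rw [h2, Finset.prod_const]
  have h3 : Real.cosh l ^ W.card ≤ Real.exp (l ^ 2 / 2 * m) := by
    refine (pow_le_pow_left₀ (Real.cosh_pos l).le (Real.cosh_le_exp_half_sq l) _).trans ?_
    rw [← Real.exp_nat_mul]
    apply Real.exp_le_exp.2
    rw [mul_comm]
    gcongr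
  refine (mul_le_mul_of_nonneg_left h3 (Real.exp_pos _).le).trans_eq ?_
  rw [← Real.exp_add]
  congr 1
  rw [hl]
  field_simp
  ring

end Averages

/-! ### The middle stage on a random graph -/

section MiddleStage

open Prog

lemma exp_neg_logb_le {x : ℝ} (hx : 1 ≤ x) : Real.exp (-Real.logb 2 x) ≤ x⁻¹ := by
  have h0 : 0 < x := by linarith
  have h2 : Real.log 2 ≤ 1 := by linarith [Real.log_two_lt_d9]
  have h3 : 0 < Real.log 2 := Real.log_pos one_lt_two
  have h1 : Real.log x ≤ Real.logb 2 x := by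
    rw [Real.logb, le_div_iff₀ h3]
    nlinarith [Real.log_nonneg hx]
  calc Real.exp (-Real.logb 2 x) ≤ Real.exp (-Real.log x) := Real.exp_le_exp.2 (by linarith)
    _ = x⁻¹ := by rw [Real.exp_neg, Real.exp_log h0]

lemma exp_neg_two_logb_le {x : ℝ} (hx : 1 ≤ x) : Real.exp (-2 * Real.logb 2 x) ≤ (x ^ 2)⁻¹ := by
  have := pow_le_pow_left₀ (Real.exp_pos _).le (exp_neg_logb_le hx) 2
  rw [← Real.exp_nat_mul] at this
  rw [← inv_pow]
  refine le_trans (le_of_eq ?_) this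
  congr 1
  push_cast
  ring

/-- Why a seed has `2 log n` vertices: being adjacent to all of it has probability at most `n⁻²`,
which survives a union bound over `n` vertices. -/
lemma sq_le_two_pow_seedSize {n : ℕ} (hn : 1 ≤ n) : (n : ℝ) ^ 2 ≤ 2 ^ seedSize 1 n := by
  have h0 : (0 : ℝ) < n := by exact_mod_cast hn
  have h1 : (2 : ℝ) * Real.logb 2 n ≤ seedSize 1 n := by
    rw [seedSize]
    refine (le_of_eq ?_).trans (Nat.le_ceil _)
    norm_num
  calc (n : ℝ) ^ 2 = (2 : ℝ) ^ (2 * Real.logb 2 n) := by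
        rw [mul_comm, Real.rpow_mul two_pos.le, Real.rpow_logb two_pos (by norm_num) h0]
        norm_num
    _ ≤ (2 : ℝ) ^ (seedSize 1 n : ℝ) := Real.rpow_le_rpow_of_exponent_le one_le_two h1
    _ = 2 ^ seedSize 1 n := Real.rpow_natCast 2 _

variable {V : Type}

lemma countP_eq_degIn [DecidableEq V] (A : V → V → Bool) (v : V) {l : List V} (hl : l.Nodup) :
    (l.countP (A v) : ℝ) = degIn A v l.toFinset := by
  rw [degIn, List.sum_toFinset _ hl, sum_map_boole]

lemma countP_eq_degIn' [DecidableEq V] {A : V → V → Bool} {v : V} {l : List V} (hA : ∀ u ∈ l, A u v = A v u)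
    (hl : l.Nodup) : ((l.countP fun u => A u v) : ℝ) = degIn A v l.toFinset := by
  rw [← countP_eq_degIn A v hl]
  congr 1
  exact List.countP_congr fun u hu => by rw [hA u hu]

lemma degIn_congr {A B : V → V → Bool} {v : V} {W : Finset V} (h : ∀ w ∈ W, A v w = B v w) :
    degIn A v W = degIn B v W :=
  Finset.sum_congr rfl fun w hw => by rw [h w hw]

lemma degIn_union [DecidableEq V] (A : V → V → Bool) (v : V) {W W' : Finset V} (h : Disjoint W W') :
    degIn A v (W ∪ W') = degIn A v W + degIn A v W' :=
  Finset.sum_union h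

lemma degIn_of_forall {A : V → V → Bool} {v : V} {W : Finset V} (h : ∀ w ∈ W, A v w = true) :
    degIn A v W = W.card := by
  rw [degIn, Finset.sum_congr rfl fun w hw => if_pos (h w hw)]
  simp

lemma degIn_mono (A : V → V → Bool) (v : V) {W W' : Finset V} (h : W ⊆ W') :
    degIn A v W ≤ degIn A v W' :=
  Finset.sum_le_sum_of_subset_of_nonneg h fun w _ _ => by positivity

/-- The degree of a clique vertex in a set of vertices of a planted graph. -/
lemma degIn_plant_of_mem [DecidableEq V] {K : Finset V} (G : SimpleGraph V) {v : V} (W : Finset V) (hv : v ∈ K) :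
    degIn (adjacency (plant K G)) v W =
      ((W ∩ K).erase v).card + degIn (adjacency G) v (W \ K) := by
  have h1 : degIn (adjacency (plant K G)) v W = degIn (adjacency (plant K G)) v (W ∩ K) +
      degIn (adjacency (plant K G)) v (W \ K) := by
    rw [← degIn_union _ _ (Finset.disjoint_sdiff_inter W K).symm, Finset.union_comm,
      Finset.sdiff_union_inter]
  have h2 : degIn (adjacency (plant K G)) v (W \ K) = degIn (adjacency G) v (W \ K) :=
    degIn_congr fun w hw => adjacency_plant_of_notMem G (Or.inr (Finset.mem_sdiff.1 hw).2)
  have h3 : degIn (adjacency (plant K G)) v (W ∩ K) = ((W ∩ K).erase v).card := by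
    rw [← degIn_of_forall (A := adjacency (plant K G)) (v := v) (W := (W ∩ K).erase v)]
    · refine (Finset.sum_subset (Finset.erase_subset _ _) fun w hw hw' => ?_).symm
      have : w = v := by
        by_contra hne
        exact hw' (Finset.mem_erase.2 ⟨hne, hw⟩)
      simp [this, adjacency_self]
    · intro w hw
      obtain ⟨hne, hw⟩ := Finset.mem_erase.1 hw
      exact adjacency_plant_of_mem G hv (Finset.mem_inter.1 hw).2 hne.symm
  rw [h1, h2, h3]

/-- Planting does not affect the pairs at `v`. Erasing `v` costs nothing and provides the hypothesis
`v ∉ W` of the tail bound. -/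
lemma degIn_plant_of_notMem [DecidableEq V] {K : Finset V} (G : SimpleGraph V) {v : V} (W : Finset V)
    (hv : v ∉ K) : degIn (adjacency (plant K G)) v W = degIn (adjacency G) v (W.erase v) := by
  rw [degIn_congr fun w _ => adjacency_plant_of_notMem G (Or.inl hv)]
  refine (Finset.sum_subset (Finset.erase_subset _ _) fun w hw hw' => ?_).symm
  have : w = v := by
    by_contra hne
    exact hw' (Finset.mem_erase.2 ⟨hne, hw⟩)
  simp [this, adjacency_self]

variable [DecidableEq V] [Fintype V]

/-- With high probability, high degree in `W` characterizes the clique vertices in `W`. -/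
lemma expect_not_highDegree_iff_le (K W : Finset V) (hW : 1 ≤ W.card)
    (hbig : 3 * Real.sqrt (W.card * Real.logb 2 W.card) + 1 ≤ ((W ∩ K).card : ℝ) / 2) :
    𝔼 G : SimpleGraph V, ind (¬ ∀ v ∈ W,
      ((W.card : ℝ) / 2 + 2 * Real.sqrt (W.card * Real.logb 2 W.card) ≤
        degIn (adjacency (plant K G)) v W ↔ v ∈ K)) ≤ (W.card : ℝ)⁻¹ := by
  set N : ℝ := (W.card : ℝ) with hN
  have hN1 : 1 ≤ N := by rw [hN]; exact_mod_cast hW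
  have hlog : 0 ≤ Real.logb 2 N := Real.logb_nonneg one_lt_two hN1
  set r := Real.sqrt (N * Real.logb 2 N) with hr
  have hr0 : 0 ≤ r := Real.sqrt_nonneg _
  have hrsq : r ^ 2 = N * Real.logb 2 N := Real.sq_sqrt (by positivity)
  have hsub : ((W ∩ K).card : ℝ) + (W \ K).card = N := by
    rw [hN]; exact_mod_cast Finset.card_inter_add_card_sdiff W K
  have hv : ∀ v ∈ W, 𝔼 G : SimpleGraph V,
      ind (¬ (N / 2 + 2 * r ≤ degIn (adjacency (plant K G)) v W ↔ v ∈ K)) ≤ (N ^ 2)⁻¹ := by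
    intro v hvW
    by_cases hvK : v ∈ K
    -- The mean degree is `N/2 + |W ∩ K|/2 - 1`, as `v` is not its own neighbour; this is the `+ 1`
    -- in `hbig`. So the mean is at least `N/2 + 3r`, and missing the threshold is a deviation of
    -- `r`, of probability at most `exp(-2 log N)`.
    · refine (Finset.expect_le_expect fun G _ => ind_mono (Q := r ≤ (-1) *
        (degIn (adjacency G) v (W \ K) - (W \ K).card / 2)) fun h => ?_).trans
        ((expect_degIn_tail v (W \ K) (by simp [hvK]) (m := N) (by linarith) ?_ hr0
          (Or.inr rfl)).trans ?_)
      · simp only [hvK, iff_true, not_le] at h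
        rw [degIn_plant_of_mem G W hvK, Finset.card_erase_of_mem (by simp [hvK, hvW]),
          Nat.cast_sub (Finset.card_pos.2 ⟨v, by simp [hvK, hvW]⟩)] at h
        push_cast at h
        linarith
      · have : (0 : ℝ) ≤ (W ∩ K).card := by positivity
        linarith
      · rw [hrsq]
        refine le_trans (le_of_eq ?_) (exp_neg_two_logb_le hN1)
        congr 1
        field_simp
    · have hle : ((W.erase v).card : ℝ) ≤ N := by
        rw [hN]; exact_mod_cast Finset.card_erase_le
      -- Here the mean is at most `N/2`, so reaching the threshold is a deviation of `2r`.
      refine (Finset.expect_le_expect fun G _ => ind_mono (Q := 2 * r ≤ 1 *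
        (degIn (adjacency G) v (W.erase v) - (W.erase v).card / 2)) fun h => ?_).trans
        ((expect_degIn_tail v (W.erase v) (by simp) (m := N) (by linarith) ?_ (by linarith)
          (Or.inl rfl)).trans ?_)
      · simp only [hvK, iff_false, not_not] at h
        rw [degIn_plant_of_notMem G W hvK] at h
        have := hle
        linarith
      · exact hle
      · rw [mul_pow, hrsq]
        refine le_trans (Real.exp_le_exp.2 ?_) (exp_neg_two_logb_le hN1)
        have : -2 * (2 ^ 2 * (N * Real.logb 2 N)) / N = -8 * Real.logb 2 N := by
          field_simp; ring
        rw [this]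
        linarith
  have key : ∀ G : SimpleGraph V, ind (¬ ∀ v ∈ W, (N / 2 + 2 * r ≤
      degIn (adjacency (plant K G)) v W ↔ v ∈ K)) ≤
      ∑ v ∈ W, ind (¬ (N / 2 + 2 * r ≤ degIn (adjacency (plant K G)) v W ↔ v ∈ K)) :=
    fun G => ind_le_sum fun h => by push Not at h ⊢; simpa using h
  refine (Finset.expect_le_expect fun G _ => key G).trans ?_
  rw [Finset.expect_sum_comm]
  refine (Finset.sum_le_sum hv).trans_eq ?_
  rw [Finset.sum_const, nsmul_eq_mul, ← hN]
  field_simp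

/-- On a random graph, `Keep-High-Degree-And-Complete` finds the clique vertices in `W`. -/
lemma expect_keepHighDegreeAndComplete_random_le (K : Finset V) (W : List V) (hW : W.Nodup)
    (B : SimpleGraph V → V → V → Bool)
    (hB : ∀ G, ∀ u ∈ W, ∀ v ∈ W, B G u v = adjacency (plant K G) u v)
    (hBK : ∀ G, ∀ u ∈ K, ∀ v ∈ K, u ≠ v → B G u v = true)
    (hbig : 3 * Real.sqrt (W.length * Real.logb 2 W.length) + 1 ≤
      ((W.toFinset ∩ K).card : ℝ) / 2)
    (hs : seedSize 1 W.length ≤ (W.toFinset ∩ K).card) :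
    𝔼 G, (keepHighDegreeAndComplete W W.length).expect (B G)
        (fun found => 1 - ind (FoundMarked (· ∈ K) W found)) ≤
      2 * (W.length : ℝ)⁻¹ + 2 ^ seedSize 1 W.length *
        Real.exp (-(((W.toFinset ∩ K).card : ℝ) - seedSize 1 W.length) / 2) := by
  classical
  have hcardW : W.toFinset.card = W.length := List.toFinset_card_of_nodup hW
  -- For the empty list `hbig` would read `1 ≤ 0`.
  obtain ⟨w, ws, rfl⟩ : ∃ w ws, W = w :: ws := by
    cases W with
    | nil => simp at hbig; norm_num at hbig
    | cons w ws => exact ⟨w, ws, rfl⟩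
  generalize hWdef : w :: ws = W at *
  have hlen : 1 ≤ W.length := by rw [← hWdef]; simp
  set N : ℝ := (W.length : ℝ) with hN
  have hN1 : 1 ≤ N := by rw [hN]; exact_mod_cast hlen
  set s := seedSize 1 W.length with hsdef
  set c := (W.toFinset ∩ K).card with hc
  have hcount : W.countP (fun v => @decide (v ∈ K) (Classical.propDecidable _)) = c := by
    rw [List.countP_eq_length_filter, ← List.toFinset_card_of_nodup (hW.filter _),
      List.toFinset_filter, hc]
    congr 1
    ext v
    simp
  have hdegW : ∀ G, ∀ v ∈ W, ((W.countP fun u => B G u v) : ℝ) =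
      degIn (adjacency (plant K G)) v W.toFinset := by
    intro G v hv
    rw [countP_eq_degIn' _ hW]
    · exact degIn_congr fun u hu => hB G v hv u (List.mem_toFinset.1 hu)
    · intro u hu
      rw [hB G u hu v hv, hB G v hv u hu, adjacency_comm]
  set E4 : SimpleGraph V → Prop := fun G => ∀ v ∈ W.toFinset,
      ((W.toFinset.card : ℝ) / 2 + 2 * Real.sqrt (W.toFinset.card * Real.logb 2 W.toFinset.card) ≤
        degIn (adjacency (plant K G)) v W.toFinset ↔ v ∈ K) with hE4
  let A₀ : V → V → Bool := fun _ _ => false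
  -- The decoupling: outside the event `¬ E4 G` the loop and the seed are replaced by their
  -- query-free versions run on `A₀`, and the graph enters only through the pairs between the seed
  -- and `W \ K`.
  have hsep : ∀ G, (keepHighDegreeAndComplete W W.length).expect (B G)
        (fun found => 1 - ind (FoundMarked (· ∈ K) W found)) ≤ ind (¬ E4 G) +
      (collectMarked (· ∈ K) w ws W.length []).expect A₀ fun S =>
        if S.length < s then 1 else (randomSubset s S).expect A₀ fun seed =>
          ∑ u ∈ W.toFinset \ K, ind (∀ v ∈ seed.toFinset, adjacency G u v = true) := by
    intro G
    by_cases h : E4 G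
    · rw [ind_of_not (not_not.2 h), zero_add]
      have h1 := expect_keepHighDegreeAndComplete_le (A := B G) (C := (· ∈ K)) w ws
        (W.toFinset \ K) (by rw [hWdef]; exact hW) (by
          rw [hWdef]
          intro v hv
          rw [hdegW G v hv]
          have := h v (List.mem_toFinset.2 hv)
          rwa [hcardW] at this)
        (fun u v hu hv => hBK G u hu v hv) (by
          rw [hWdef]
          intro u hu hK
          simp [hu, hK]) W.length
      rw [hWdef] at h1
      refine (le_of_eq ?_).trans (h1.trans ?_)
      · congr 1
        ext found
        by_cases hf : FoundMarked (· ∈ K) W found <;> simp [ind, hf]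
      · rw [(queryFree_collectMarked (· ∈ K) w ws W.length []).expect_eq (B G) A₀]
        have hens := ensures_collectMarked (A := A₀) (· ∈ K) w ws W.length [] List.nodup_nil
          (by simp)
        rw [hWdef] at hens
        refine hens.expect_mono ?_
        rintro S ⟨hS, hSC, -⟩
        split_ifs
        · exact le_rfl
        rw [(queryFree_randomSubset _ S).expect_eq (B G) A₀]
        refine (ensures_randomSubset _ S).expect_mono ?_
        rintro seed ⟨hsub, -⟩
        refine Finset.sum_le_sum fun u hu => ?_
        rw [Finset.mem_sdiff, List.mem_toFinset] at hu
        rw [← ind_eq]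
        refine ind_mono fun hall v hv => ?_
        rw [List.mem_toFinset] at hv
        have hvW := (hSC v (hsub.subset hv)).1
        rw [← adjacency_plant_of_notMem G (Or.inl hu.2), ← hB G u hu.1 v hvW]
        exact List.all_eq_true.1 hall v hv
    · rw [ind_of h]
      refine ((ensures_true _).expect_le (c := 1) fun found _ => by
        linarith [ind_nonneg (FoundMarked (· ∈ K) W found)]).trans ?_
      refine le_add_of_nonneg_right (expect_nonneg fun S => ?_)
      split_ifs
      · norm_num
      · exact expect_nonneg fun seed => Finset.sum_nonneg fun u _ => ind_nonneg _
  refine (Finset.expect_le_expect fun G _ => hsep G).trans ?_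
  rw [Finset.expect_add_distrib]
  have hE := expect_not_highDegree_iff_le K W.toFinset (by rw [hcardW]; exact hlen)
    (by rw [hcardW]; exact hbig)
  rw [← expect_finset_expect]
  have hmarked : ((collectMarked (· ∈ K) w ws W.length []).expect A₀ fun S =>
      𝔼 G : SimpleGraph V, if S.length < s then 1 else (randomSubset s S).expect A₀ fun seed =>
          ∑ u ∈ W.toFinset \ K, ind (∀ v ∈ seed.toFinset, adjacency G u v = true)) ≤
      (collectMarked (· ∈ K) w ws W.length []).expect A₀ fun S =>
        (if S.length < s then 1 else 0) + N⁻¹ := by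
    have hens := ensures_collectMarked (A := A₀) (· ∈ K) w ws W.length [] List.nodup_nil (by simp)
    rw [hWdef] at hens
    refine hens.expect_mono ?_
    rintro S ⟨hS, hSC, -⟩
    by_cases hlt : S.length < s
    · simp only [hlt, if_true, Fintype.expect_const]
      have : 0 ≤ N⁻¹ := by positivity
      linarith
    · simp only [hlt, if_false, zero_add]
      rw [← expect_finset_expect]
      refine (ensures_randomSubset s S).expect_le ?_
      rintro seed ⟨hsub, hseedlen⟩
      have hseed : seed.Nodup := by
        obtain ⟨l, hl, hl'⟩ := hsub
        exact hl.nodup_iff.1 (hl'.nodup hS)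
      rw [Finset.expect_sum_comm]
      -- The seed is fixed and lies in `K`, so its pairs with `u ∉ K` are fair coins.
      have : ∀ u ∈ W.toFinset \ K, 𝔼 G : SimpleGraph V,
          ind (∀ v ∈ seed.toFinset, adjacency G u v = true) ≤ (N ^ 2)⁻¹ := by
        intro u hu
        rw [Finset.mem_sdiff] at hu
        rw [expect_forall_adjacency, List.toFinset_card_of_nodup hseed, hseedlen,
          min_eq_left (not_lt.1 hlt), one_div, inv_pow]
        · exact inv_anti₀ (by positivity) (sq_le_two_pow_seedSize hlen)
        · rw [List.mem_toFinset]
          exact fun h => hu.2 (hSC u (hsub.subset h)).2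
      refine (Finset.sum_le_sum this).trans ?_
      rw [Finset.sum_const, nsmul_eq_mul]
      have hle : ((W.toFinset \ K).card : ℝ) ≤ N := by
        rw [hN, ← hcardW]
        exact_mod_cast Finset.card_le_card Finset.sdiff_subset
      refine (mul_le_mul_of_nonneg_right hle (by positivity)).trans_eq ?_
      field_simp
  have hshort := expect_collectMarked_short_le (A := A₀) (· ∈ K) w ws s (by rwa [hWdef])
    (by rw [hWdef, hcount]; exact hs) W.length [] List.nodup_nil (by simp)
  rw [hWdef, hcount] at hshort
  -- There are as many rounds as vertices, which cancels the `N` in the rate.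
  have hpow : (1 - ((c : ℝ) - s) / (2 * N)) ^ W.length ≤ Real.exp (-((c : ℝ) - s) / 2) := by
    have hcN : (c : ℝ) ≤ N := by
      rw [hN, ← hcardW]
      exact_mod_cast Finset.card_le_card Finset.inter_subset_left
    have hs0 : (0 : ℝ) ≤ s := by positivity
    refine (pow_le_pow_left₀ ?_ (Real.one_sub_le_exp_neg _) _).trans ?_
    · rw [sub_nonneg, div_le_one (by positivity)]
      linarith
    · rw [← Real.exp_nat_mul]
      apply le_of_eq
      congr 1
      rw [← hN]
      field_simp
  rw [expect_add, expect_const] at hmarked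
  have h2 : (2 : ℝ) ^ s / 2 ^ ([] : List V).length *
      (1 - ((c : ℝ) - s) / (2 * N)) ^ W.length ≤ 2 ^ s * Real.exp (-((c : ℝ) - s) / 2) := by
    rw [List.length_nil, pow_zero, div_one]
    gcongr
  rw [hcardW] at hE
  have hE' : 𝔼 G, ind (¬ E4 G) ≤ N⁻¹ := by
    simp only [hE4, hcardW]
    exact hE
  linarith

end MiddleStage

/-! ### The algorithm on a random graph, for a fixed clique and a fixed sample -/

section FixedSample

open Prog

variable {n : ℕ}

lemma passesFilter_iff {A : Fin n → Fin n → Bool} {V₂ : Finset (Fin n)} {k : ℕ} {v : Fin n}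
    (hA : ∀ u, A u v = A v u) : PassesFilter A V₂ k v ↔
      |degIn A v V₂ - ((n : ℝ) + k) / 4| ≤ 2 * Real.sqrt n := by
  rw [PassesFilter, countP_eq_degIn' (fun u _ => hA u) V₂.nodup_toList, Finset.toList_toFinset,
    abs_le]
  constructor <;> rintro ⟨h1, h2⟩ <;> constructor <;> linarith

lemma passesFilter_plant_iff {K V₂ : Finset (Fin n)} {k : ℕ} {v : Fin n} (G : SimpleGraph (Fin n)) :
    PassesFilter (adjacency (plant K G)) V₂ k v ↔
      |degIn (adjacency (plant K G)) v V₂ - ((n : ℝ) + k) / 4| ≤ 2 * Real.sqrt n :=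
  passesFilter_iff fun u => adjacency_comm _ u v

lemma adjacency_plant_congr {K : Finset (Fin n)} {G H : SimpleGraph (Fin n)} {u v : Fin n}
    (h : adjacency G u v = adjacency H u v) :
    adjacency (plant K G) u v = adjacency (plant K H) u v := by
  by_cases hK : u ∉ K ∨ v ∉ K
  · rw [adjacency_plant_of_notMem G hK, adjacency_plant_of_notMem H hK, h]
  · push Not at hK
    by_cases huv : u = v
    · rw [huv, adjacency_self, adjacency_self]
    · rw [adjacency_plant_of_mem G hK.1 hK.2 huv, adjacency_plant_of_mem H hK.1 hK.2 huv]

/-- The filter at `v` reads only the pairs from `v` to `V₂`. All independence statements about the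
filter rest on this. -/
lemma passesFilter_congr {K V₂ : Finset (Fin n)} {k : ℕ} {v : Fin n} {G H : SimpleGraph (Fin n)}
    (h : ∀ u ∈ V₂, adjacency G v u = adjacency H v u) :
    PassesFilter (adjacency (plant K G)) V₂ k v ↔ PassesFilter (adjacency (plant K H)) V₂ k v := by
  rw [passesFilter_plant_iff, passesFilter_plant_iff,
    degIn_congr fun u hu => adjacency_plant_congr (h u hu)]

lemma half_card_bounds {V₂ : Finset (Fin n)} (hV₂ : V₂.card = n / 2) :
    (n : ℝ) / 2 - 1 / 2 ≤ V₂.card ∧ (V₂.card : ℝ) ≤ n / 2 := by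
  have h1 : n ≤ 2 * (n / 2) + 1 := by omega
  have h2 : 2 * (n / 2) ≤ n := by omega
  have h1' : (n : ℝ) ≤ 2 * ((n / 2 : ℕ) : ℝ) + 1 := by exact_mod_cast h1
  have h2' : 2 * ((n / 2 : ℕ) : ℝ) ≤ n := by exact_mod_cast h2
  rw [hV₂]
  constructor <;> linarith

/-- A vertex outside the clique rarely passes the filter. -/
lemma expect_passesFilter_le {K V₂ : Finset (Fin n)} {k : ℕ} {v : Fin n} (hn : 0 < n)
    (hV₂ : V₂.card = n / 2) (hv : v ∉ V₂) (hvK : v ∉ K)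
    (ht : 0 ≤ (k : ℝ) / 4 - 2 * Real.sqrt n) :
    𝔼 G, ind (PassesFilter (adjacency (plant K G)) V₂ k v) ≤
      Real.exp (-4 * ((k : ℝ) / 4 - 2 * Real.sqrt n) ^ 2 / n) := by
  have hn0 : (0 : ℝ) < n := by exact_mod_cast hn
  obtain ⟨-, hc⟩ := half_card_bounds hV₂
  -- The mean `|V₂|/2` is at most `n/4`, so only the lower cutoff of the filter is used.
  refine (Finset.expect_le_expect fun G _ => ind_mono (Q := (k : ℝ) / 4 - 2 * Real.sqrt n ≤ 1 *
    (degIn (adjacency G) v V₂ - V₂.card / 2)) fun h => ?_).trans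
    ((expect_degIn_tail v V₂ hv (m := n / 2) (by positivity) hc ht (Or.inl rfl)).trans_eq ?_)
  · rw [passesFilter_plant_iff, degIn_plant_of_notMem G V₂ hvK, Finset.erase_eq_of_notMem hv,
      abs_le] at h
    linarith
  · congr 1
    field_simp
    ring

/-- A clique vertex usually passes the filter. -/
lemma expect_not_passesFilter_le {K V₂ : Finset (Fin n)} {k : ℕ} {v : Fin n} (hn : 25 ≤ n)
    (hkn : k ≤ n) (hV₂ : V₂.card = n / 2) (hv : v ∉ V₂) (hvK : v ∈ K)
    (hK : |((V₂ ∩ K).card : ℝ) - k * V₂.card / n| ≤ Real.sqrt n) :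
    𝔼 G, ind (¬ PassesFilter (adjacency (plant K G)) V₂ k v) ≤ 1 / 50 := by
  have hn0 : (25 : ℝ) ≤ n := by exact_mod_cast hn
  obtain ⟨hc', hc⟩ := half_card_bounds hV₂
  set r := Real.sqrt n with hr
  have hr5 : 5 ≤ r := Real.le_sqrt_of_sq_le (by linarith)
  have hrr : r ^ 2 = n := Real.sq_sqrt (by linarith)
  have hsplit : ((V₂ ∩ K).card : ℝ) + (V₂ \ K).card = V₂.card := by
    exact_mod_cast Finset.card_inter_add_card_sdiff V₂ K
  have hkn' : (k : ℝ) ≤ n := by exact_mod_cast hkn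
  have hk0 : (0 : ℝ) ≤ k := by positivity
  have hmean1 : (k : ℝ) * V₂.card / n ≤ k / 2 := by
    rw [div_le_iff₀ (by linarith)]
    nlinarith
  have hmean2 : (k : ℝ) / 2 - 1 / 2 ≤ k * V₂.card / n := by
    rw [le_div_iff₀ (by linarith)]
    nlinarith
  -- The centre `(|V₂| + |V₂ ∩ K|)/2` is within `√n/2 + 1/2 ≤ 3/5 √n` of `(n + k)/4`, since `√n ≥
  -- 5`. Of the window `2√n` there remains `7/5 √n` for the random part, with tail `exp(-196/25)`.
  have htail : ∀ σ : ℝ, σ = 1 ∨ σ = -1 →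
      𝔼 G : SimpleGraph (Fin n), ind (7 / 5 * r ≤ σ *
        (degIn (adjacency G) v (V₂ \ K) - (V₂ \ K).card / 2)) ≤ 1 / 100 := by
    intro σ hσ
    refine (expect_degIn_tail v (V₂ \ K) (by simp [hv]) (m := n / 2) (by linarith) ?_
      (by linarith) hσ).trans ?_
    · have : (0 : ℝ) ≤ (V₂ ∩ K).card := by positivity
      linarith
    · have : -2 * (7 / 5 * r) ^ 2 / ((n : ℝ) / 2) = -(196 / 25) := by
        rw [mul_pow, hrr]; field_simp; norm_num
      rw [this]
      have h1 : Real.exp (-(196 / 25)) ≤ Real.exp (-1) ^ 7 := by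
        rw [← Real.exp_nat_mul]
        exact Real.exp_le_exp.2 (by norm_num)
      refine h1.trans ((pow_le_pow_left₀ (Real.exp_pos _).le
        (Real.exp_neg_one_lt_d9.le.trans (by norm_num : (_ : ℝ) ≤ 0.4)) 7).trans (by norm_num))
  have key : ∀ G : SimpleGraph (Fin n), ind (¬ PassesFilter (adjacency (plant K G)) V₂ k v) ≤
      ind (7 / 5 * r ≤ 1 * (degIn (adjacency G) v (V₂ \ K) - (V₂ \ K).card / 2)) +
      ind (7 / 5 * r ≤ -1 * (degIn (adjacency G) v (V₂ \ K) - (V₂ \ K).card / 2)) := by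
    intro G
    refine (ind_mono fun h => ?_).trans (ind_or_le _ _)
    rw [passesFilter_plant_iff, degIn_plant_of_mem G V₂ hvK,
      Finset.erase_eq_of_notMem (by simp [hv])] at h
    by_contra hcon
    push Not at hcon
    apply h
    obtain ⟨hK1, hK2⟩ := abs_le.1 hK
    rw [abs_le]
    constructor <;> linarith [hcon.1, hcon.2]
  refine (Finset.expect_le_expect fun G _ => key G).trans ?_
  rw [Finset.expect_add_distrib]
  have := htail 1 (Or.inl rfl)
  have := htail (-1) (Or.inr rfl)
  linarith

/-- Most clique vertices of the sample pass the filter. -/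
lemma expect_few_pass_le {K V₂ S : Finset (Fin n)} {k : ℕ} (hn : 25 ≤ n) (hkn : k ≤ n)
    (hV₂ : V₂.card = n / 2) (hS : Disjoint S V₂) (hSK : S ⊆ K) (hS0 : 0 < S.card)
    (hK : |((V₂ ∩ K).card : ℝ) - k * V₂.card / n| ≤ Real.sqrt n) :
    𝔼 G, ind ((S.card : ℝ) / 10 < ∑ v ∈ S, ind (¬ PassesFilter (adjacency (plant K G)) V₂ k v)) ≤
      4 / S.card := by
  set M : ℝ := (S.card : ℝ) with hM
  have hM0 : 0 < M := by rw [hM]; exact_mod_cast hS0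
  have hq : ∀ v ∈ S, 𝔼 G, ind (¬ PassesFilter (adjacency (plant K G)) V₂ k v) ≤ 1 / 50 :=
    fun v hv => expect_not_passesFilter_le hn hkn hV₂ (Finset.disjoint_left.1 hS hv) (hSK hv) hK
  have hcheb := expect_sq_sum_sub_le Finset.univ_nonempty S
    (fun v (G : SimpleGraph (Fin n)) => ¬ PassesFilter (adjacency (plant K G)) V₂ k v) (1 / 50) hq
    (by
      -- The pairs at `v` against all other pairs: those from `w` to `V₂` avoid `v`, since `w ≠ v`
      -- and `v ∉ V₂`.
      intro v hv w hw hvw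
      have hv2 := Finset.disjoint_left.1 hS hv
      refine (expect_mul_of_merge {e | v ∈ e} (fun G H => ?_) fun G H => ?_).le
      · rw [passesFilter_congr fun u _ => adjacency_merge_of_mem G H (by simp)]
      · rw [passesFilter_congr fun u hu => adjacency_merge_of_notMem G H ?_]
        simp only [Set.mem_ofPred_eq, Sym2.mem_iff, not_or]
        exact ⟨hvw, by rintro rfl; exact hv2 hu⟩)
  set e : ℝ := ∑ v ∈ S, 𝔼 G, ind (¬ PassesFilter (adjacency (plant K G)) V₂ k v) with he
  have he1 : e ≤ M / 50 := by
    refine (Finset.sum_le_sum hq).trans_eq ?_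
    rw [Finset.sum_const, nsmul_eq_mul, ← hM]; ring
  -- The mean is at most `M/50`, so exceeding `M/10` is a deviation of `2M/25`. The variance is at
  -- most `M/50`, and the quotient is below `4/M`.
  have key : ∀ G, ind (M / 10 < ∑ v ∈ S, ind (¬ PassesFilter (adjacency (plant K G)) V₂ k v)) ≤
      (∑ v ∈ S, ind (¬ PassesFilter (adjacency (plant K G)) V₂ k v) - e) ^ 2 *
        (2 * M / 25 * (2 * M / 25))⁻¹ := by
    intro G
    by_cases h : M / 10 < ∑ v ∈ S, ind (¬ PassesFilter (adjacency (plant K G)) V₂ k v)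
    · rw [ind_of h, ← div_eq_mul_inv, le_div_iff₀ (by positivity)]
      nlinarith
    · rw [ind_of_not h]
      positivity
  refine (Finset.expect_le_expect fun G _ => key G).trans ?_
  rw [← Finset.expect_mul]
  refine (mul_le_mul_of_nonneg_right hcheb (by positivity)).trans ?_
  rw [← hM, ← div_eq_mul_inv, div_le_div_iff₀ (by positivity) hM0]
  nlinarith

/-- Few vertices of the sample outside of the clique pass the filter. -/
lemma expect_many_pass_le {K V₂ S : Finset (Fin n)} {k : ℕ} {B : ℝ} (hn : 0 < n)
    (hV₂ : V₂.card = n / 2) (hS : Disjoint S V₂) (hSK : Disjoint S K) (hB : 0 < B)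
    (ht : 0 ≤ (k : ℝ) / 4 - 2 * Real.sqrt n) :
    𝔼 G, ind (B < ∑ v ∈ S, ind (PassesFilter (adjacency (plant K G)) V₂ k v)) ≤
      S.card * Real.exp (-4 * ((k : ℝ) / 4 - 2 * Real.sqrt n) ^ 2 / n) / B := by
  have key : ∀ G, ind (B < ∑ v ∈ S, ind (PassesFilter (adjacency (plant K G)) V₂ k v)) ≤
      (∑ v ∈ S, ind (PassesFilter (adjacency (plant K G)) V₂ k v)) / B := by
    intro G
    by_cases h : B < ∑ v ∈ S, ind (PassesFilter (adjacency (plant K G)) V₂ k v)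
    · rw [ind_of h, le_div_iff₀ hB]
      linarith
    · rw [ind_of_not h]
      exact div_nonneg (Finset.sum_nonneg fun v _ => ind_nonneg _) hB.le
  refine (Finset.expect_le_expect fun G _ => key G).trans ?_
  rw [← Finset.expect_div, Finset.expect_sum_comm]
  refine div_le_div_of_nonneg_right ((Finset.sum_le_sum fun v hv => expect_passesFilter_le hn hV₂
    (Finset.disjoint_left.1 hS hv) (Finset.disjoint_left.1 hSK hv) ht).trans_eq ?_) hB.le
  rw [Finset.sum_const, nsmul_eq_mul]

/-- No vertex outside of the clique has many neighbours in a set of clique vertices. -/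
lemma expect_exists_degIn_le {K S : Finset (Fin n)} (hSK : S ⊆ K) (hS0 : 0 < S.card) :
    𝔼 G : SimpleGraph (Fin n), ind (∃ u ∉ K, 11 / 20 * (S.card : ℝ) ≤
        degIn (adjacency (plant K G)) u S) ≤ n * Real.exp (-(S.card : ℝ) / 200) := by
  set M : ℝ := (S.card : ℝ) with hM
  have hM0 : 0 < M := by rw [hM]; exact_mod_cast hS0
  have key : ∀ G : SimpleGraph (Fin n), ind (∃ u ∉ K, 11 / 20 * M ≤
        degIn (adjacency (plant K G)) u S) ≤
      ∑ u ∈ Kᶜ, ind (M / 20 ≤ 1 * (degIn (adjacency G) u S - M / 2)) := by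
    intro G
    refine ind_le_sum ?_
    rintro ⟨u, hu, h⟩
    refine ⟨u, by simpa using hu, ?_⟩
    rw [degIn_plant_of_notMem G S hu, Finset.erase_eq_of_notMem fun h => hu (hSK h)] at h
    linarith
  refine (Finset.expect_le_expect fun G _ => key G).trans ?_
  rw [Finset.expect_sum_comm]
  refine (Finset.sum_le_sum (g := fun _ => Real.exp (-M / 200)) fun u hu => ?_).trans ?_
  · rw [Finset.mem_compl] at hu
    refine (expect_degIn_tail u S (fun h => hu (hSK h)) hM0 hM.ge (by positivity)
      (Or.inl rfl)).trans_eq ?_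
    congr 1
    field_simp
    norm_num
  · rw [Finset.sum_const, nsmul_eq_mul]
    gcongr
    exact_mod_cast (Finset.card_le_univ _).trans_eq (Fintype.card_fin n)

lemma seedSize_mono {m n : ℕ} (hm : 1 ≤ m) (h : m ≤ n) : seedSize 1 m ≤ seedSize 1 n := by
  have hm0 : (0 : ℝ) < m := by exact_mod_cast hm
  have hmn : (m : ℝ) ≤ n := by exact_mod_cast h
  refine Nat.ceil_le_ceil ?_
  gcongr
  norm_num

end FixedSample

/-! ### The filtered sample and the combined error bound for a fixed clique and sample -/

section FixedSample

open Prog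

variable {n : ℕ}

lemma card_filtered_inter {K V₂ : Finset (Fin n)} {k : ℕ} {A : Fin n → Fin n → Bool}
    {SP : List (Fin n)} :
    (((filtered A V₂ k SP).toFinset ∩ K).card : ℝ) =
      (SP.toFinset ∩ K).card - ∑ v ∈ SP.toFinset ∩ K, ind (¬ PassesFilter A V₂ k v) := by
  classical
  have h1 : (filtered A V₂ k SP).toFinset ∩ K =
      (SP.toFinset ∩ K).filter fun v => PassesFilter A V₂ k v := by
    ext v
    simp [filtered]
    tauto
  simp only [ind_eq]
  rw [h1, Finset.sum_boole, eq_sub_iff_add_eq]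
  exact_mod_cast Finset.card_filter_add_card_filter_not _

lemma card_filtered_sdiff {K V₂ : Finset (Fin n)} {k : ℕ} {A : Fin n → Fin n → Bool}
    {SP : List (Fin n)} :
    (((filtered A V₂ k SP).toFinset \ K).card : ℝ) =
      ∑ v ∈ SP.toFinset \ K, ind (PassesFilter A V₂ k v) := by
  classical
  have h1 : (filtered A V₂ k SP).toFinset \ K =
      (SP.toFinset \ K).filter fun v => PassesFilter A V₂ k v := by
    ext v
    simp [filtered]
    tauto
  simp only [ind_eq]
  rw [h1, Finset.sum_boole]

/-- Redrawing the pairs inside `V₁` leaves the filter unchanged, because every pair it reads has an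
endpoint in `V₂`. -/
lemma filtered_congr {K V₁ V₂ : Finset (Fin n)} {k : ℕ} {SP : List (Fin n)}
    (hV : Disjoint V₁ V₂) (G H : SimpleGraph (Fin n)) :
    filtered (adjacency (plant K (merge {e | ¬ ∀ u ∈ e, u ∈ V₁} G H))) V₂ k SP =
      filtered (adjacency (plant K G)) V₂ k SP := by
  classical
  refine List.filter_congr fun v hv => ?_
  rw [decide_eq_decide]
  refine passesFilter_congr fun u hu => adjacency_merge_of_mem G H ?_
  simp only [Set.mem_ofPred_eq, Sym2.mem_iff, not_forall]
  exact ⟨u, Or.inr rfl, fun h => Finset.disjoint_left.1 hV h hu⟩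

/-- The probability of failure of the middle stage, given the sizes of the filtered sample. -/
lemma expect_middleStage_le {K V₁ V₂ : Finset (Fin n)} {k : ℕ} {SP : List (Fin n)} {B M : ℝ}
    (hV : Disjoint V₁ V₂) (hSP : SP.Nodup) (hSPV : ∀ v ∈ SP, v ∈ V₁) (hM : 0 < M)
    (hMle : ((SP.toFinset ∩ K).card : ℝ) ≤ M)
    (hbig : 3 * Real.sqrt ((M + B) * Real.logb 2 n) + 1 ≤ 9 / 20 * M)
    (hseed : (seedSize 1 n : ℝ) ≤ 9 / 20 * M) :
    𝔼 G, ind (9 / 10 * M ≤ ((filtered (adjacency (plant K G)) V₂ k SP).toFinset ∩ K).card ∧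
        (((filtered (adjacency (plant K G)) V₂ k SP).toFinset \ K).card : ℝ) ≤ B) *
      (keepHighDegreeAndComplete (filtered (adjacency (plant K G)) V₂ k SP)
        (filtered (adjacency (plant K G)) V₂ k SP).length).expect (adjacency (plant K G))
        (fun found => 1 - ind (FoundMarked (· ∈ K)
          (filtered (adjacency (plant K G)) V₂ k SP) found)) ≤
      3 / M + 2 ^ seedSize 1 n * Real.exp (-M / 5) := by
  have hpos : 0 ≤ 3 / M + 2 ^ seedSize 1 n * Real.exp (-M / 5) := by positivity
  -- Condition on all pairs not inside `V₁`: the filtered list becomes fixed, and the graph on it is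
  -- fresh.
  rw [← expect_merge {e | ¬ ∀ u ∈ e, u ∈ V₁}]
  refine expect_le_of_forall_le hpos fun G _ => ?_
  simp only [filtered_congr hV]
  rw [← Finset.mul_expect]
  set W := filtered (adjacency (plant K G)) V₂ k SP with hWdef
  have hW : W.Nodup := hSP.filter _
  have hWV : ∀ v ∈ W, v ∈ V₁ := fun v hv => hSPV v (List.mem_filter.1 hv).1
  by_cases hgood : 9 / 10 * M ≤ (W.toFinset ∩ K).card ∧ ((W.toFinset \ K).card : ℝ) ≤ B
  swap
  · rw [ind_of_not hgood, zero_mul]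
    exact hpos
  rw [ind_of hgood, one_mul]
  obtain ⟨hc, hB⟩ := hgood
  set c := (W.toFinset ∩ K).card with hcdef
  have hsub : W.toFinset ∩ K ⊆ SP.toFinset ∩ K := by
    refine Finset.inter_subset_inter_right fun v hv => ?_
    rw [List.mem_toFinset] at hv ⊢
    exact (List.mem_filter.1 hv).1
  have hcM : (c : ℝ) ≤ M := le_trans (by exact_mod_cast Finset.card_le_card hsub) hMle
  have hN : (W.length : ℝ) = c + (W.toFinset \ K).card := by
    rw [← List.toFinset_card_of_nodup hW]
    exact_mod_cast (Finset.card_inter_add_card_sdiff W.toFinset K).symm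
  have hNn : W.length ≤ n := by
    rw [← List.toFinset_card_of_nodup hW]
    exact (Finset.card_le_univ _).trans_eq (Fintype.card_fin n)
  have hN0 : (0 : ℝ) < W.length := by
    have : (0 : ℝ) ≤ (W.toFinset \ K).card := by positivity
    linarith
  have hN1 : 1 ≤ W.length := by exact_mod_cast hN0
  have hs : seedSize 1 W.length ≤ seedSize 1 n := seedSize_mono hN1 hNn
  have hs' : (seedSize 1 W.length : ℝ) ≤ seedSize 1 n := by exact_mod_cast hs
  refine (expect_keepHighDegreeAndComplete_random_le K W hW
    (fun H => adjacency (plant K (merge {e | ¬ ∀ u ∈ e, u ∈ V₁} G H))) ?_ ?_ ?_ ?_).trans ?_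
  · intro H u hu v hv
    refine adjacency_plant_congr (adjacency_merge_of_notMem G H ?_)
    simp [hWV u hu, hWV v hv]
  · intro H u hu v hv huv
    exact adjacency_plant_of_mem _ hu hv huv
  · have hN1' : (1 : ℝ) ≤ W.length := by exact_mod_cast hN1
    have : Real.sqrt (W.length * Real.logb 2 W.length) ≤
        Real.sqrt ((M + B) * Real.logb 2 n) := by
      apply Real.sqrt_le_sqrt
      have hlog : Real.logb 2 W.length ≤ Real.logb 2 n :=
        Real.logb_le_logb_of_le one_lt_two hN0 (by exact_mod_cast hNn)
      have := Real.logb_nonneg one_lt_two hN1'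
      have hle : (W.length : ℝ) ≤ M + B := by linarith
      exact mul_le_mul hle hlog this (by linarith)
    linarith
  · have : (seedSize 1 W.length : ℝ) ≤ c := by linarith
    exact_mod_cast this
  -- Here `|W| ≥ c ≥ 9/10 M` gives `2/|W| ≤ 3/M`, and `c - s ≥ 9/20 M` gives the exponent `-M/5`.
  · refine add_le_add ?_ ?_
    · rw [← div_eq_mul_inv, div_le_div_iff₀ hN0 hM]
      have : (0 : ℝ) ≤ (W.toFinset \ K).card := by positivity
      nlinarith
    · exact mul_le_mul (pow_le_pow_right₀ one_le_two hs) (Real.exp_le_exp.2 (by linarith))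
        (Real.exp_pos _).le (by positivity)

open Classical in
/-- The failure probability for a fixed clique and a fixed sample. -/
lemma expect_afterSampling_random_le {K V₁ V₂ : Finset (Fin n)} {k : ℕ} {p B M : ℝ}
    {SP : List (Fin n)} (hn : 25 ≤ n) (hkn : k ≤ n) (hV : Disjoint V₁ V₂) (hV₂ : V₂.card = n / 2)
    (hK : |((V₂ ∩ K).card : ℝ) - k * V₂.card / n| ≤ Real.sqrt n)
    (ht : 0 ≤ (k : ℝ) / 4 - 2 * Real.sqrt n)
    (hSP : SP.Nodup) (hSPV : ∀ v ∈ SP, v ∈ V₁) (hlen : (SP.length : ℝ) ≤ p * n)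
    (hB : 0 < B) (hM : M = (SP.toFinset ∩ K).card)
    (hbig : 3 * Real.sqrt ((M + B) * Real.logb 2 n) + 1 ≤ 9 / 20 * M)
    (hseed : (seedSize 1 n : ℝ) ≤ 9 / 20 * M) :
    𝔼 G, (afterSampling V₂ k p SP).expect (adjacency (plant K G))
        (fun out => if out.toFinset ≠ K then 1 else 0) ≤
      p * n * Real.exp (-4 * ((k : ℝ) / 4 - 2 * Real.sqrt n) ^ 2 / n) / B + 7 / M +
        n * Real.exp (-M / 200) + 2 ^ seedSize 1 n * Real.exp (-M / 5) +
        n * (5 / 8) ^ seedSize 1 n := by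
  have hM0 : 0 < M := by
    have := Real.sqrt_nonneg ((M + B) * Real.logb 2 n)
    linarith
  set S := SP.toFinset ∩ K with hSdef
  have hS0 : 0 < S.card := by rw [hM] at hM0; exact_mod_cast hM0
  have hSV : Disjoint SP.toFinset V₂ := Finset.disjoint_left.2 fun v hv =>
    Finset.disjoint_left.1 hV (hSPV v (List.mem_toFinset.1 hv))
  set W : SimpleGraph (Fin n) → List (Fin n) := fun G =>
    filtered (adjacency (plant K G)) V₂ k SP with hW
  set bad₁ : SimpleGraph (Fin n) → Prop := fun G =>
    (S.card : ℝ) / 10 < ∑ v ∈ S, ind (¬ PassesFilter (adjacency (plant K G)) V₂ k v) with hbad₁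
  set bad₂ : SimpleGraph (Fin n) → Prop := fun G =>
    B < ∑ v ∈ SP.toFinset \ K, ind (PassesFilter (adjacency (plant K G)) V₂ k v) with hbad₂
  -- Stated for the unfiltered `S`, which does not depend on the graph: the filtered clique vertices
  -- are correlated with the pairs into `V₂`.
  set bad₃ : SimpleGraph (Fin n) → Prop := fun G =>
    ∃ u ∉ K, 11 / 20 * (S.card : ℝ) ≤ degIn (adjacency (plant K G)) u S with hbad₃
  set g : SimpleGraph (Fin n) → ℝ := fun G =>
    ind (9 / 10 * M ≤ ((W G).toFinset ∩ K).card ∧ (((W G).toFinset \ K).card : ℝ) ≤ B) *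
      (keepHighDegreeAndComplete (W G) (W G).length).expect (adjacency (plant K G))
        (fun found => 1 - ind (FoundMarked (· ∈ K) (W G) found)) with hg
  have hg0 : ∀ G, 0 ≤ g G := fun G => mul_nonneg (ind_nonneg _)
    (expect_nonneg fun found => sub_nonneg.2 (ind_le_one _))
  set R : ℝ := n * (5 / 8) ^ seedSize 1 n with hR
  have hR0 : 0 ≤ R := by positivity
  have key : ∀ G, (afterSampling V₂ k p SP).expect (adjacency (plant K G))
        (fun out => if out.toFinset ≠ K then 1 else 0) ≤
      ind (bad₁ G) + ind (bad₂ G) + ind (bad₃ G) + g G + R := by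
    intro G
    by_cases hall : bad₁ G ∨ bad₂ G ∨ bad₃ G
    · have h1 : (afterSampling V₂ k p SP).expect (adjacency (plant K G))
        (fun out => if out.toFinset ≠ K then (1 : ℝ) else 0) ≤ 1 :=
        (ensures_true _).expect_le fun out _ => by split_ifs <;> norm_num
      have h2 := ind_nonneg (bad₁ G)
      have h3 := ind_nonneg (bad₂ G)
      have h4 := ind_nonneg (bad₃ G)
      have h5 := hg0 G
      rcases hall with h | h | h <;> rw [ind_of h] at * <;> linarith
    · push Not at hall
      obtain ⟨hn1, hn2, hn3⟩ := hall
      have hWn : (W G).Nodup := hSP.filter _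
      have hc : 9 / 10 * M ≤ ((W G).toFinset ∩ K).card := by
        simp only [hW]
        rw [card_filtered_inter, ← hSdef, ← hM]
        simp only [hbad₁, not_lt, ← hM] at hn1
        linarith
      have hd : (((W G).toFinset \ K).card : ℝ) ≤ B := by
        simp only [hW]
        rw [card_filtered_sdiff]
        simpa only [hbad₂, not_lt] using hn2
      have hfl : (((W G).filter (· ∈ K)).toFinset) = (W G).toFinset ∩ K := by
        ext v; simp
      have hfn : ((W G).filter (· ∈ K)).Nodup := hWn.filter _
      have hlenW : ((W G).filter (· ∈ K)).length = ((W G).toFinset ∩ K).card := by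
        rw [← List.toFinset_card_of_nodup hfn, hfl]
      have h1 := expect_afterSampling_le (A := adjacency (plant K G)) K V₂ k p SP hSP hlen
        (fun u hu v hv => adjacency_plant_of_mem G hu hv) (by
          have : (seedSize 1 n : ℝ) ≤ ((filtered (adjacency (plant K G)) V₂ k SP).filter
            (· ∈ K)).length := by
            rw [show filtered (adjacency (plant K G)) V₂ k SP = W G from rfl, hlenW]
            linarith
          exact_mod_cast this)
      refine h1.trans ?_
      rw [ind_of_not hn1, ind_of_not hn2, ind_of_not hn3]
      simp only [zero_add]
      refine add_le_add (le_of_eq ?_) ?_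
      · simp only [hg]
        rw [ind_of ⟨hc, hd⟩, one_mul]
        congr 1
        ext found
        by_cases hf : FoundMarked (· ∈ K) (W G) found <;> simp [ind, hW] at hf ⊢ <;> simp [hf]
      · have hu : ∀ u ∈ Kᶜ, (((((W G).filter (· ∈ K)).countP (adjacency (plant K G) u) : ℕ) : ℝ) /
            ((W G).filter (· ∈ K)).length) ^ seedSize 1 n ≤ (5 / 8) ^ seedSize 1 n := by
          intro u hu
          refine pow_le_pow_left₀ (by positivity) ?_ _
          rw [countP_eq_degIn _ _ hfn, hfl, hlenW, div_le_iff₀ (by linarith)]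
          have h2 : degIn (adjacency (plant K G)) u ((W G).toFinset ∩ K) ≤
              degIn (adjacency (plant K G)) u S := by
            refine degIn_mono _ _ (Finset.inter_subset_inter_right fun v hv => ?_)
            rw [List.mem_toFinset] at hv ⊢
            exact (List.mem_filter.1 hv).1
          -- At most `11/20 M` neighbours among at least `9/10 M` vertices is a fraction `11/18 <
          -- 5/8`.
          have h3 : degIn (adjacency (plant K G)) u S < 11 / 20 * M := by
            by_contra hcon
            exact hn3 ⟨u, by simpa using hu, by rw [← hM]; exact not_lt.1 hcon⟩
          linarith
        refine (Finset.sum_le_sum hu).trans ?_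
        rw [Finset.sum_const, nsmul_eq_mul, hR]
        gcongr
        exact_mod_cast (Finset.card_le_univ _).trans_eq (Fintype.card_fin n)
  refine (Finset.expect_le_expect fun G _ => key G).trans ?_
  simp only [Finset.expect_add_distrib, Fintype.expect_const]
  have e1 : 𝔼 G, ind (bad₁ G) ≤ 4 / M := by
    rw [hM]
    exact expect_few_pass_le hn hkn hV₂ (hSV.mono_left Finset.inter_subset_left)
      Finset.inter_subset_right hS0 hK
  have e2 : 𝔼 G, ind (bad₂ G) ≤
      p * n * Real.exp (-4 * ((k : ℝ) / 4 - 2 * Real.sqrt n) ^ 2 / n) / B := by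
    refine (expect_many_pass_le (by omega) hV₂ (hSV.mono_left Finset.sdiff_subset)
      Finset.sdiff_disjoint hB ht).trans ?_
    gcongr
    refine le_trans ?_ hlen
    rw [← List.toFinset_card_of_nodup hSP]
    exact_mod_cast Finset.card_le_card Finset.sdiff_subset
  have e3 : 𝔼 G, ind (bad₃ G) ≤ n * Real.exp (-M / 200) := by
    rw [hM]
    exact expect_exists_degIn_le Finset.inter_subset_right hS0
  have e4 : 𝔼 G, g G ≤ 3 / M + 2 ^ seedSize 1 n * Real.exp (-M / 5) :=
    expect_middleStage_le hV hSP hSPV hM0 hM.ge hbig hseed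
  have e5 : 7 / M = 4 / M + 3 / M := by ring
  linarith

end FixedSample

/-! ### The random sample and the random clique -/

section Sampling

open Prog

variable {V : Type} {A : V → V → Bool}

lemma queryFree_select_flip (p : ℝ) (l : List V) : (select (fun _ => flip p) l).QueryFree := by
  induction l with
  | nil => trivial
  | cons v l ih =>
    exact fun b => ih.bind fun r => trivial

lemma expect_select_flip_cons {p : ℝ} (hp : p ∈ Set.Icc (0 : ℝ) 1) (v : V) (l : List V)
    (f : List V → ℝ) :
    (select (fun _ => flip p) (v :: l)).expect A f =
      p * (select (fun _ => flip p) l).expect A (fun r => f (v :: r)) +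
      (1 - p) * (select (fun _ => flip p) l).expect A f := by
  simp [select, tick_bind, flip, Set.projIcc_of_mem zero_le_one hp]

/-- The binomial variance. The shift `a` makes the induction close: the coin at the head of the list
moves it by `1 - p` or by `-p`. -/
lemma expect_select_flip_sq {p : ℝ} (hp : p ∈ Set.Icc (0 : ℝ) 1) (D : V → Bool) (l : List V)
    (a : ℝ) :
    (select (fun _ => flip p) l).expect A (fun r => ((r.countP D : ℝ) - p * l.countP D + a) ^ 2) =
      l.countP D * (p * (1 - p)) + a ^ 2 := by
  induction l generalizing a with
  | nil => simp [select]
  | cons v l ih =>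
    rw [expect_select_flip_cons hp]
    by_cases hv : D v = true
    · have h1 : ∀ r : List V, (((v :: r).countP D : ℝ) - p * (v :: l).countP D + a) ^ 2 =
          ((r.countP D : ℝ) - p * l.countP D + (a + 1 - p)) ^ 2 := by
        intro r
        simp only [List.countP_cons, hv, if_true]
        push_cast
        ring
      have h2 : ∀ r : List V, ((r.countP D : ℝ) - p * (v :: l).countP D + a) ^ 2 =
          ((r.countP D : ℝ) - p * l.countP D + (a - p)) ^ 2 := by
        intro r
        simp only [List.countP_cons, hv, if_true]
        push_cast
        ring
      rw [funext h1, funext h2, ih, ih, List.countP_cons, if_pos hv]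
      push_cast
      ring
    · simp only [List.countP_cons, hv, Bool.false_eq_true, if_false, add_zero, ih]
      ring

/-- Chebyshev's inequality for the number of sampled elements with a property. -/
lemma expect_select_flip_dev_le {p t : ℝ} (hp : p ∈ Set.Icc (0 : ℝ) 1) (D : V → Bool) (l : List V)
    (ht : 0 < t) :
    (select (fun _ => flip p) l).expect A
        (fun r => ind (t ≤ |(r.countP D : ℝ) - p * l.countP D|)) ≤ p * l.countP D / t ^ 2 := by
  have key : ∀ r : List V, ind (t ≤ |(r.countP D : ℝ) - p * l.countP D|) ≤
      (t ^ 2)⁻¹ * ((r.countP D : ℝ) - p * l.countP D + 0) ^ 2 := by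
    intro r
    by_cases h : t ≤ |(r.countP D : ℝ) - p * l.countP D|
    · rw [ind_of h, add_zero, ← div_eq_inv_mul, le_div_iff₀ (by positivity), one_mul,
        ← sq_abs ((r.countP D : ℝ) - _)]
      exact pow_le_pow_left₀ ht.le h 2
    · rw [ind_of_not h]
      positivity
  refine (expect_mono key).trans ?_
  rw [expect_const_mul, expect_select_flip_sq hp, ← div_eq_inv_mul]
  gcongr
  have := mul_nonneg (Nat.cast_nonneg (α := ℝ) (l.countP D)) (mul_self_nonneg p)
  linarith

/-- A uniformly random `k`-set contains a vertex with probability `k / n`, and the events that it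
contains two distinct vertices are not positively correlated. -/
lemma expect_powersetCard_ind_subset {n k : ℕ} (hk : 2 ≤ k) (hkn : k ≤ n) {u v : Fin n}
    (huv : u ≠ v) :
    (𝔼 K ∈ Finset.powersetCard k Finset.univ, ind (v ∈ K) = (k : ℝ) / n) ∧
    𝔼 K ∈ Finset.powersetCard k Finset.univ, ind (u ∈ K) * ind (v ∈ K) ≤
      ((k : ℝ) / n) * (k / n) := by
  -- Removes truncated subtraction, so that the absorption identities `c1` and `c2` apply to the
  -- counts of supersets.
  obtain ⟨k, rfl⟩ : ∃ j, k = j + 2 := ⟨k - 2, by omega⟩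
  obtain ⟨n, rfl⟩ : ∃ m, n = m + 2 := ⟨n - 2, by omega⟩
  have hkn' : k ≤ n := by omega
  have c1 : ((n + 2 : ℕ) : ℝ) * ((n + 1).choose (k + 1) : ℕ) =
      ((n + 2).choose (k + 2) : ℕ) * ((k + 2 : ℕ) : ℝ) := by
    exact_mod_cast Nat.add_one_mul_choose_eq (n + 1) (k + 1)
  have c2 : ((n + 1 : ℕ) : ℝ) * (n.choose k : ℕ) =
      ((n + 1).choose (k + 1) : ℕ) * ((k + 1 : ℕ) : ℝ) := by
    exact_mod_cast Nat.add_one_mul_choose_eq n k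
  have hpos : (0 : ℝ) < ((n + 2).choose (k + 2) : ℕ) := by
    exact_mod_cast Nat.choose_pos hkn
  have avg : ∀ S : Finset (Fin (n + 2)), S.card ≤ k + 2 →
      𝔼 K ∈ Finset.powersetCard (k + 2) Finset.univ, ind (S ⊆ K) =
        ((n + 2 - S.card).choose (k + 2 - S.card) : ℕ) / (((n + 2).choose (k + 2) : ℕ) : ℝ) := by
    intro S hS
    rw [Finset.expect_eq_sum_div_card, Finset.card_powersetCard, Finset.card_univ,
      Fintype.card_fin]
    congr 1
    simp only [ind_eq]
    rw [Finset.sum_boole, Finset.card_filter_powersetCard_subset S Finset.univ (k + 2)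
      (Finset.subset_univ _) hS, Finset.card_univ, Fintype.card_fin]
  constructor
  · have := avg {v} (by simp)
    simp only [Finset.singleton_subset_iff, Finset.card_singleton] at this
    rw [this, div_eq_div_iff hpos.ne' (by positivity)]
    have e : n + 2 - 1 = n + 1 := rfl
    have e' : k + 2 - 1 = k + 1 := rfl
    rw [e, e']
    linarith
  · have h2 : ∀ K : Finset (Fin (n + 2)), ind (u ∈ K) * ind (v ∈ K) = ind ({u, v} ⊆ K) := by
      intro K
      have : ({u, v} : Finset _) ⊆ K ↔ u ∈ K ∧ v ∈ K := by
        simp [Finset.insert_subset_iff]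
      by_cases hu : u ∈ K <;> by_cases hv : v ∈ K <;> simp [ind, this, hu, hv]
    have := avg {u, v} (by rw [Finset.card_pair huv]; omega)
    rw [Finset.card_pair huv] at this
    simp only [h2]
    rw [this, Nat.add_sub_cancel, Nat.add_sub_cancel, div_mul_div_comm,
      div_le_div_iff₀ hpos (by positivity)]
    push_cast at *
    have hkn'' : (k : ℝ) ≤ n := by exact_mod_cast hkn'
    set x : ℝ := ((n.choose k : ℕ) : ℝ)
    set y : ℝ := (((n + 1).choose (k + 1) : ℕ) : ℝ)
    set z : ℝ := (((n + 2).choose (k + 2) : ℕ) : ℝ)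
    have hx : 0 ≤ x := by positivity
    have hn0 : (0 : ℝ) ≤ n := by positivity
    have hk0 : (0 : ℝ) ≤ k := by positivity
    have hz : z * ((k : ℝ) + 2) * (k + 1) = (n + 2) * ((n + 1) * x) := by
      rw [← c1, c2]; ring
    -- Negative correlation of sampling without replacement, in the original parameters `(k - 1)/(n
    -- - 1) ≤ k/n`.
    have h3 : ((n : ℝ) + 2) * (k + 1) ≤ (n + 1) * (k + 2) := by nlinarith
    have h4 : x * ((n + 2) * (n + 2)) * (k + 1) ≤ (k + 2) * (k + 2) * z * (k + 1) := by
      calc x * (((n : ℝ) + 2) * (n + 2)) * (k + 1) = x * (n + 2) * ((n + 2) * (k + 1)) := by ring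
        _ ≤ x * (n + 2) * ((n + 1) * (k + 2)) := by gcongr
        _ = (k + 2) * ((n + 2) * ((n + 1) * x)) := by ring
        _ = (k + 2) * (k + 2) * z * (k + 1) := by rw [← hz]; ring
    exact le_of_mul_le_mul_right h4 (by positivity)

/-- Chebyshev: the variance is at most `|S| k/n ≤ k`, against a squared deviation of `n`. Applied to
both halves, it says that a typical clique is split evenly. -/
lemma expect_powersetCard_dev_le {n k : ℕ} (hk : 2 ≤ k) (hkn : k ≤ n) (S : Finset (Fin n)) :
    𝔼 K ∈ Finset.powersetCard k Finset.univ,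
      ind (¬ |((S ∩ K).card : ℝ) - k * S.card / n| ≤ Real.sqrt n) ≤ k / n := by
  classical
  have hn0 : (0 : ℝ) < n := by
    have : 0 < n := by omega
    exact_mod_cast this
  have : Nontrivial (Fin n) := Fin.nontrivial_iff_two_le.2 (hk.trans hkn)
  have hmean : ∀ v : Fin n, 𝔼 K ∈ Finset.powersetCard k Finset.univ, ind (v ∈ K) = (k : ℝ) / n :=
    fun v => by
      obtain ⟨u, hu⟩ := exists_ne v
      exact (expect_powersetCard_ind_subset hk hkn hu).1
  have hne : (Finset.powersetCard k (Finset.univ : Finset (Fin n))).Nonempty :=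
    Finset.powersetCard_nonempty.2 (by simpa using hkn)
  have hcheb := expect_sq_sum_sub_le hne S (fun v K => v ∈ K) ((k : ℝ) / n)
    (fun v _ => (hmean v).le) (fun u _ v _ huv => by
      rw [hmean, hmean]
      exact (expect_powersetCard_ind_subset hk hkn huv).2)
  simp only [hmean, Finset.sum_const, nsmul_eq_mul] at hcheb
  have hcard : ∀ K : Finset (Fin n), ∑ v ∈ S, ind (v ∈ K) = (S ∩ K).card := by
    intro K
    simp only [ind_eq]
    rw [Finset.sum_boole, Finset.filter_mem_eq_inter]
  have key : ∀ K : Finset (Fin n),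
      ind (¬ |((S ∩ K).card : ℝ) - k * S.card / n| ≤ Real.sqrt n) ≤
      (∑ v ∈ S, ind (v ∈ K) - S.card * (k / n)) ^ 2 / n := by
    intro K
    by_cases h : |((S ∩ K).card : ℝ) - k * S.card / n| ≤ Real.sqrt n
    · rw [ind_of_not (not_not.2 h)]
      positivity
    · rw [ind_of h, hcard, le_div_iff₀ hn0, one_mul, ← Real.sq_sqrt hn0.le]
      have e : ((S ∩ K).card : ℝ) - S.card * (k / n) = (S ∩ K).card - k * S.card / n := by ring
      rw [Real.sq_sqrt hn0.le, e, ← sq_abs (((S ∩ K).card : ℝ) - _)]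
      nth_rewrite 1 [← Real.sq_sqrt hn0.le]
      exact pow_le_pow_left₀ (Real.sqrt_nonneg _) (not_le.1 h).le 2
  refine (Finset.expect_le_expect fun K _ => key K).trans ?_
  rw [← Finset.expect_div, div_le_div_iff_of_pos_right hn0]
  refine hcheb.trans ?_
  have : (S.card : ℝ) ≤ n := by
    exact_mod_cast (Finset.card_le_univ S).trans_eq (Fintype.card_fin n)
  calc (S.card : ℝ) * (k / n) ≤ n * (k / n) := by gcongr
    _ = k := by field_simp

end Sampling

/-! ### Averaging over the sample and the clique -/

section FailureBound

open Prog

variable {n : ℕ}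

lemma countP_mem_eq_card {l : List (Fin n)} (hl : l.Nodup) (K : Finset (Fin n)) :
    l.countP (fun v => decide (v ∈ K)) = (l.toFinset ∩ K).card := by
  rw [List.countP_eq_length_filter, ← List.toFinset_card_of_nodup (hl.filter _)]
  congr 1
  ext v
  simp

/-- Each of `ML` and `BL` is at most `M²/120`, and `1/60 ≤ (2/15)²`. Then `2/5 M + 1 ≤ 9/20 M`
because `M ≥ 20`. -/
lemma three_mul_sqrt_add_one_le {m M B L : ℝ} (hm : 20 ≤ m) (hmM : m ≤ M) (hL : 120 * L ≤ m)
    (hB : 120 * B * L ≤ m ^ 2) : 3 * Real.sqrt ((M + B) * L) + 1 ≤ 9 / 20 * M := by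
  have hM : 20 ≤ M := hm.trans hmM
  have : Real.sqrt ((M + B) * L) ≤ 2 / 15 * M := by
    apply Real.sqrt_le_iff.2 ⟨by positivity, ?_⟩
    have h3 : M * (120 * L) ≤ M * M := by gcongr; exact hL.trans hmM
    have h4 : m ^ 2 ≤ M ^ 2 := by gcongr
    linarith [sq_nonneg M]
  linarith

/-- Replaces the random number `M` of sampled clique vertices by its deterministic lower bound `m`.
-/
lemma error_terms_anti {m M a b c d : ℝ} (hm : 0 < m) (hmM : m ≤ M) (hb : 0 ≤ b) (hc : 0 ≤ c) :
    a + 7 / M + b * Real.exp (-M / 200) + c * Real.exp (-M / 5) + d ≤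
      a + 7 / m + b * Real.exp (-m / 200) + c * Real.exp (-m / 5) + d := by
  gcongr

open Classical in
/-- The failure probability for a fixed clique that meets both halves in about `k / 2` vertices. -/
lemma expect_subsampleAndFilter_le {K V₁ V₂ : Finset (Fin n)} {k : ℕ} {p B m : ℝ}
    (hn : 25 ≤ n) (hkn : k ≤ n) (hV : Disjoint V₁ V₂) (hV₁ : V₁.card = n / 2)
    (hV₂ : V₂.card = n / 2)
    (hK₁ : |((V₁ ∩ K).card : ℝ) - k * V₁.card / n| ≤ Real.sqrt n)
    (hK₂ : |((V₂ ∩ K).card : ℝ) - k * V₂.card / n| ≤ Real.sqrt n)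
    (ht : 0 ≤ (k : ℝ) / 4 - 2 * Real.sqrt n) (hp : 0 < p) (hp1 : p ≤ 1) (hB : 0 < B)
    (hm : m = p * k / 8) (hm20 : 20 ≤ m) (hmlog : 120 * Real.logb 2 n ≤ m)
    (hmB : 120 * B * Real.logb 2 n ≤ m ^ 2) :
    𝔼 G, (subsampleAndFilter V₁ V₂ k p).expect (adjacency (plant K G))
        (fun out => if out.toFinset ≠ K then 1 else 0) ≤
      p * n * Real.exp (-4 * ((k : ℝ) / 4 - 2 * Real.sqrt n) ^ 2 / n) / B + 10 / m +
        n * Real.exp (-m / 200) + 2 ^ seedSize 1 n * Real.exp (-m / 5) +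
        n * (5 / 8) ^ seedSize 1 n := by
  have hn0 : (25 : ℝ) ≤ n := by exact_mod_cast hn
  have hm0 : 0 < m := by linarith
  have hkn' : (k : ℝ) ≤ n := by exact_mod_cast hkn
  have hk0 : (0 : ℝ) ≤ k := by positivity
  have hr5 : 5 ≤ Real.sqrt n := Real.le_sqrt_of_sq_le (by linarith)
  have hlog1 : 1 ≤ Real.logb 2 n := by
    rw [Real.le_logb_iff_rpow_le one_lt_two (by linarith), Real.rpow_one]
    linarith
  obtain ⟨hc', hc⟩ := half_card_bounds hV₁
  set k₁ : ℝ := ((V₁ ∩ K).card : ℝ) with hk₁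
  -- The losses `1/2 + √n` are at most `k/4`, since `k/4 ≥ 2√n`.
  have hk₁k : (k : ℝ) / 4 ≤ k₁ := by
    have h1 : (k : ℝ) / 2 - 1 / 2 ≤ k * V₁.card / n := by
      rw [le_div_iff₀ (by linarith)]
      nlinarith
    linarith [(abs_le.1 hK₁).1]
  have hpk₁ : 2 * m ≤ p * k₁ := by rw [hm]; nlinarith
  let A₀ : Fin n → Fin n → Bool := fun _ _ => false
  set D : ℝ := p * n * Real.exp (-4 * ((k : ℝ) / 4 - 2 * Real.sqrt n) ^ 2 / n) / B + 7 / m +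
        n * Real.exp (-m / 200) + 2 ^ seedSize 1 n * Real.exp (-m / 5) +
        n * (5 / 8) ^ seedSize 1 n with hD
  have hD0 : 0 ≤ D := by positivity
  have e1 : ∀ G, (subsampleAndFilter V₁ V₂ k p).expect (adjacency (plant K G))
        (fun out => if out.toFinset ≠ K then 1 else 0) =
      (select (fun _ => flip p) V₁.toList).expect A₀ fun SP =>
        (afterSampling V₂ k p SP).expect (adjacency (plant K G))
          (fun out => if out.toFinset ≠ K then 1 else 0) := by
    intro G
    rw [subsampleAndFilter_eq, expect_bind, expect_ticks, expect_bind]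
    exact (queryFree_select_flip p V₁.toList).expect_eq _ _ _
  simp only [e1]
  rw [← expect_finset_expect]
  have key : ((select (fun _ => flip p) V₁.toList).expect A₀ fun SP =>
        𝔼 G, (afterSampling V₂ k p SP).expect (adjacency (plant K G))
          (fun out => if out.toFinset ≠ K then 1 else 0)) ≤
      (select (fun _ => flip p) V₁.toList).expect A₀ fun SP =>
        ind (p * n / 2 ≤ |(SP.countP (fun _ => true) : ℝ) -
          p * V₁.toList.countP (fun _ => true)|) +
        ind (p * k₁ / 2 ≤ |(SP.countP (fun v => decide (v ∈ K)) : ℝ) -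
          p * V₁.toList.countP (fun v => decide (v ∈ K))|) + D := by
    refine (ensures_select_sublist _ _).expect_mono fun SP hSP => ?_
    have hSPn : SP.Nodup := hSP.nodup V₁.nodup_toList
    have hSPV : ∀ v ∈ SP, v ∈ V₁ := fun v hv => Finset.mem_toList.1 (hSP.subset hv)
    have hle1 : 𝔼 G, (afterSampling V₂ k p SP).expect (adjacency (plant K G))
          (fun out => if out.toFinset ≠ K then (1 : ℝ) else 0) ≤ 1 :=
      expect_le_of_forall_le zero_le_one fun G _ =>
        (ensures_true _).expect_le fun out _ => by split_ifs <;> norm_num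
    rw [List.countP_true, countP_mem_eq_card hSPn,
      countP_mem_eq_card V₁.nodup_toList, Finset.toList_toFinset, Finset.length_toList, ← hk₁]
    set i₁ : Prop := p * n / 2 ≤ |(SP.length : ℝ) - p * V₁.card| with hi₁
    set i₂ : Prop := p * k₁ / 2 ≤ |((SP.toFinset ∩ K).card : ℝ) - p * k₁| with hi₂
    by_cases h : i₁ ∨ i₂
    · have h1 := ind_nonneg i₁
      have h2 := ind_nonneg i₂
      rcases h with h | h <;> rw [ind_of h] at * <;> linarith
    · push Not at h
      rw [ind_of_not h.1, ind_of_not h.2, zero_add, zero_add]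
      simp only [hi₁, hi₂, not_le, abs_lt] at h
      obtain ⟨⟨-, h1⟩, h2, -⟩ := h
      -- The mean sample size is at most `pn/2` and the deviation is below `pn/2`, so the size test
      -- does not abort.
      have hlen : (SP.length : ℝ) ≤ p * n := by
        have := mul_le_mul_of_nonneg_left hc hp.le
        linarith only [this, h1]
      set M : ℝ := ((SP.toFinset ∩ K).card : ℝ) with hM
      have hmM : m ≤ M := by linarith
      have hM0 : 0 < M := by linarith
      refine (expect_afterSampling_random_le hn hkn hV hV₂ hK₂ ht hSPn hSPV hlen hB hM ?_ ?_).trans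
        ?_
      · exact three_mul_sqrt_add_one_le hm20 hmM hmlog hmB
      · have h3 : (seedSize 1 n : ℝ) < 2 * Real.logb 2 n + 1 := by
          rw [seedSize]
          refine (Nat.ceil_lt_add_one (by positivity)).trans_eq ?_
          norm_num
        linarith
      · exact error_terms_anti hm0 hmM (by positivity) (by positivity)
  refine key.trans ?_
  simp only [expect_add, expect_const]
  have hpIcc : p ∈ Set.Icc (0 : ℝ) 1 := ⟨hp.le, hp1⟩
  have hpk₁0 : 0 < p * k₁ := by linarith
  -- The two sampling deviations cost `1/m` and `4/(p k₁) ≤ 2/m`, raising `7/m` to `10/m`.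
  have s1 := expect_select_flip_dev_le (A := A₀) (t := p * n / 2) hpIcc (fun _ => true) V₁.toList
    (by positivity)
  have s2 := expect_select_flip_dev_le (A := A₀) (t := p * k₁ / 2) hpIcc
    (fun v => decide (v ∈ K)) V₁.toList (by linarith)
  have s1' : p * (V₁.toList.countP (fun _ => true) : ℕ) / (p * n / 2) ^ 2 ≤ 1 / m := by
    rw [List.countP_true, Finset.length_toList, div_le_div_iff₀ (by positivity) hm0, hm]
    have : p * V₁.card * (p * k / 8) ≤ p * (n / 2) * (p * n / 8) := by gcongr
    have h2 : 0 ≤ (p * n) ^ 2 := by positivity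
    linarith
  have s2' : p * (V₁.toList.countP (fun v => decide (v ∈ K)) : ℕ) / (p * k₁ / 2) ^ 2 ≤ 2 / m := by
    rw [countP_mem_eq_card V₁.nodup_toList, Finset.toList_toFinset, ← hk₁,
      div_le_div_iff₀ (by positivity) hm0]
    have h2 := mul_nonneg hpk₁0.le (sub_nonneg.2 hpk₁)
    linarith only [h2]
  have e7 : 10 / m = 7 / m + 1 / m + 2 / m := by ring
  rw [e7]
  linarith only [s1, s2, s1', s2', hD]

/-- A bound for the failure probability without asymptotics. -/
lemma failureProbability_subsampleAndFilter_le {V₁ V₂ : Finset (Fin n)} {k : ℕ} {p B m : ℝ}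
    (hn : 25 ≤ n) (hkn : k ≤ n) (hV : Disjoint V₁ V₂) (hV₁ : V₁.card = n / 2)
    (hV₂ : V₂.card = n / 2)
    (ht : 0 ≤ (k : ℝ) / 4 - 2 * Real.sqrt n) (hp : 0 < p) (hp1 : p ≤ 1) (hB : 0 < B)
    (hm : m = p * k / 8) (hm20 : 20 ≤ m) (hmlog : 120 * Real.logb 2 n ≤ m)
    (hmB : 120 * B * Real.logb 2 n ≤ m ^ 2) :
    failureProbability k hkn (subsampleAndFilter V₁ V₂ k p) ≤
      2 * k / n + (p * n * Real.exp (-4 * ((k : ℝ) / 4 - 2 * Real.sqrt n) ^ 2 / n) / B + 10 / m +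
        n * Real.exp (-m / 200) + 2 ^ seedSize 1 n * Real.exp (-m / 5) +
        n * (5 / 8) ^ seedSize 1 n) := by
  classical
  set D : ℝ := p * n * Real.exp (-4 * ((k : ℝ) / 4 - 2 * Real.sqrt n) ^ 2 / n) / B + 10 / m +
        n * Real.exp (-m / 200) + 2 ^ seedSize 1 n * Real.exp (-m / 5) +
        n * (5 / 8) ^ seedSize 1 n with hD
  have hm0 : 0 < m := by linarith
  have hD0 : 0 ≤ D := by positivity
  have hn0 : (25 : ℝ) ≤ n := by exact_mod_cast hn
  have hr5 : 5 ≤ Real.sqrt n := Real.le_sqrt_of_sq_le (by linarith)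
  have hk2 : 2 ≤ k := by
    have : (2 : ℝ) ≤ k := by linarith
    exact_mod_cast this
  rw [failureProbability_eq]
  have key : ∀ K : Finset (Fin n), 𝔼 G, (subsampleAndFilter V₁ V₂ k p).expect
      (adjacency (plant K G)) (fun out => if out.toFinset ≠ K then (1 : ℝ) else 0) ≤
      ind (¬ |((V₁ ∩ K).card : ℝ) - k * V₁.card / n| ≤ Real.sqrt n) +
      ind (¬ |((V₂ ∩ K).card : ℝ) - k * V₂.card / n| ≤ Real.sqrt n) + D := by
    intro K
    by_cases h : |((V₁ ∩ K).card : ℝ) - k * V₁.card / n| ≤ Real.sqrt n ∧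
        |((V₂ ∩ K).card : ℝ) - k * V₂.card / n| ≤ Real.sqrt n
    · rw [ind_of_not (not_not.2 h.1), ind_of_not (not_not.2 h.2), zero_add, zero_add]
      exact expect_subsampleAndFilter_le hn hkn hV hV₁ hV₂ h.1 h.2 ht hp hp1 hB hm hm20 hmlog hmB
    · have hle1 : 𝔼 G, (subsampleAndFilter V₁ V₂ k p).expect (adjacency (plant K G))
          (fun out => if out.toFinset ≠ K then (1 : ℝ) else 0) ≤ 1 :=
        expect_le_of_forall_le zero_le_one fun G _ =>
          (ensures_true _).expect_le fun out _ => by split_ifs <;> norm_num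
      have h1 := ind_nonneg (¬ |((V₁ ∩ K).card : ℝ) - k * V₁.card / n| ≤ Real.sqrt n)
      have h2 := ind_nonneg (¬ |((V₂ ∩ K).card : ℝ) - k * V₂.card / n| ≤ Real.sqrt n)
      rcases not_and_or.1 h with h | h <;> rw [ind_of h] at * <;> linarith
  refine (Finset.expect_le_expect fun K _ => ?_).trans (b := 𝔼 K ∈ Finset.powersetCard k
      (Finset.univ : Finset (Fin n)),
      (ind (¬ |((V₁ ∩ K).card : ℝ) - k * V₁.card / n| ≤ Real.sqrt n) +
      ind (¬ |((V₂ ∩ K).card : ℝ) - k * V₂.card / n| ≤ Real.sqrt n) + D)) ?_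
  · convert key K using 2
  · rw [Finset.expect_add_distrib, Finset.expect_add_distrib, Finset.expect_const
      (Finset.powersetCard_nonempty.2 (by simpa using hkn))]
    have h1 := expect_powersetCard_dev_le hk2 hkn V₁
    have h2 := expect_powersetCard_dev_le hk2 hkn V₂
    have h3 : 2 * (k : ℝ) / n = k / n + k / n := by ring
    linarith

end FailureBound

/-! ### Running times -/

section RunningTime

open Prog

variable {V : Type} {A : V → V → Bool}

lemma time_tick_bind {α : Type} (f : Unit → Prog V α) :
    ((tick : Prog V Unit).bind f).time A = (f ()).time A + 1 := rfl

lemma length_addCommonNeighbours (vs S : List V) :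
    (addCommonNeighbours vs S).Ensures A fun out => out.length ≤ S.length + vs.length := by
  refine (ensures_addCommonNeighbours vs S).mono ?_
  rintro _ ⟨new, hnew, rfl, -⟩
  rw [List.length_append]
  have := hnew.length_le
  omega

lemma length_randomSubset (m : ℕ) (l : List V) :
    (randomSubset m l).Ensures A fun out => out.length ≤ m :=
  (ensures_randomSubset m l).mono fun _ hr => hr.2.le.trans (min_le_left _ _)

/-- No disjointness is tracked, so each extension may add as many vertices as its ambient list has;
hence the factor 2. -/
lemma length_cliqueCompletion (c : ℝ) (vs S : List V) :
    (cliqueCompletion c vs S).Ensures A fun out => out.length ≤ 2 * (S.length + vs.length) := by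
  simp only [cliqueCompletion, bind_eq]
  refine (ensures_true _).bind fun n _ => (length_addCommonNeighbours vs S).bind fun V' hV' => ?_
  simp only [tick_bind, ensures_step]
  refine (ensures_randomSubset _ _).bind fun S' hS' => (length_addCommonNeighbours V' S').mono ?_
  intro out hout
  have := hS'.2.le.trans (min_le_right _ _)
  omega

lemma time_cliqueCompletion_le (c : ℝ) (vs S : List V) {l σ : ℕ} (hl : vs.length ≤ l)
    (hS : S.length ≤ σ) (hσ : seedSize c vs.length ≤ σ) :
    (cliqueCompletion c vs S).time A ≤ 9 * ((l + σ + 1) * (σ + 1)) := by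
  simp only [cliqueCompletion, bind_eq]
  have h1 : vs.length * (4 * S.length + 2) + S.length ≤ l * (4 * σ + 2) + σ := by gcongr
  have h2 : ∀ V' : List V, V'.length ≤ S.length + vs.length →
      ((tick : Prog V Unit).bind fun _ => (randomSubset (seedSize c vs.length) V').bind fun S' =>
        addCommonNeighbours V' S').time A ≤
      1 + σ * (l + σ + 3) + ((l + σ) * (4 * σ + 2) + σ) := by
    intro V' hV'
    rw [time_tick_bind]
    have hV'' : V'.length ≤ l + σ := by omega
    have h3 : ((randomSubset (seedSize c vs.length) V').bind fun S' =>
        addCommonNeighbours V' S').time A ≤ σ * (l + σ + 3) + ((l + σ) * (4 * σ + 2) + σ) := by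
      refine ((length_randomSubset _ V').time_bind_le (t := (l + σ) * (4 * σ + 2) + σ)
        fun S' hS' => (time_addCommonNeighbours_le V' S').trans ?_).trans ?_
      · have := hS'.trans hσ
        gcongr
      · gcongr
        exact (time_randomSubset_le _ _).trans (by gcongr)
    omega
  refine ((ensures_size vs).time_bind_le (t := l * (4 * σ + 2) + σ +
    (1 + σ * (l + σ + 3) + ((l + σ) * (4 * σ + 2) + σ))) ?_).trans ?_
  · rintro _ rfl
    refine ((length_addCommonNeighbours vs S).time_bind_le h2).trans ?_
    gcongr
    exact (time_addCommonNeighbours_le vs S).trans h1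
  · have := time_size_le (A := A) vs
    nlinarith

lemma length_collectHighDegree (w : V) (ws : List V) (θ : ℝ) (m : ℕ) (S : List V) :
    (collectHighDegree w ws θ m S).Ensures A fun out => out.length ≤ S.length + m := by
  induction m generalizing S with
  | zero => simp [collectHighDegree]
  | succ m ih =>
    simp only [collectHighDegree, bind_eq, tick_bind, draw_bind, ret_bind, ensures_step,
      ensures_draw]
    intro i
    refine (ensures_true _).bind fun d _ => ?_
    simp only [test_bind, ensures_step]
    split_ifs
    · refine (ensures_true _).bind fun b _ => ?_
      split_ifs
      · exact (ih S).mono fun out h => by omega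
      · exact (ih _).mono fun out h => by simp at h; omega
    · exact (ih S).mono fun out h => by omega

lemma time_collectHighDegree_le (w : V) (ws : List V) (θ : ℝ) (m : ℕ) (S : List V) :
    (collectHighDegree w ws θ m S).time A ≤
      m * (3 * (w :: ws).length + 2 * (S.length + m) + 4) := by
  induction m generalizing S with
  | zero => simp [collectHighDegree]
  | succ m ih =>
    simp only [collectHighDegree, bind_eq, tick_bind, draw_bind, ret_bind, time_step, time_draw]
    set N := (w :: ws).length with hN
    have ih' : ∀ S' : List V, S'.length ≤ S.length + 1 →
        (collectHighDegree w ws θ m S').time A ≤ m * (3 * N + 2 * (S.length + 1 + m) + 4) :=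
      fun S' hS' => (ih S').trans (by gcongr)
    set R := m * (3 * N + 2 * (S.length + 1 + m) + 4) with hR
    have hsup : (Finset.univ.sup fun i : Fin (ws.length + 1) =>
        ((degreeInto ((w :: ws).get i) (w :: ws)).bind fun d =>
          (test (θ ≤ (d : ℝ))).bind fun b =>
            if b = true then
              (member ((w :: ws).get i) S).bind fun b =>
                if b = true then collectHighDegree w ws θ m S
                else step (collectHighDegree w ws θ m ((w :: ws).get i :: S))
            else collectHighDegree w ws θ m S).time A) ≤
        3 * N + (1 + (2 * S.length + (1 + R))) := by
      refine Finset.sup_le fun i _ => ?_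
      refine (time_bind_le (t := 1 + (2 * S.length + (1 + R))) fun d => ?_).trans
        (Nat.add_le_add_right (time_degreeInto_le _ _) _)
      rw [test_bind, time_step]
      split_ifs
      · have := (time_bind_le (P := member ((w :: ws).get i) S) (A := A) (t := 1 + R)
          (f := fun b => if b = true then collectHighDegree w ws θ m S
                else step (collectHighDegree w ws θ m ((w :: ws).get i :: S))) fun b => by
            split_ifs
            · exact (ih' S (by omega)).trans (by omega)
            · have := ih' ((w :: ws).get i :: S) (by simp)
              rw [time_step]; omega).trans (Nat.add_le_add_right (time_member_le _ S) _)
        omega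
      · have := ih' S (by omega)
        omega
    have : (m + 1) * (3 * N + 2 * (S.length + (m + 1)) + 4) =
        R + (3 * N + 2 * (S.length + 1 + m) + 4) := by rw [hR]; ring
    rw [this]
    refine (Nat.add_le_add_right (Nat.add_le_add_right hsup 1) 1).trans ?_
    omega

lemma length_keepHighDegreeAndComplete (W : List V) (L : ℕ) :
    (keepHighDegreeAndComplete W L).Ensures A fun found =>
      (found.getD []).length ≤ 2 * (seedSize 1 W.length + W.length) := by
  cases W with
  | nil => simp [keepHighDegreeAndComplete]
  | cons w ws =>
    simp only [keepHighDegreeAndComplete, bind_eq]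
    refine (ensures_size _).bind ?_
    rintro _ rfl
    simp only [tick_bind, ensures_step]
    refine (ensures_true _).bind fun S _ => (ensures_true _).bind fun s _ => ?_
    simp only [test_bind, ensures_step]
    split_ifs
    · simp
    · refine (length_randomSubset _ S).bind fun seed hseed =>
        (length_cliqueCompletion 1 (w :: ws) seed).bind fun out hout => ?_
      simp only [pure_eq, ensures_ret, Option.getD_some]
      omega

/-- Each of the `|W|` rounds computes a degree, in `3|W|` steps, and searches a list of at most
`|W|` elements, in `2|W|` steps. The remaining terms come from sizes, the seed and one completion.
-/
lemma time_keepHighDegreeAndComplete_le (W : List V) {σ : ℕ} (hσ : seedSize 1 W.length ≤ σ) :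
    (keepHighDegreeAndComplete W W.length).time A ≤
      5 * (W.length * W.length) + 18 * ((W.length + σ + 1) * (σ + 1)) := by
  cases W with
  | nil => simp [keepHighDegreeAndComplete]
  | cons w ws =>
    simp only [keepHighDegreeAndComplete, bind_eq]
    set θ : ℕ → ℝ := fun n => (n : ℝ) / 2 + 2 * Real.sqrt (n * Real.logb 2 n) with hθ
    generalize hW : w :: ws = W at *
    set N := W.length with hN
    have hseed : ∀ S : List V, S.length ≤ N →
        (step ((randomSubset (seedSize 1 N) S).bind fun seed =>
          (cliqueCompletion 1 W seed).bind fun out =>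
            (pure (some out) : Prog V (Option (List V))))).time A ≤
        1 + (σ * (N + 3) + 9 * ((N + σ + 1) * (σ + 1))) := by
      intro S hS
      rw [time_step, add_comm]
      refine Nat.add_le_add_left (((length_randomSubset _ S).time_bind_le
        (t := 9 * ((N + σ + 1) * (σ + 1))) fun seed hseed => ?_).trans ?_) 1
      · refine (time_bind_le (t := 0) fun out => by simp).trans ?_
        exact time_cliqueCompletion_le 1 W seed le_rfl (hseed.trans hσ) hσ
      · gcongr
        exact (time_randomSubset_le _ _).trans (by gcongr)
    set R := 1 + (σ * (N + 3) + 9 * ((N + σ + 1) * (σ + 1))) with hR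
    have hcollect : ((collectHighDegree w ws (θ N) N []).bind fun S =>
        (size S).bind fun s => (test ((s : ℝ) < 2 * Real.logb 2 N)).bind fun b =>
          if b = true then (pure none : Prog V (Option (List V)))
          else step ((randomSubset (seedSize 1 N) S).bind fun seed =>
            (cliqueCompletion 1 W seed).bind fun out => pure (some out))).time A ≤
        N * (3 * N + 2 * N + 4) + (N + (1 + R)) := by
      refine ((length_collectHighDegree w ws (θ N) N []).time_bind_le (t := N + (1 + R))
        fun S hS => ?_).trans ?_
      · have hS' : S.length ≤ N := by simpa using hS
        refine (time_bind_le (t := 1 + R) fun s => ?_).trans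
          (Nat.add_le_add_right ((time_size_le S).trans hS') _)
        rw [test_bind, time_step]
        split_ifs
        · simp
        · have := hseed S hS'
          omega
      · gcongr
        refine (time_collectHighDegree_le w ws (θ N) N []).trans ?_
        rw [hW]
        simp [← hN]
    refine ((ensures_size W).time_bind_le (t := 1 + (N * (3 * N + 2 * N + 4) + (N + (1 + R))))
      ?_).trans ?_
    · rintro _ rfl
      simp only [tick_bind, time_step]
      rw [add_comm]
      exact Nat.add_le_add_left hcollect 1
    · have := time_size_le (A := A) W
      rw [hR]
      nlinarith

variable {n : ℕ} {A : Fin n → Fin n → Bool}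

lemma time_degreeFilter_le (V₂ : Finset (Fin n)) (k : ℕ) (v : Fin n) :
    (degreeFilter V₂ k v).time A ≤ 3 * V₂.card + 2 := by
  simp only [degreeFilter, bind_eq]
  refine (time_bind_le (t := 2) fun d => by simp [test_bind]).trans ?_
  gcongr
  simpa using time_degreeInto_le (A := A) v V₂.toList

/-- `Q` bounds the sample size after the size test. The term `k n` pays for a random guess, `Q n`
for the degree filter, and `Q² ≤ Q n` for the middle stage. -/
lemma time_afterSampling_le (V₂ : Finset (Fin n)) (k : ℕ) (p : ℝ) (SP : List (Fin n)) {Q : ℕ}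
    (hSP : SP.Nodup) (hQ : ∀ m : ℕ, (m : ℝ) ≤ p * n → m ≤ Q) (hQn : Q ≤ n) :
    (afterSampling V₂ k p SP).time A ≤
      35 * ((n + seedSize 1 n + 1) * (seedSize 1 n + 1)) + 10 * ((k + Q) * (n + 1)) := by
  simp only [afterSampling, bind_eq]
  set σ := seedSize 1 n with hσ
  have hSPn : SP.length ≤ n := by
    rw [← List.toFinset_card_of_nodup hSP]
    exact (Finset.card_le_univ _).trans_eq (Fintype.card_fin n)
  have hV₂ : V₂.card ≤ n := (Finset.card_le_univ _).trans_eq (Fintype.card_fin n)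
  have hsize : (size SP).time A ≤ n := (time_size_le SP).trans hSPn
  have hrand : (randomSubset k (List.finRange n)).time A ≤ 3 * (k * (n + 1)) := by
    refine (time_randomSubset_le _ _).trans ?_
    rw [List.length_finRange]
    nlinarith
  set R := 18 * ((Q + σ + 1) * (σ + 1)) + 5 * (Q * Q) with hR
  set F := σ * (2 * (σ + Q) + 3) + 9 * ((n + σ + 1) * (σ + 1)) with hF
  have hfin : ∀ SC : List (Fin n), SC.length ≤ 2 * (σ + Q) →
      ((size SC).bind fun s => (test ((s : ℝ) < 2 * Real.logb 2 n)).bind fun b =>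
        if b = true then randomSubset k (List.finRange n)
        else tick.bind fun _ => (randomSubset σ SC).bind fun seed =>
          cliqueCompletion 1 (List.finRange n) seed).time A ≤
      2 * (σ + Q) + (1 + (3 * (k * (n + 1)) + (1 + F))) := by
    intro SC hSC
    refine (time_bind_le (t := 1 + (3 * (k * (n + 1)) + (1 + F))) fun s => ?_).trans
      (Nat.add_le_add_right ((time_size_le SC).trans hSC) _)
    rw [test_bind, time_step]
    split_ifs
    · omega
    · rw [time_tick_bind]
      have : ((randomSubset σ SC).bind fun seed =>
          cliqueCompletion 1 (List.finRange n) seed).time A ≤ F := by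
        refine ((length_randomSubset σ SC).time_bind_le (t := 9 * ((n + σ + 1) * (σ + 1)))
          fun seed hseed => ?_).trans ?_
        · exact time_cliqueCompletion_le 1 _ seed (by simp) hseed (by simp [hσ])
        · rw [hF]
          exact Nat.add_le_add_right ((time_randomSubset_le _ _).trans (by gcongr)) _
      omega
  have hmid : SP.length ≤ Q → ((select (degreeFilter V₂ k) SP).bind fun SF =>
      (size SF).bind fun n' => (keepHighDegreeAndComplete SF n').bind fun found =>
        (size (found.getD [])).bind fun s => (test ((s : ℝ) < 2 * Real.logb 2 n)).bind fun b =>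
          if b = true then randomSubset k (List.finRange n)
          else tick.bind fun _ => (randomSubset σ (found.getD [])).bind fun seed =>
            cliqueCompletion 1 (List.finRange n) seed).time A ≤
      Q * (3 * n + 4) + (Q + (R + (2 * (σ + Q) + (1 + (3 * (k * (n + 1)) + (1 + F)))))) := by
    intro hlen
    refine ((ensures_select_sublist _ SP).time_bind_le
      (t := Q + (R + (2 * (σ + Q) + (1 + (3 * (k * (n + 1)) + (1 + F)))))) fun SF hSF => ?_).trans ?_
    · have hSFQ : SF.length ≤ Q := hSF.length_le.trans hlen
      refine ((ensures_size SF).time_bind_le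
        (t := R + (2 * (σ + Q) + (1 + (3 * (k * (n + 1)) + (1 + F))))) ?_).trans
        (Nat.add_le_add_right ((time_size_le SF).trans hSFQ) _)
      rintro _ rfl
      have hseed : seedSize 1 SF.length ≤ σ := by
        -- For an empty list the convention `Real.logb 2 0 = 0` gives seed size zero.
        rcases Nat.eq_zero_or_pos SF.length with h0 | h0
        · simp [h0, seedSize]
        · exact seedSize_mono h0 (hSFQ.trans hQn)
      refine ((length_keepHighDegreeAndComplete SF SF.length).time_bind_le
        fun found hfound => hfin _ (hfound.trans (by gcongr))).trans ?_
      gcongr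
      refine (time_keepHighDegreeAndComplete_le SF hseed).trans ?_
      rw [add_comm, hR]
      gcongr
    · gcongr
      exact (time_select_le _ _ _ fun v _ => time_degreeFilter_le V₂ k v).trans
        (Nat.mul_le_mul hlen (by omega))
  refine ((ensures_size SP).time_bind_le (t := 1 + (3 * (k * (n + 1)) + (1 +
    (Q * (3 * n + 4) + (Q + (R + (2 * (σ + Q) + (1 + (3 * (k * (n + 1)) + (1 + F))))))))))
    ?_).trans ?_
  · rintro _ rfl
    rw [test_bind, time_step]
    by_cases h : p * n < (SP.length : ℝ)
    · simp only [h, decide_true, if_true]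
      exact (Nat.add_le_add_right hrand 1).trans (by omega)
    · simp only [h, decide_false, Bool.false_eq_true, if_false]
      rw [time_tick_bind]
      have := hmid (hQ _ (not_lt.1 h))
      exact (Nat.add_le_add_right (Nat.add_le_add_right this 1) 1).trans (by omega)
  · rw [hR, hF]
    have h1 : Q * Q ≤ Q * (n + 1) := by gcongr; omega
    have h2 : Q * σ ≤ n * σ := by gcongr
    nlinarith [hsize]

lemma runningTime_subsampleAndFilter_le (V₁ V₂ : Finset (Fin n)) (k : ℕ) (p : ℝ) {Q : ℕ}
    (hQ : ∀ m : ℕ, (m : ℝ) ≤ p * n → m ≤ Q) (hQn : Q ≤ n) :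
    runningTime (subsampleAndFilter V₁ V₂ k p) ≤
      40 * ((n + seedSize 1 n + 1) * (seedSize 1 n + 1)) + 10 * ((k + Q) * (n + 1)) := by
  refine Finset.sup_le fun G _ => ?_
  rw [subsampleAndFilter_eq]
  have hV₁ : V₁.card ≤ n := (Finset.card_le_univ _).trans_eq (Fintype.card_fin n)
  refine (time_bind_le (t := 3 * n + (35 * ((n + seedSize 1 n + 1) * (seedSize 1 n + 1)) +
    10 * ((k + Q) * (n + 1)))) fun _ => ?_).trans ?_
  · refine ((ensures_select_sublist _ _).time_bind_le fun SP hSP =>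
      time_afterSampling_le V₂ k p SP (hSP.nodup V₁.nodup_toList) hQ hQn).trans ?_
    gcongr
    refine (time_select_le _ _ 1 fun v _ => by simp [flip]).trans ?_
    rw [Finset.length_toList]
    omega
  · rw [time_ticks]
    nlinarith

end RunningTime

/-! ### Bounds for concrete parameters -/

section Parameters

/-- The bounds on the parameters that hold for all large `n`. -/
structure LargeParameters (n k : ℕ) (p u : ℝ) : Prop where
  pow_eq : u ^ 8 = n
  eight_le : 8 ≤ u
  one_le_log : 1 ≤ Real.logb 2 n
  log_le : 1000 * Real.logb 2 n ≤ u ^ 2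
  p_eq : p = (n : ℝ) * Real.logb 2 n / (k : ℝ) ^ 2 * Real.exp (-(k : ℝ) ^ 2 / (24 * n))
  p_le : p ≤ 1
  le_sq : 100000 * (n : ℝ) ≤ (k : ℝ) ^ 2
  sq_le : (k : ℝ) ^ 2 ≤ n * Real.logb 2 n
  inv_le : u⁻¹ ≤ Real.exp (-(k : ℝ) ^ 2 / (24 * n))

variable {n k : ℕ} {p u : ℝ}

namespace LargeParameters

lemma u_pos (h : LargeParameters n k p u) : 0 < u := by linarith [h.eight_le]

lemma n_ge (h : LargeParameters n k p u) : 25 ≤ n := by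
  have h1 : (8 : ℝ) ^ 8 ≤ u ^ 8 := pow_le_pow_left₀ (by norm_num) h.eight_le 8
  rw [h.pow_eq] at h1
  have : (25 : ℝ) ≤ n := by linarith
  exact_mod_cast this

lemma n_pos (h : LargeParameters n k p u) : (0 : ℝ) < n := by
  rw [← h.pow_eq]
  have := h.u_pos
  positivity

lemma sqrt_eq (h : LargeParameters n k p u) : Real.sqrt n = u ^ 4 := by
  have := h.u_pos
  rw [Real.sqrt_eq_iff_mul_self_eq h.n_pos.le (by positivity), ← h.pow_eq]
  ring

lemma le_k (h : LargeParameters n k p u) : 40 * u ^ 4 ≤ k := by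
  have := h.u_pos
  apply le_of_sq_le_sq _ (by positivity)
  have h1 := h.le_sq
  rw [← h.pow_eq] at h1
  have : 0 < u ^ 8 := by positivity
  calc (40 * u ^ 4) ^ 2 = 1600 * u ^ 8 := by ring
    _ ≤ (k : ℝ) ^ 2 := by linarith

lemma k_le (h : LargeParameters n k p u) : (k : ℝ) ≤ u ^ 5 := by
  have hu := h.u_pos
  apply le_of_sq_le_sq _ (by positivity)
  have h2 : (n : ℝ) * Real.logb 2 n ≤ u ^ 8 * u ^ 2 := by
    rw [h.pow_eq]
    have := h.log_le
    have := h.one_le_log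
    have := h.n_pos
    gcongr
    linarith
  calc (k : ℝ) ^ 2 ≤ u ^ 8 * u ^ 2 := h.sq_le.trans h2
    _ = (u ^ 5) ^ 2 := by ring

lemma k_pos (h : LargeParameters n k p u) : (0 : ℝ) < k := by
  have := h.u_pos
  exact lt_of_lt_of_le (by positivity) h.le_k

/-- The prefactor `n log n / k²` of `p` is at least 1, so `p` is no smaller than its exponential
factor. -/
lemma inv_le_p (h : LargeParameters n k p u) : u⁻¹ ≤ p := by
  have hk := h.k_pos
  rw [h.p_eq]
  have : 1 ≤ (n : ℝ) * Real.logb 2 n / (k : ℝ) ^ 2 := by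
    rw [le_div_iff₀ (by positivity), one_mul]
    exact h.sq_le
  exact h.inv_le.trans (le_mul_of_one_le_left (Real.exp_pos _).le this)

lemma p_pos (h : LargeParameters n k p u) : 0 < p :=
  (inv_pos.2 h.u_pos).trans_le h.inv_le_p

lemma seedSize_le (h : LargeParameters n k p u) :
    (seedSize 1 n : ℝ) ≤ 2 * Real.logb 2 n + 1 := by
  have := h.one_le_log
  rw [seedSize]
  refine (Nat.ceil_lt_add_one (by positivity)).le.trans_eq ?_
  norm_num

lemma pow_le_pn (h : LargeParameters n k p u) : u ^ 7 ≤ p * n := by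
  have hu := h.u_pos
  calc u ^ 7 = u⁻¹ * u ^ 8 := by field_simp
    _ ≤ p * n := by
      rw [h.pow_eq]
      have := h.inv_le_p
      gcongr

/-- The filter dominates: `pn ≥ u⁷` exceeds `k ≤ u⁵` as well as the seed size, which is below `u²`.
-/
lemma runningTime_le (h : LargeParameters n k p u) (V₁ V₂ : Finset (Fin n)) :
    (runningTime (subsampleAndFilter V₁ V₂ k p) : ℝ) ≤ 200 * (p * (n : ℝ) ^ 2) := by
  have hu := h.u_pos
  have hp := h.p_pos
  have hn := h.n_pos
  have hpn := h.pow_le_pn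
  have h8 := h.eight_le
  have hQ : ∀ m : ℕ, (m : ℝ) ≤ p * n → m ≤ ⌊p * n⌋₊ := fun m hm => Nat.le_floor hm
  have hQn : ⌊p * n⌋₊ ≤ n := by
    have : p * n ≤ n := mul_le_of_le_one_left hn.le h.p_le
    exact (Nat.floor_le_floor this).trans_eq (Nat.floor_natCast n)
  have h1 : (runningTime (subsampleAndFilter V₁ V₂ k p) : ℝ) ≤
      40 * ((n + seedSize 1 n + 1) * (seedSize 1 n + 1)) + 10 * ((k + ⌊p * n⌋₊) * (n + 1)) := by
    exact_mod_cast runningTime_subsampleAndFilter_le V₁ V₂ k p hQ hQn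
  have hQ' : (⌊p * n⌋₊ : ℝ) ≤ p * n := Nat.floor_le (by positivity)
  have hu57 : u ^ 5 ≤ u ^ 7 := pow_le_pow_right₀ (by linarith) (by norm_num)
  have hu27 : u ^ 2 ≤ u ^ 7 := pow_le_pow_right₀ (by linarith) (by norm_num)
  have hk : (k : ℝ) ≤ p * n := h.k_le.trans (hu57.trans hpn)
  have hs : (seedSize 1 n : ℝ) + 1 ≤ p * n := by
    have := h.seedSize_le
    have := h.log_le
    have := h.one_le_log
    linarith
  have hpnn : p * n ≤ n := mul_le_of_le_one_left hn.le h.p_le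
  have hn1 : (1 : ℝ) ≤ n := by
    have : 1 ≤ n := by have := h.n_ge; omega
    exact_mod_cast this
  have h2 : ((n : ℝ) + seedSize 1 n + 1) * (seedSize 1 n + 1) ≤ (2 * n) * (p * n) := by
    gcongr
    linarith
  have h3 : ((k : ℝ) + ⌊p * n⌋₊) * (n + 1) ≤ (2 * (p * n)) * (2 * n) := by
    gcongr
    · linarith
    · linarith
  refine h1.trans ?_
  have h4 : 0 ≤ p * (n : ℝ) ^ 2 := by positivity
  linarith

/-- The fraction `5/8` works because `(5/8)² < 1/2`: the term is at most `(25/32)^(log n)`, and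
`(25/32)⁸ ≤ 1/2` turns this into `n^(-1/8)`. -/
lemma final_term_le (h : LargeParameters n k p u) :
    (n : ℝ) * (5 / 8) ^ seedSize 1 n ≤ u⁻¹ := by
  have hu := h.u_pos
  have hn := h.n_pos
  set L := Real.logb 2 n with hL
  have hL1 := h.one_le_log
  have hnL : (2 : ℝ) ^ L = n := Real.rpow_logb two_pos (by norm_num) hn
  have h1 : ((5 : ℝ) / 8) ^ seedSize 1 n ≤ (25 / 64 : ℝ) ^ L := by
    have h2 : 2 * L ≤ (seedSize 1 n : ℝ) := by
      rw [seedSize]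
      refine (le_of_eq ?_).trans (Nat.le_ceil _)
      norm_num [hL]
    rw [← Real.rpow_natCast]
    refine (Real.rpow_le_rpow_of_exponent_ge (by norm_num) (by norm_num) h2).trans_eq ?_
    rw [Real.rpow_mul (by norm_num)]
    norm_num
  have h3 : ((n : ℝ) * (25 / 64 : ℝ) ^ L) = (25 / 32 : ℝ) ^ L := by
    rw [← hnL, ← Real.mul_rpow (by norm_num) (by norm_num)]
    norm_num
  have h4 : (25 / 32 : ℝ) ^ L ≤ u⁻¹ := by
    refine le_of_pow_le_pow_left₀ (n := 8) (by norm_num) (by positivity) ?_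
    rw [inv_pow, h.pow_eq, ← hnL, ← Real.rpow_natCast, ← Real.rpow_mul (by norm_num), mul_comm,
      Real.rpow_mul (by norm_num), ← Real.inv_rpow (by norm_num)]
    refine Real.rpow_le_rpow (by positivity) ?_ (by linarith)
    norm_num
  calc (n : ℝ) * (5 / 8) ^ seedSize 1 n ≤ n * (25 / 64 : ℝ) ^ L := by gcongr
    _ ≤ u⁻¹ := h3.le.trans h4

lemma inv_n_le (h : LargeParameters n k p u) : (n : ℝ)⁻¹ ≤ u⁻¹ := by
  have hu := h.u_pos
  rw [← h.pow_eq]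
  exact inv_anti₀ hu (le_self_pow₀ (by linarith [h.eight_le]) (by norm_num))

lemma exp_terms_le (h : LargeParameters n k p u) {m : ℝ} (hm : 1000 * Real.logb 2 n ≤ m) :
    n * Real.exp (-m / 200) ≤ u⁻¹ ∧ 2 ^ seedSize 1 n * Real.exp (-m / 5) ≤ 2 * u⁻¹ := by
  have hn := h.n_pos
  have hL1 := h.one_le_log
  have hn1 : (1 : ℝ) ≤ n := by
    have : 1 ≤ n := by have := h.n_ge; omega
    exact_mod_cast this
  set L := Real.logb 2 n with hL
  have hexp : Real.exp (-L) ≤ (n : ℝ)⁻¹ := exp_neg_logb_le hn1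
  have hexp2 : Real.exp (-2 * L) ≤ ((n : ℝ) ^ 2)⁻¹ := exp_neg_two_logb_le hn1
  constructor
  · calc (n : ℝ) * Real.exp (-m / 200) ≤ n * Real.exp (-2 * L) := by
          gcongr
          linarith
      _ ≤ n * ((n : ℝ) ^ 2)⁻¹ := by gcongr
      _ = (n : ℝ)⁻¹ := by field_simp
      _ ≤ u⁻¹ := h.inv_n_le
  · have hs : (2 : ℝ) ^ seedSize 1 n ≤ 2 * (n : ℝ) ^ 2 := by
      have hnL : (2 : ℝ) ^ L = n := Real.rpow_logb two_pos (by norm_num) hn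
      rw [← Real.rpow_natCast]
      refine (Real.rpow_le_rpow_of_exponent_le one_le_two h.seedSize_le).trans_eq ?_
      rw [Real.rpow_add two_pos, Real.rpow_one, mul_comm 2 (Real.logb 2 n),
        Real.rpow_mul two_pos.le, ← hL, hnL, mul_comm]
      norm_num
    calc (2 : ℝ) ^ seedSize 1 n * Real.exp (-m / 5) ≤
          2 * (n : ℝ) ^ 2 * (Real.exp (-2 * L) * Real.exp (-L)) := by
          rw [← Real.exp_add]
          gcongr
          linarith
      _ ≤ 2 * (n : ℝ) ^ 2 * (((n : ℝ) ^ 2)⁻¹ * (n : ℝ)⁻¹) := by gcongr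
      _ = 2 * (n : ℝ)⁻¹ := by field_simp
      _ ≤ 2 * u⁻¹ := mul_le_mul_of_nonneg_left h.inv_n_le two_pos.le

/-- With `x = k²/n`, the bound `k ≥ 40√n` gives `k/4 - 2√n ≥ k/5`, so the filter gains
`exp(-4x/25)`. As `x` is large, `7680 ≤ exp(x/12)`, and `1/12 - 4/25 + 1/48 ≤ -1/24`. The constant
is `120 · 8²`, from `120 B log n ≤ m²` with `m = pk/8`. -/
lemma filter_exponent_le (h : LargeParameters n k p u) :
    7680 * Real.exp (-4 * ((k : ℝ) / 4 - 2 * Real.sqrt n) ^ 2 / n) *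
      Real.exp ((k : ℝ) ^ 2 / (48 * n)) ≤ Real.exp (-(k : ℝ) ^ 2 / (24 * n)) := by
  have hu := h.u_pos
  have hn := h.n_pos
  have hk := h.le_k
  have hkpos := h.k_pos
  set x : ℝ := (k : ℝ) ^ 2 / n with hx
  have hx5 : 100000 ≤ x := by
    rw [hx, le_div_iff₀ hn]
    exact h.le_sq
  have e1 : (k : ℝ) ^ 2 / (48 * n) = x / 48 := by rw [hx]; field_simp
  have e2 : -(k : ℝ) ^ 2 / (24 * n) = -(x / 24) := by rw [hx]; field_simp
  have e3 : -4 * ((k : ℝ) / 4 - 2 * Real.sqrt n) ^ 2 / n ≤ -(4 / 25 * x) := by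
    rw [div_le_iff₀ hn, h.sqrt_eq]
    have h1 : (k : ℝ) / 5 ≤ k - 8 * u ^ 4 - 3 / 5 * k := by linarith
    have h2 : (4 / 5 * (k : ℝ)) ^ 2 ≤ (k - 8 * u ^ 4) ^ 2 :=
      pow_le_pow_left₀ (by positivity) (by linarith) 2
    have h3 : -(4 / 25 * x) * n = -(4 / 25 * (k : ℝ) ^ 2) := by
      rw [hx]; field_simp
    rw [h3]
    linarith
  have h7680 : (7680 : ℝ) ≤ Real.exp (x / 12) := by
    linarith [Real.add_one_le_exp (x / 12)]
  rw [e1, e2]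
  calc 7680 * Real.exp (-4 * ((k : ℝ) / 4 - 2 * Real.sqrt n) ^ 2 / n) * Real.exp (x / 48) ≤
        Real.exp (x / 12) * Real.exp (-(4 / 25 * x)) * Real.exp (x / 48) := by gcongr
    _ = Real.exp (x / 12 + -(4 / 25 * x) + x / 48) := by rw [Real.exp_add, Real.exp_add]
    _ ≤ Real.exp (-(x / 24)) := Real.exp_le_exp.2 (by linarith)

lemma failureProbability_le (h : LargeParameters n k p u) (hkn : k ≤ n) {V₁ V₂ : Finset (Fin n)}
    (hV : Disjoint V₁ V₂) (hV₁ : V₁.card = n / 2) (hV₂ : V₂.card = n / 2) :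
    failureProbability k hkn (subsampleAndFilter V₁ V₂ k p) ≤
      20 * Real.exp (-(k : ℝ) ^ 2 / (48 * n)) := by
  have hu := h.u_pos
  have h8 := h.eight_le
  have hn := h.n_pos
  have hk := h.le_k
  have hkpos := h.k_pos
  have hp := h.p_pos
  have hL1 := h.one_le_log
  set q := Real.exp (-4 * ((k : ℝ) / 4 - 2 * Real.sqrt n) ^ 2 / n) with hq
  have hq0 : 0 < q := Real.exp_pos _
  set E := Real.exp ((k : ℝ) ^ 2 / (48 * n)) with hE
  have hE0 : 0 < E := Real.exp_pos _
  -- At most `pnq` outsiders are expected to pass. The slack `E` makes the Markov error exactly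
  -- `exp(-k²/48n)` and still fits into `filter_exponent_le`.
  set B := p * n * q * E with hB
  set m := p * k / 8 with hm
  have hmu : u ^ 2 ≤ m := by
    have h1 : u⁻¹ * (40 * u ^ 4) ≤ p * k := by
      have := h.inv_le_p
      gcongr
    have h2 : u⁻¹ * (40 * u ^ 4) = 40 * u ^ 3 := by field_simp
    have h3 : u ^ 2 ≤ u ^ 3 := pow_le_pow_right₀ (by linarith) (by norm_num)
    have h4 : 0 < u ^ 3 := by positivity
    rw [hm]
    linarith
  have hmL : 1000 * Real.logb 2 n ≤ m := h.log_le.trans hmu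
  have hm0 : 0 < m := by linarith
  have hmB : 120 * B * Real.logb 2 n ≤ m ^ 2 := by
    have h1 : p * (k : ℝ) ^ 2 = n * Real.logb 2 n * Real.exp (-(k : ℝ) ^ 2 / (24 * n)) := by
      rw [h.p_eq]; field_simp
    have h2 : 7680 * q * E ≤ Real.exp (-(k : ℝ) ^ 2 / (24 * n)) := h.filter_exponent_le
    have h3 : n * Real.logb 2 n * (7680 * q * E) ≤ p * (k : ℝ) ^ 2 := by
      rw [h1]; gcongr
    calc 120 * B * Real.logb 2 n = p / 64 * (n * Real.logb 2 n * (7680 * q * E)) := by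
          rw [hB]; ring
      _ ≤ p / 64 * (p * (k : ℝ) ^ 2) := by gcongr
      _ = m ^ 2 := by rw [hm]; ring
  have hmain := failureProbability_subsampleAndFilter_le (p := p) (B := B) (m := m) h.n_ge hkn hV
    hV₁ hV₂ (by rw [h.sqrt_eq]; have : 0 < u ^ 4 := by positivity
                linarith) hp h.p_le (by positivity) hm (by linarith) (by linarith) hmB
  obtain ⟨t1, t2⟩ := h.exp_terms_le hmL
  have t3 := h.final_term_le
  have t4 : p * n * q / B = Real.exp (-(k : ℝ) ^ 2 / (48 * n)) := by
    rw [neg_div, Real.exp_neg, ← hE, hB]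
    field_simp
  have t5 : 2 * (k : ℝ) / n ≤ 2 * u⁻¹ := by
    rw [div_le_iff₀ hn, ← h.pow_eq]
    have h1 : u ^ 5 ≤ u ^ 7 := pow_le_pow_right₀ (by linarith) (by norm_num)
    have h2 : 2 * u⁻¹ * u ^ 8 = 2 * u ^ 7 := by field_simp
    rw [h2]
    linarith [h.k_le]
  have t6 : 10 / m ≤ 10 * u⁻¹ := by
    rw [← div_eq_mul_inv]
    have : u ≤ m := (le_self_pow₀ (by linarith) (by norm_num)).trans hmu
    gcongr
  have t7 : u⁻¹ ≤ Real.exp (-(k : ℝ) ^ 2 / (48 * n)) := by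
    refine h.inv_le.trans (Real.exp_le_exp.2 ?_)
    rw [div_le_div_iff₀ (by positivity) (by positivity)]
    have : 0 ≤ (k : ℝ) ^ 2 * n := by positivity
    linarith
  have t8 := Real.exp_pos (-(k : ℝ) ^ 2 / (48 * n))
  rw [t4] at hmain
  linarith

end LargeParameters

end Parameters

/-! ### Asymptotics -/

section Asymptotic

lemma tendsto_logb_natCast : Tendsto (fun n : ℕ => Real.logb 2 n) atTop atTop :=
  (Real.tendsto_logb_atTop one_lt_two).comp tendsto_natCast_atTop_atTop

variable {k : ℕ → ℕ}

lemma eventually_mul_logb_logb_le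
    (hlower : (fun n : ℕ => Real.sqrt (n * Real.logb 2 (Real.logb 2 n))) =o[atTop]
      fun n => (k n : ℝ)) {C : ℝ} (hC : 0 < C) :
    ∀ᶠ n : ℕ in atTop, C * (n * Real.logb 2 (Real.logb 2 n)) ≤ (k n : ℝ) ^ 2 := by
  filter_upwards [hlower.def (c := (Real.sqrt C)⁻¹) (by positivity)] with n hn
  rw [Real.norm_of_nonneg (Real.sqrt_nonneg _), Real.norm_of_nonneg (Nat.cast_nonneg _),
    Real.sqrt_le_left (by positivity), mul_pow, inv_pow, Real.sq_sqrt hC.le] at hn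
  calc C * (n * Real.logb 2 (Real.logb 2 n)) ≤ C * (C⁻¹ * (k n : ℝ) ^ 2) := by gcongr
    _ = (k n : ℝ) ^ 2 := by field_simp

lemma eventually_sq_le_mul_logb
    (hupper : (fun n : ℕ => (k n : ℝ)) =o[atTop] fun n => Real.sqrt (n * Real.logb 2 n)) :
    ∀ᶠ n : ℕ in atTop, (k n : ℝ) ^ 2 ≤ n * Real.logb 2 n := by
  filter_upwards [hupper.def one_pos, tendsto_logb_natCast.eventually_ge_atTop 0] with n hn h0
  rw [Real.norm_of_nonneg (Real.sqrt_nonneg _), Real.norm_of_nonneg (Nat.cast_nonneg _),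
    one_mul] at hn
  calc (k n : ℝ) ^ 2 ≤ Real.sqrt (n * Real.logb 2 n) ^ 2 := by gcongr
    _ = n * Real.logb 2 n := Real.sq_sqrt (by positivity)

lemma eventually_const_mul_le_sq
    (hlower : (fun n : ℕ => Real.sqrt (n * Real.logb 2 (Real.logb 2 n))) =o[atTop]
      fun n => (k n : ℝ)) {C : ℝ} (hC : 0 < C) :
    ∀ᶠ n : ℕ in atTop, C * n ≤ (k n : ℝ) ^ 2 := by
  filter_upwards [eventually_mul_logb_logb_le hlower hC,
    ((Real.tendsto_logb_atTop one_lt_two).comp tendsto_logb_natCast).eventually_ge_atTop 1]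
    with n hn h1
  refine le_trans ?_ hn
  have h1' : 1 ≤ Real.logb 2 (Real.logb 2 n) := h1
  gcongr
  exact le_mul_of_one_le_right (Nat.cast_nonneg _) h1'

/-- Since `k²` exceeds `c (d + 1) n log log n`, the exponential is at most `(log n)^(-d)`. The
summand 1 only keeps the constant positive when `d = 0`. -/
lemma eventually_logb_pow_mul_exp_le_one
    (hlower : (fun n : ℕ => Real.sqrt (n * Real.logb 2 (Real.logb 2 n))) =o[atTop]
      fun n => (k n : ℝ)) {c : ℝ} (hc : 0 < c) (d : ℕ) :
    ∀ᶠ n : ℕ in atTop, Real.logb 2 n ^ d * Real.exp (-(k n : ℝ) ^ 2 / (c * n)) ≤ 1 := by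
  filter_upwards [eventually_mul_logb_logb_le hlower (C := c * (d + 1)) (by positivity),
    tendsto_logb_natCast.eventually_ge_atTop 1, eventually_gt_atTop 0] with n hn h1 h0
  set L := Real.logb 2 n
  have hn0 : (0 : ℝ) < n := Nat.cast_pos.2 h0
  have hL0 : 0 ≤ Real.logb 2 L := Real.logb_nonneg one_lt_two h1
  have hexp : -(k n : ℝ) ^ 2 / (c * n) ≤ d * -Real.logb 2 L := by
    rw [div_le_iff₀ (by positivity)]
    have : 0 ≤ c * (n * Real.logb 2 L) := by positivity
    linarith
  calc L ^ d * Real.exp (-(k n : ℝ) ^ 2 / (c * n)) ≤ L ^ d * Real.exp (d * -Real.logb 2 L) := by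
        gcongr
    _ = L ^ d * Real.exp (-Real.logb 2 L) ^ d := by rw [Real.exp_nat_mul]
    _ ≤ L ^ d * L⁻¹ ^ d := by
        gcongr
        exact exp_neg_logb_le h1
    _ = 1 := by rw [← mul_pow, mul_inv_cancel₀ (by positivity), one_pow]

lemma logb_two_le_two_mul_log {x : ℝ} (hx : 1 ≤ x) : Real.logb 2 x ≤ 2 * Real.log x := by
  rw [Real.logb, div_le_iff₀ (Real.log_pos one_lt_two)]
  have h1 := Real.log_two_gt_d9
  have h2 := Real.log_nonneg hx
  nlinarith

lemma eventually_largeParameters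
    (hlower : (fun n : ℕ => Real.sqrt (n * Real.logb 2 (Real.logb 2 n))) =o[atTop]
      fun n => (k n : ℝ))
    (hupper : (fun n : ℕ => (k n : ℝ)) =o[atTop] fun n => Real.sqrt (n * Real.logb 2 n))
    {p : ℕ → ℝ}
    (hp : ∀ n : ℕ, p n =
      (n : ℝ) * Real.logb 2 n / (k n : ℝ) ^ 2 * Real.exp (-(k n : ℝ) ^ 2 / (24 * n))) :
    ∀ᶠ n : ℕ in atTop, LargeParameters n (k n) (p n) ((n : ℝ) ^ (1 / 8 : ℝ)) := by
  have hlog := (isLittleO_log_rpow_atTop (r := 1 / 4) (by norm_num)).comp_tendsto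
    (tendsto_natCast_atTop_atTop (R := ℝ))
  filter_upwards [hlog.def (c := 1 / 2000) (by norm_num), eventually_sq_le_mul_logb hupper,
    eventually_const_mul_le_sq hlower (C := 100000) (by norm_num),
    eventually_logb_pow_mul_exp_le_one hlower (c := 24) (by norm_num) 1,
    tendsto_logb_natCast.eventually_ge_atTop 1,
    ((tendsto_rpow_atTop (y := 1 / 8) (by norm_num)).comp
      (tendsto_natCast_atTop_atTop (R := ℝ))).eventually_ge_atTop 8, eventually_ge_atTop 1]
    with n hn hsq hle hexp hL h8 hn1
  have hn1' : (1 : ℝ) ≤ n := Nat.one_le_cast.2 hn1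
  have hn0 : (0 : ℝ) < n := by linarith
  have hlog2 := logb_two_le_two_mul_log hn1'
  refine ⟨?_, h8, hL, ?_, hp n, ?_, hle, hsq, ?_⟩
  · rw [← Real.rpow_mul_natCast hn0.le]
    norm_num
  · have h1 : Real.log n ≤ 1 / 2000 * (n : ℝ) ^ (1 / 4 : ℝ) := by
      have := (le_abs_self _).trans hn
      simpa [abs_of_nonneg (Real.rpow_nonneg hn0.le _)] using this
    have h2 : ((n : ℝ) ^ (1 / 8 : ℝ)) ^ 2 = (n : ℝ) ^ (1 / 4 : ℝ) := by
      rw [← Real.rpow_mul_natCast hn0.le]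
      norm_num
    rw [h2]
    linarith
  · have hk : (n : ℝ) / (k n : ℝ) ^ 2 ≤ 1 := div_le_one_of_le₀ (by linarith) (by positivity)
    rw [pow_one] at hexp
    calc p n = (n : ℝ) / (k n : ℝ) ^ 2 *
          (Real.logb 2 n * Real.exp (-(k n : ℝ) ^ 2 / (24 * n))) := by rw [hp]; ring
      _ ≤ 1 := mul_le_one₀ hk (by positivity) hexp
  -- From `k² ≤ n log n` the exponent `k²/24n` is at most a twelfth of the natural logarithm of `n`,
  -- hence below an eighth of it.
  · rw [← Real.rpow_neg hn0.le, Real.rpow_def_of_pos hn0, Real.exp_le_exp,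
      le_div_iff₀ (by positivity)]
    have h1 : (n : ℝ) * Real.logb 2 n ≤ n * (2 * Real.log n) := by gcongr
    have h2 : 0 ≤ (n : ℝ) * Real.log n := mul_nonneg hn0.le (Real.log_nonneg hn1')
    linarith

/-- Boundedness with one more power of the logarithm yields a factor `1 / log n`, which tends to
zero. -/
lemma isLittleO_logb_pow_mul_div_exp
    (hlower : (fun n : ℕ => Real.sqrt (n * Real.logb 2 (Real.logb 2 n))) =o[atTop]
      fun n => (k n : ℝ)) (d : ℕ) :
    (fun n : ℕ => Real.logb 2 n ^ d * ((n : ℝ) ^ 2 / Real.exp ((k n : ℝ) ^ 2 / (24 * n))))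
      =o[atTop] fun n : ℕ => (n : ℝ) ^ 2 := by
  refine IsLittleO.of_bound fun c hc => ?_
  filter_upwards [eventually_logb_pow_mul_exp_le_one hlower (c := 24) (by norm_num) (d + 1),
    tendsto_logb_natCast.eventually_ge_atTop (max 1 c⁻¹)] with n hexp hL
  have h1 : 1 ≤ Real.logb 2 n := (le_max_left _ _).trans hL
  have h2 : c⁻¹ ≤ Real.logb 2 n := (le_max_right _ _).trans hL
  have h3 : Real.logb 2 n ^ d * Real.exp (-(k n : ℝ) ^ 2 / (24 * n)) ≤ c := by
    rw [pow_succ, mul_right_comm] at hexp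
    rw [← one_div, div_le_iff₀ hc] at h2
    have := mul_le_mul_of_nonneg_right hexp hc.le
    have h4 : 0 ≤ Real.logb 2 n ^ d * Real.exp (-(k n : ℝ) ^ 2 / (24 * n)) := by positivity
    nlinarith
  rw [Real.norm_of_nonneg (by positivity), Real.norm_of_nonneg (by positivity)]
  calc Real.logb 2 n ^ d * ((n : ℝ) ^ 2 / Real.exp ((k n : ℝ) ^ 2 / (24 * n))) =
        Real.logb 2 n ^ d * Real.exp (-(k n : ℝ) ^ 2 / (24 * n)) * (n : ℝ) ^ 2 := by
          rw [neg_div, Real.exp_neg]; ring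
    _ ≤ c * (n : ℝ) ^ 2 := by gcongr

lemma isBigO_mul_exp_logb_mul_div_exp
    (hlower : (fun n : ℕ => Real.sqrt (n * Real.logb 2 (Real.logb 2 n))) =o[atTop]
      fun n => (k n : ℝ)) :
    (fun n : ℕ =>
      (n : ℝ) ^ 3 * Real.logb 2 n / (k n : ℝ) ^ 2 * Real.exp (-(k n : ℝ) ^ 2 / (24 * n)))
        =O[atTop] fun n : ℕ =>
          Real.logb 2 n ^ 1 * ((n : ℝ) ^ 2 / Real.exp ((k n : ℝ) ^ 2 / (24 * n))) := by
  refine IsBigO.of_bound 1 ?_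
  filter_upwards [eventually_const_mul_le_sq hlower one_pos,
    tendsto_logb_natCast.eventually_ge_atTop 1] with n hle hL
  rw [Real.norm_of_nonneg (by positivity), Real.norm_of_nonneg (by positivity), one_mul]
  have hk : (n : ℝ) / (k n : ℝ) ^ 2 ≤ 1 := div_le_one_of_le₀ (by linarith) (by positivity)
  calc (n : ℝ) ^ 3 * Real.logb 2 n / (k n : ℝ) ^ 2 * Real.exp (-(k n : ℝ) ^ 2 / (24 * n)) =
        (n : ℝ) / (k n : ℝ) ^ 2 *
          (Real.logb 2 n ^ 1 * ((n : ℝ) ^ 2 / Real.exp ((k n : ℝ) ^ 2 / (24 * n)))) := by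
        rw [neg_div, Real.exp_neg]; ring
    _ ≤ 1 * (Real.logb 2 n ^ 1 * ((n : ℝ) ^ 2 / Real.exp ((k n : ℝ) ^ 2 / (24 * n)))) := by
        gcongr
    _ = _ := one_mul _

lemma isBigO_exp_one_div_logb
    (hlower : (fun n : ℕ => Real.sqrt (n * Real.logb 2 (Real.logb 2 n))) =o[atTop]
      fun n => (k n : ℝ)) :
    (fun n : ℕ => Real.exp (-(k n : ℝ) ^ 2 / (48 * n))) =O[atTop]
      fun n : ℕ => 1 / Real.logb 2 n := by
  refine IsBigO.of_bound 1 ?_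
  filter_upwards [eventually_logb_pow_mul_exp_le_one hlower (c := 48) (by norm_num) 1,
    tendsto_logb_natCast.eventually_ge_atTop 1] with n hexp hL
  rw [Real.norm_of_nonneg (by positivity), Real.norm_of_nonneg (by positivity), one_mul,
    le_div_iff₀ (by positivity), mul_comm]
  simpa using hexp

end Asymptotic

end PlantedClique

end

theorem theorem3
    -- the clique size, with `k = ω(√(n log log n))` and `k = o(√(n log n))`
    (k : ℕ → ℕ) (hkn : ∀ n, k n ≤ n)
    (hlower : (fun n : ℕ => Real.sqrt (n * Real.logb 2 (Real.logb 2 n))) =o[atTop]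
      fun n => (k n : ℝ))
    (hupper : (fun n : ℕ => (k n : ℝ)) =o[atTop] fun n => Real.sqrt (n * Real.logb 2 n))
    -- the subsampling fraction
    (p : ℕ → ℝ)
    (hp : ∀ n : ℕ, p n =
      (n : ℝ) * Real.logb 2 n / (k n : ℝ) ^ 2 * Real.exp (-(k n : ℝ) ^ 2 / (24 * n)))
    -- the two disjoint halves of the vertex set
    (V₁ V₂ : ∀ n, Finset (Fin n)) (hdisj : ∀ n, Disjoint (V₁ n) (V₂ n))
    (hV₁ : ∀ n, (V₁ n).card = n / 2) (hV₂ : ∀ n, (V₂ n).card = n / 2)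
    -- the worst-case running time and the failure probability of the algorithm
    (T err : ℕ → ℝ)
    (hT : ∀ n, T n =
      PlantedClique.runningTime (PlantedClique.subsampleAndFilter (V₁ n) (V₂ n) (k n) (p n)))
    (herr : ∀ n, err n = PlantedClique.failureProbability (k n) (hkn n)
      (PlantedClique.subsampleAndFilter (V₁ n) (V₂ n) (k n) (p n))) :
    -- running time `O(pn²)`
    (T =O[atTop] fun n : ℕ => p n * (n : ℝ) ^ 2) ∧
    -- `O(pn²) = O((n³ log n / k²) exp(-k²/24n))`
    ((fun n : ℕ => p n * (n : ℝ) ^ 2) =O[atTop] fun n : ℕ =>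
      (n : ℝ) ^ 3 * Real.logb 2 n / (k n : ℝ) ^ 2 * Real.exp (-(k n : ℝ) ^ 2 / (24 * n))) ∧
    -- `= Õ(n² / exp(k²/24n))`
    (∃ d : ℕ, (fun n : ℕ =>
      (n : ℝ) ^ 3 * Real.logb 2 n / (k n : ℝ) ^ 2 * Real.exp (-(k n : ℝ) ^ 2 / (24 * n)))
        =O[atTop] fun n : ℕ =>
          Real.logb 2 n ^ d * ((n : ℝ) ^ 2 / Real.exp ((k n : ℝ) ^ 2 / (24 * n)))) ∧
    -- `= o(n²)`, for every power of the logarithm hidden in `Õ`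
    (∀ d : ℕ, (fun n : ℕ =>
      Real.logb 2 n ^ d * ((n : ℝ) ^ 2 / Real.exp ((k n : ℝ) ^ 2 / (24 * n))))
        =o[atTop] fun n : ℕ => (n : ℝ) ^ 2) ∧
    -- so the running time is sublinear in the size of the input
    (T =o[atTop] fun n : ℕ => (n : ℝ) ^ 2) ∧
    -- failure probability `O(exp(-k²/48n))`
    (err =O[atTop] fun n : ℕ => Real.exp (-(k n : ℝ) ^ 2 / (48 * n))) ∧
    -- `O(exp(-k²/48n)) = O(1 / log n)`
    ((fun n : ℕ => Real.exp (-(k n : ℝ) ^ 2 / (48 * n))) =O[atTop]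
      fun n : ℕ => 1 / Real.logb 2 n) := by
  have hlarge := PlantedClique.eventually_largeParameters hlower hupper hp
  have hpn : ∀ n : ℕ, p n * (n : ℝ) ^ 2 =
      (n : ℝ) ^ 3 * Real.logb 2 n / (k n : ℝ) ^ 2 * Real.exp (-(k n : ℝ) ^ 2 / (24 * n)) := by
    intro n
    rw [hp]
    ring
  have htime : T =O[atTop] fun n : ℕ => p n * (n : ℝ) ^ 2 := by
    refine IsBigO.of_bound 200 ?_
    filter_upwards [hlarge] with n h
    rw [hT, Real.norm_of_nonneg (Nat.cast_nonneg _)]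
    exact (h.runningTime_le (V₁ n) (V₂ n)).trans
      (mul_le_mul_of_nonneg_left (le_abs_self _) (by norm_num))
  have heq : (fun n : ℕ => p n * (n : ℝ) ^ 2) =O[atTop] fun n : ℕ =>
      (n : ℝ) ^ 3 * Real.logb 2 n / (k n : ℝ) ^ 2 * Real.exp (-(k n : ℝ) ^ 2 / (24 * n)) := by
    simp only [hpn]
    exact isBigO_refl _ _
  have htilde := PlantedClique.isBigO_mul_exp_logb_mul_div_exp hlower
  have hsmall := PlantedClique.isLittleO_logb_pow_mul_div_exp hlower
  -- One logarithm suffices in `Õ`, because `n/k²` is eventually at most 1.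
  refine ⟨htime, heq, ⟨1, htilde⟩, hsmall,
    ((htime.trans heq).trans htilde).trans_isLittleO (hsmall 1), ?_,
    PlantedClique.isBigO_exp_one_div_logb hlower⟩
  refine IsBigO.of_bound 20 ?_
  filter_upwards [hlarge] with n h
  have h0 : 0 ≤ err n := (herr n).symm ▸ ENNReal.toReal_nonneg
  rw [Real.norm_of_nonneg h0, Real.norm_of_nonneg (Real.exp_pos _).le, herr]
  exact h.failureProbability_le (hkn n) (hdisj n) (hV₁ n) (hV₂ n)
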